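/- Let $\mathcal S^{\sharp\flat}$ be the class of functions $F$, not identically zero, such that: (i) $F(s)=\sum_{n\ge1}a_F(n)n^{-s}$, converging absolutely for $\operatorname{Re}s>1$; (ii) for some integer $m\ge 0$ the function $(s-1)^mF(s)$ is entire of finite order; the smallest such $m$ is denoted $m_F$; (iii) the function $\xi_F(s)=s^{m_F}(1-s)^{m_F}F(s)Q_F^s\prod_{j=1}^r\Gamma(\lambda_js+\mu_j)$ satisfies $\xi_F(s)=w\,\overline{\xi_F(1-\bar s)}$, where $Q_F>0$, $r\ge0$, $\lambda_j>0$, $|w|=1$, $\operatorname{Re}\mu_j>-\tfrac14$ and $\operatorname{Re}(\lambda_j+2\mu_j)>0$; (iv) $\frac{F'}{F}(s)=-\sum_{n\ge2}c_F(n)n^{-s}$, converging absolutely for $\operatorname{Re}s>1$. Let $Z(F)$ be the set of zeros of $\xi_F$ (the non-trivial zeros of $F$). All sums and counts over $Z(F)$ take multiplicities into account. GRH for $F$ is the assertion that $\operatorname{Re}\rho=\frac12$ for all $\rho\in Z(F)$. Let $N_F(x)$ be the number of $\rho\in Z(F)$ with $|\operatorname{Im}\rho|\le x$, and, if $0\notin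 Z(F)$, put $$\lambda_F(n)=\lim_{T\to\infty}\sum_{\rho\in Z(F),\ |\operatorname{Im}\rho|\le T}\Bigl(1-\Bigl(1-\frac1\rho\Bigr)^n\Bigr).$$ Let $T_n$ and $U_{n-1}$ be the Chebyshev polynomials of the first and second kind. **Theorem.** Let $F\in\mathcal S^{\sharp\flat}$ with $0\notin Z(F)$. Then $N_F(x)$ is finite for all $x$, the limits $\lambda_F(n)$ exist for all $n\ge1$, and the series and the integral below converge absolutely. Moreover: (a) GRH for $F$ holds if and only if, for every positive integer $n$, $$\operatorname{Re}\lambda_F(n)=\sum_{\rho=\sigma+i\gamma\in Z(F)}\Bigl(1-T_n\Bigl(\frac{4\gamma^2-1}{4\gamma^2+1}\Bigr)\Bigr).$$ (b) If $\frac12\notin Z(F)$, then GRH for $F$ holds if and only if, for every positive integer $n$, $$\operatorname{Re}\lambda_F(n)=16n\int_0^\infty N_F(x)\frac{x}{(4x^2+1)^2}U_{n-1}\Bigl(\frac{4x^2-1}{4x^2+1}\Bigr)dx-(1-(-1)^n)N_F(0).$$ (c) Without the restriction on the point $\frac12$, GRH for $F$ holds if and only if, for every positive integer $n$, $$\operatorname{Re}\lambda_F(n)=16n\int_0^\infty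 N_F(x)\frac{x}{(4x^2+1)^2}U_{n-1}\Bigl(\frac{4x^2-1}{4x^2+1}\Bigr)dx.$$ -/

import Mathlib

/-- `G` is of finite order: `G(s) = O(exp(|s|^A))` as `|s| → ∞`, for some real `A`. -/
def HasFiniteOrder (G : ℂ → ℂ) : Prop :=
  ∃ A : ℝ, G =O[Filter.cocompact ℂ] fun s => Real.exp (‖s‖ ^ A)

/-- `(s - 1) ^ m * F s` is (after removing the singularity at `s = 1`) an entire function of
finite order. The value of `F` at the possible pole `s = 1` plays no role. -/
def IsPolarBound (F : ℂ → ℂ) (m : ℕ) : Prop :=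
  ∃ G : ℂ → ℂ, Differentiable ℂ G ∧ HasFiniteOrder G ∧
    ∀ s : ℂ, s ≠ 1 → G s = (s - 1) ^ m * F s

/-- The polar order `m_F`: the smallest `m` with `(s - 1) ^ m * F s` entire of finite order. -/
noncomputable def polarOrder (F : ℂ → ℂ) : ℕ := sInf {m : ℕ | IsPolarBound F m}

/-- The parameters of the functional equation. -/
structure GammaData where
  /-- the number of gamma factors, possibly `0` -/
  r : ℕ
  /-- the factor `Q_F` -/
  Q : ℝ
  /-- the numbers `λ_j` -/
  lam : Fin r → ℝ
  /-- the numbers `μ_j` -/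
  mu : Fin r → ℂ
  /-- the sign of the functional equation -/
  w : ℂ
  Q_pos : 0 < Q
  lam_pos : ∀ j, 0 < lam j
  mu_re : ∀ j, -(1 / 4 : ℝ) < (mu j).re
  lam_mu : ∀ j, 0 < lam j + 2 * (mu j).re
  norm_w : ‖w‖ = 1

/-- The completed function `ξ_F`. It is the meromorphic function on `ℂ` given by the displayed
product; passing to the normal form gives it its limit value wherever the product has a
removable singularity (at `s = 1`, and where a pole of a gamma factor meets a zero of `F`). -/
noncomputable def xi (F : ℂ → ℂ) (D : GammaData) : ℂ → ℂ :=
  toMeromorphicNFOn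
    (fun s => s ^ polarOrder F * (1 - s) ^ polarOrder F * F s * (D.Q : ℂ) ^ s *
      ∏ j, Complex.Gamma ((D.lam j : ℂ) * s + D.mu j))
    Set.univ

/-- `F` belongs to the class `S^{♯♭}`, with functional equation given by `D`. -/
structure IsSelbergSharpFlat (F : ℂ → ℂ) (D : GammaData) : Prop where
  /-- Dirichlet series, absolutely convergent for `Re s > 1` -/
  dirichlet_series : ∃ a : ℕ → ℂ, ∀ s : ℂ, 1 < s.re → LSeriesHasSum a s (F s)
  /-- analytic continuation -/
  continuation : ∃ m : ℕ, IsPolarBound F m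
  /-- functional equation -/
  functional_equation : ∀ s : ℂ,
    xi F D s = D.w * (starRingEnd ℂ) (xi F D (1 - (starRingEnd ℂ) s))
  /-- `F` is not the zero function, so that `F'/F` makes sense -/
  not_zero : ∃ s : ℂ, 1 < s.re ∧ F s ≠ 0
  /-- Euler sum: `F'/F = -∑_{n ≥ 2} c(n) n^{-s}`, absolutely convergent for `Re s > 1` -/
  euler_sum : ∃ c : ℕ → ℂ, c 1 = 0 ∧
    ∀ s : ℂ, 1 < s.re → LSeriesHasSum c s (-logDeriv F s)

/-- The set `Z(F)` of non-trivial zeros: the zeros of `ξ_F`. -/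
def nontrivialZeros (F : ℂ → ℂ) (D : GammaData) : Set ℂ := {ρ | xi F D ρ = 0}

/-- The multiplicity of a non-trivial zero. -/
noncomputable def zeroMult (F : ℂ → ℂ) (D : GammaData) (ρ : ℂ) : ℕ :=
  analyticOrderNatAt (xi F D) ρ

/-- The non-trivial zeros `ρ` with `|Im ρ| ≤ x`. -/
def zerosUpTo (F : ℂ → ℂ) (D : GammaData) (x : ℝ) : Set ℂ :=
  {ρ | ρ ∈ nontrivialZeros F D ∧ |ρ.im| ≤ x}

/-- The counting function `N_F(x)`, zeros being counted with multiplicity. -/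
noncomputable def zeroCount (F : ℂ → ℂ) (D : GammaData) (x : ℝ) : ℕ :=
  ∑ᶠ ρ ∈ zerosUpTo F D x, zeroMult F D ρ

/-- The partial sum over `|Im ρ| ≤ T` of the series that defines `λ_F(n)`. -/
noncomputable def liPartialSum (F : ℂ → ℂ) (D : GammaData) (n : ℕ) (T : ℝ) : ℂ :=
  ∑ᶠ ρ ∈ zerosUpTo F D T, (zeroMult F D ρ : ℂ) * (1 - (1 - 1 / ρ) ^ n)

/-- The generalized Li coefficient `λ_F(n)`. -/
noncomputable def liCoeff (F : ℂ → ℂ) (D : GammaData) (n : ℕ) : ℂ :=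
  Filter.limUnder Filter.atTop (liPartialSum F D n)

/-- The generalized Riemann hypothesis for `F`. -/
def GRH (F : ℂ → ℂ) (D : GammaData) : Prop :=
  ∀ ρ ∈ nontrivialZeros F D, ρ.re = 1 / 2

/-- The term of the zero `ρ = σ + iγ`, taken with multiplicity:
`1 - T_n((4γ² - 1) / (4γ² + 1))`. -/
noncomputable def chebyshevTerm (F : ℂ → ℂ) (D : GammaData) (n : ℕ) (ρ : ℂ) : ℝ :=
  (zeroMult F D ρ : ℝ) *
    (1 - (Polynomial.Chebyshev.T ℝ (n : ℤ)).eval ((4 * ρ.im ^ 2 - 1) / (4 * ρ.im ^ 2 + 1)))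

/-- The integrand `N_F(x) x / (4x² + 1)² U_{n-1}((4x² - 1) / (4x² + 1))`. -/
noncomputable def chebyshevIntegrand (F : ℂ → ℂ) (D : GammaData) (n : ℕ) (x : ℝ) : ℝ :=
  (zeroCount F D x : ℝ) * (x / (4 * x ^ 2 + 1) ^ 2) *
    (Polynomial.Chebyshev.U ℝ ((n : ℤ) - 1)).eval ((4 * x ^ 2 - 1) / (4 * x ^ 2 + 1))

/-!
Write `z_ρ = 1 - 1 / ρ`. If `Re ρ = 1 / 2`, then `z_ρ` is unimodular with real part
`(4 γ² - 1) / (4 γ² + 1)`, so `Re (1 - z_ρ ^ n) = 1 - T_n((4 γ² - 1) / (4 γ² + 1))`. Since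
`Re λ_F(n)` is the sum of `Re (1 - z_ρ ^ n)` over the zeros, GRH gives the identity
with the Chebyshev series (`re_liCoeff_eq_tsum`). Conversely, if GRH fails, the functional equation provides a zero with
`Re ρ < 1 / 2`, that is with `|z_ρ| > 1`. By the argument of Bombieri and Lagarias, a simultaneous
approximation of the arguments of the largest `z_ρ` makes `Re λ_F(n)` arbitrarily negative
(`exists_hasSum_lt`, `exists_re_liCoeff_lt`), whereas the terms `1 - T_n` of the Chebyshev series
are nonnegative. The integral is the Chebyshev series again
(`integrableOn_and_integral_chebyshevIntegrand`): as `T_n' = n U_{n-1}`, the kernel has the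
primitive `T_n((4 x² - 1) / (4 x² + 1))` up to a constant factor, and `N_F` is the sum of the
indicator functions of `[|γ|, ∞)`. The correction term in the second integral formula is bounded in
`n`, so it does not affect the converse; under GRH it vanishes if `1 / 2` is not a zero.

The analytic substance is the existence of the limits `λ_F(n)`. The function `ξ_F` is entire with
`log |ξ_F(s)| ≪ |s| ^ (9 / 8)`, by Phragmén–Lindelöf (`hasGrowthOn_xi`), so that
`∑ |ρ| ^ (-5 / 4)` converges and `ξ_F'/ξ_F` has a partial fraction expansion
(`hasSum_logDeriv_sub`); this settles everything except the term `n / ρ` of `1 - z_ρ ^ n`. The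
symmetric partial sums of `∑ 1 / ρ` converge provided that the zeros above and below the real axis
are balanced: since the functional equation relates `F` to its conjugate, it does not pair `ρ` with
`conj ρ`. The balance up to `O(T ^ (3 / 4))` (`exists_abs_signedCount_le`) replaces the
Riemann–von Mangoldt formula. It follows from integrating the odd part of
`t ↦ Re (ξ_F'/ξ_F)(2 + i t)` over `0 ≤ t ≤ T`, where `F'/F` has a bounded primitive and the gamma
factors are even up to a shift. Partial summation then gives the convergence
(`exists_tendsto_liPartialSum`).
-/

section

open Complex Filter Topology Metric

/-! ### Zero-free functions on discs and division by zeros -/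

/-- A zero-free holomorphic function on a disc has a holomorphic logarithm there. -/
lemma exists_log_on_ball {g : ℂ → ℂ} {R : ℝ} (hR : 0 < R) (hg : DifferentiableOn ℂ g (ball 0 R))
    (hne : ∀ z ∈ ball (0 : ℂ) R, g z ≠ 0) :
    ∃ L : ℂ → ℂ, L 0 = 0 ∧ (∀ z ∈ ball (0 : ℂ) R, HasDerivAt L (logDeriv g z) z) ∧
      ∀ z ∈ ball (0 : ℂ) R, g z = g 0 * exp (L z) := by
  have hld : DifferentiableOn ℂ (logDeriv g) (ball 0 R) :=
    (hg.deriv isOpen_ball).div hg hne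
  obtain ⟨L, hL0, hL⟩ := (hld.isExactOn_ball).with_val_at 0 0
  have h0 : (0 : ℂ) ∈ ball (0 : ℂ) R := by simpa using hR
  refine ⟨L, hL0, hL, fun z hz => ?_⟩
  have hq : ∀ w ∈ ball (0 : ℂ) R, HasDerivAt (fun w => g w * exp (-L w)) 0 w := by
    intro w hw
    have h1 := ((hg.differentiableAt (isOpen_ball.mem_nhds hw)).hasDerivAt).mul ((hL w hw).neg.cexp)
    convert! h1 using 1
    rw [logDeriv_apply]
    have := hne w hw
    simp only [Pi.neg_apply]
    field_simp
    ring
  have hconst := (convex_ball (0 : ℂ) R).is_const_of_fderivWithin_eq_zero (𝕜 := ℂ)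
    (f := fun w => g w * exp (-L w))
    (fun w hw => (hq w hw).differentiableAt.differentiableWithinAt)
    (fun w hw => by
      rw [fderivWithin_of_isOpen isOpen_ball hw]
      ext
      simpa using (hq w hw).deriv) hz h0
  simp only [hL0, neg_zero, exp_zero, mul_one] at hconst
  rw [← hconst, mul_assoc, ← exp_add]
  simp

/-- Borel–Carathéodory for the logarithmic derivative of a zero-free function. The second bound has
the factor `A / R ^ 2`, which tends to `0` as `R → ∞` when `A` grows more slowly than `R ^ 2`. -/
lemma logDeriv_bounds_of_ball {g : ℂ → ℂ} {R A : ℝ} (hR : 0 < R) (hA : 0 < A)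
    (hg : DifferentiableOn ℂ g (ball 0 R)) (hne : ∀ z ∈ ball (0 : ℂ) R, g z ≠ 0)
    (hb : ∀ z ∈ ball (0 : ℂ) R, ‖g z‖ ≤ Real.exp A * ‖g 0‖) :
    ‖logDeriv g 0‖ ≤ 8 * A / R ∧
      ∀ s : ℂ, ‖s‖ ≤ R / 8 → ‖logDeriv g s - logDeriv g 0‖ ≤ 64 * A / R ^ 2 * ‖s‖ := by
  obtain ⟨L, hL0, hL, hLg⟩ := exists_log_on_ball hR hg hne
  have h0 : (0 : ℂ) ∈ ball (0 : ℂ) R := by simpa using hR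
  have hLd : DifferentiableOn ℂ L (ball 0 R) :=
    fun z hz => (hL z hz).differentiableAt.differentiableWithinAt
  have hre : Set.MapsTo L (ball 0 R) {z | z.re ≤ A} := by
    intro z hz
    have h1 := hb z hz
    rw [hLg z hz, norm_mul, norm_exp, mul_comm] at h1
    have h2 : 0 < ‖g 0‖ := norm_pos_iff.2 (hne 0 h0)
    exact Real.exp_le_exp.1 (le_of_mul_le_mul_right h1 h2)
  have hLb : ∀ z : ℂ, ‖z‖ ≤ R / 2 → ‖L z‖ ≤ 2 * A := by
    intro z hz
    have hzR : z ∈ ball (0 : ℂ) R := by simp; linarith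
    refine (borelCaratheodory_zero hA hLd hre hR hzR hL0).trans ?_
    rw [div_le_iff₀ (by linarith)]
    nlinarith [norm_nonneg z]
  have hsub : ∀ {z : ℂ} {r : ℝ}, ‖z‖ + r < R → closedBall z r ⊆ ball 0 R := by
    intro z r h w hw
    rw [mem_closedBall, dist_eq_norm] at hw
    rw [mem_ball_zero_iff]
    calc ‖w‖ = ‖(w - z) + z‖ := by simp
      _ ≤ ‖w - z‖ + ‖z‖ := norm_add_le _ _
      _ < R := by linarith
  have hL1 : ∀ z : ℂ, ‖z‖ ≤ R / 4 → ‖deriv L z‖ ≤ 8 * A / R := by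
    intro z hz
    have h1 := norm_deriv_le_of_forall_mem_sphere_norm_le (c := z) (R := R / 4) (C := 2 * A)
      (f := L) (by positivity)
      ((hLd.mono (hsub (by linarith))).diffContOnCl_ball subset_rfl) (by
        intro w hw
        rw [mem_sphere, dist_eq_norm] at hw
        refine hLb w ?_
        calc ‖w‖ = ‖(w - z) + z‖ := by simp
          _ ≤ ‖w - z‖ + ‖z‖ := norm_add_le _ _
          _ ≤ R / 2 := by linarith)
    refine h1.trans (le_of_eq ?_)
    field_simp
    ring
  have hL'd : DifferentiableOn ℂ (deriv L) (ball 0 R) := hLd.deriv isOpen_ball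
  have hL2 : ∀ z : ℂ, ‖z‖ ≤ R / 8 → ‖deriv (deriv L) z‖ ≤ 64 * A / R ^ 2 := by
    intro z hz
    have h1 := norm_deriv_le_of_forall_mem_sphere_norm_le (c := z) (R := R / 8) (C := 8 * A / R)
      (f := deriv L) (by positivity)
      ((hL'd.mono (hsub (by linarith))).diffContOnCl_ball subset_rfl) (by
        intro w hw
        rw [mem_sphere, dist_eq_norm] at hw
        refine hL1 w ?_
        calc ‖w‖ = ‖(w - z) + z‖ := by simp
          _ ≤ ‖w - z‖ + ‖z‖ := norm_add_le _ _
          _ ≤ R / 4 := by linarith)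
    refine h1.trans (le_of_eq ?_)
    field_simp
    ring
  have heq : ∀ z ∈ ball (0 : ℂ) R, logDeriv g z = deriv L z := fun z hz => (hL z hz).deriv.symm
  constructor
  · rw [heq 0 h0]
    exact hL1 0 (by simp; positivity)
  · intro s hs
    have hsR : s ∈ ball (0 : ℂ) R := by simp; linarith
    rw [heq 0 h0, heq s hsR]
    have := (convex_closedBall (0 : ℂ) (R / 8)).norm_image_sub_le_of_norm_deriv_le
      (f := deriv L) (C := 64 * A / R ^ 2) (x := 0) (y := s)
      (fun x hx => hL'd.differentiableAt (isOpen_ball.mem_nhds (by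
        simp at hx ⊢; linarith)))
      (fun x hx => hL2 x (by simpa using hx)) (by simp; positivity) (by simpa using hs)
    simpa using this

/-- An entire function that is not identically zero vanishes to finite order at every point. -/
lemma analyticOrderAt_ne_top_of_entire {f : ℂ → ℂ} (hf : Differentiable ℂ f) {w : ℂ}
    (hw : f w ≠ 0) (z : ℂ) : analyticOrderAt f z ≠ ⊤ := by
  have hA : AnalyticOnNhd ℂ f Set.univ := hf.differentiableOn.analyticOnNhd isOpen_univ
  refine hA.analyticOrderAt_ne_top_of_isPreconnected (x := w) isPreconnected_univ trivial trivial ?_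
  rw [(hA w trivial).analyticOrderAt_eq_zero.2 hw]
  simp

/-- Dividing an entire function by `(1 - z / ρ) ^ m`, where `m` is the order of its zero `ρ`. -/
lemma exists_entire_div {f : ℂ → ℂ} (hf : Differentiable ℂ f) {ρ : ℂ} (hρ : ρ ≠ 0)
    (ht : analyticOrderAt f ρ ≠ ⊤) :
    ∃ g : ℂ → ℂ, Differentiable ℂ g ∧ g ρ ≠ 0 ∧
      ∀ z, f z = (1 - z / ρ) ^ analyticOrderNatAt f ρ * g z := by
  set m := analyticOrderNatAt f ρ
  obtain ⟨h, hh, hne, hev⟩ := ((hf.analyticAt ρ).analyticOrderAt_ne_top).1 ht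
  have hpne : ∀ z, z ≠ ρ → (1 - z / ρ) ^ m ≠ 0 := by
    intro z hz
    refine pow_ne_zero _ (sub_ne_zero.2 ?_)
    rwa [ne_comm, ne_eq, div_eq_one_iff_eq hρ]
  let g : ℂ → ℂ := fun z => if z = ρ then (-ρ) ^ m * h ρ else f z / (1 - z / ρ) ^ m
  have hfac : ∀ z : ℂ, (z - ρ) ^ m = (1 - z / ρ) ^ m * (-ρ) ^ m := by
    intro z
    rw [← mul_pow]
    congr 1
    field_simp
    ring
  have hgev : g =ᶠ[𝓝 ρ] fun z => (-ρ) ^ m * h z := by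
    filter_upwards [hev] with z hz
    by_cases hzρ : z = ρ
    · simp [g, hzρ]
    · simp only [g, if_neg hzρ]
      rw [hz, hfac, smul_eq_mul]
      have := hpne z hzρ
      field_simp
  refine ⟨g, fun z => ?_, ?_, fun z => ?_⟩
  · by_cases hz : z = ρ
    · subst hz
      exact (hh.differentiableAt.const_mul _).congr_of_eventuallyEq hgev
    · have : g =ᶠ[𝓝 z] fun z => f z / (1 - z / ρ) ^ m := by
        filter_upwards [isOpen_ne.mem_nhds hz] with w hw
        simp only [g, if_neg hw]
      refine DifferentiableAt.congr_of_eventuallyEq ?_ this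
      exact (hf z).div (by fun_prop) (hpne z hz)
  · simp only [g, if_true]
    exact mul_ne_zero (pow_ne_zero _ (neg_ne_zero.2 hρ)) hne
  · by_cases hz : z = ρ
    · subst hz
      simp only [g, if_true]
      have : f z = (z - z) ^ m • h z := hev.self_of_nhds
      rw [this, hfac, smul_eq_mul]
      ring
    · simp only [g, if_neg hz]
      have := hpne z hz
      field_simp

/-- Dividing out finitely many zeros of an entire function. -/
lemma exists_entire_div_prod {f : ℂ → ℂ} (hf : Differentiable ℂ f) (h0 : f 0 ≠ 0)
    (S : Finset ℂ) (hS : ∀ ρ ∈ S, ρ ≠ 0) :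
    ∃ g : ℂ → ℂ, Differentiable ℂ g ∧ (∀ ρ ∈ S, g ρ ≠ 0) ∧
      ∀ z, f z = (∏ ρ ∈ S, (1 - z / ρ) ^ analyticOrderNatAt f ρ) * g z := by
  classical
  induction S using Finset.induction_on with
  | empty => exact ⟨f, hf, by simp, by simp⟩
  | insert ρ S hρS ih =>
    obtain ⟨g, hg, hgne, hfg⟩ := ih fun σ hσ => hS σ (Finset.mem_insert_of_mem hσ)
    have hρ0 : ρ ≠ 0 := hS ρ (Finset.mem_insert_self _ _)
    let P : ℂ → ℂ := fun z => ∏ σ ∈ S, (1 - z / σ) ^ analyticOrderNatAt f σ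
    have hP : Differentiable ℂ P := by
      intro z
      refine DifferentiableAt.fun_finsetProd fun i _ => ?_
      fun_prop
    have hfP : f = P * g := funext hfg
    have hPρ : P ρ ≠ 0 := by
      refine Finset.prod_ne_zero_iff.2 fun σ hσ => pow_ne_zero _ (sub_ne_zero.2 ?_)
      have hσ0 : σ ≠ 0 := hS σ (Finset.mem_insert_of_mem hσ)
      rw [ne_comm, ne_eq, div_eq_one_iff_eq hσ0]
      rintro rfl
      exact hρS hσ
    have hord : analyticOrderAt f ρ = analyticOrderAt g ρ := by
      conv_lhs => rw [hfP]
      rw [analyticOrderAt_mul (hP.analyticAt ρ) (hg.analyticAt ρ),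
        (hP.analyticAt ρ).analyticOrderAt_eq_zero.2 hPρ, zero_add]
    have hordN : analyticOrderNatAt f ρ = analyticOrderNatAt g ρ := by
      simp [analyticOrderNatAt, hord]
    obtain ⟨k, hk, hkne, hgk⟩ := exists_entire_div hg hρ0
      (hord ▸ analyticOrderAt_ne_top_of_entire hf h0 ρ)
    refine ⟨k, hk, ?_, fun z => ?_⟩
    · intro σ hσ
      rcases Finset.mem_insert.1 hσ with rfl | hσ
      · exact hkne
      · have := hgne σ hσ
        rw [hgk σ] at this
        exact right_ne_zero_of_mul this
    · rw [Finset.prod_insert hρS, hfg z, hgk z, hordN]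
      ring

/-! ### Zeros of entire functions of order less than two -/

lemma analyticOrderNatAt_eq_zero_of_ne_zero {f : ℂ → ℂ} {ρ : ℂ} (h : f ρ ≠ 0) :
    analyticOrderNatAt f ρ = 0 := by
  by_contra hne
  exact h (apply_eq_zero_of_analyticOrderNatAt_ne_zero hne)

lemma analyticOrderNatAt_pos_of_zero {f : ℂ → ℂ} (hf : Differentiable ℂ f) {w : ℂ}
    (hw : f w ≠ 0) {ρ : ℂ} (h : f ρ = 0) : 0 < analyticOrderNatAt f ρ := by
  have h1 : analyticOrderAt f ρ ≠ 0 := (hf.analyticAt ρ).analyticOrderAt_ne_zero.2 h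
  rw [← Nat.cast_analyticOrderNatAt (analyticOrderAt_ne_top_of_entire hf hw ρ)] at h1
  exact Nat.pos_of_ne_zero (by exact_mod_cast h1)

lemma finite_zeros_of_isCompact {f : ℂ → ℂ} (hf : Differentiable ℂ f) {w : ℂ} (hw : f w ≠ 0)
    {K : Set ℂ} (hK : IsCompact K) : {z | f z = 0 ∧ z ∈ K}.Finite := by
  have hA : AnalyticOnNhd ℂ f Set.univ := hf.differentiableOn.analyticOnNhd isOpen_univ
  have h1 := hA.preimage_zero_mem_codiscrete (x := w) hw
  have h2 : IsDiscrete (f ⁻¹' {0}) := by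
    have := (mem_codiscrete'.1 h1).2
    simpa using this
  have h3 : {z | f z = 0 ∧ z ∈ K} = f ⁻¹' {0} ∩ K := by ext; simp
  rw [h3]
  have hc : IsCompact (f ⁻¹' {0} ∩ K) := hK.inter_left (isClosed_singleton.preimage hf.continuous)
  exact hc.finite (h2.mono Set.inter_subset_left)

/-- The zeros of an entire function in a disc, as a finite set. -/
noncomputable def zerosInBall (f : ℂ → ℂ) (R : ℝ) : Finset ℂ :=
  open Classical in
  if h : {z | f z = 0 ∧ z ∈ closedBall (0 : ℂ) R}.Finite then h.toFinset else ∅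

lemma mem_zerosInBall {f : ℂ → ℂ} (hf : Differentiable ℂ f) {w : ℂ} (hw : f w ≠ 0) {R : ℝ}
    {z : ℂ} : z ∈ zerosInBall f R ↔ f z = 0 ∧ ‖z‖ ≤ R := by
  rw [zerosInBall, dif_pos (finite_zeros_of_isCompact hf hw (isCompact_closedBall 0 R))]
  simp

/-- If `g` is the quotient of an entire function by its zeros `S` in a disc of radius `R`, then the
maximum principle bounds `g` on the disc of radius `(1 + a) R`, with a gain of `a` for each zero. -/
lemma pow_mul_norm_quotient_le {f g : ℂ → ℂ} (hg : Differentiable ℂ g) {S : Finset ℂ}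
    {m : ℂ → ℕ} (hfg : ∀ z, f z = (∏ ρ ∈ S, (1 - z / ρ) ^ m ρ) * g z) {R a M : ℝ} (hR : 0 < R)
    (ha : 0 < a) (hS0 : ∀ ρ ∈ S, ρ ≠ 0) (hSR : ∀ ρ ∈ S, ‖ρ‖ ≤ R)
    (hM : ∀ z, ‖z‖ = (1 + a) * R → ‖f z‖ ≤ M) {z : ℂ} (hz : ‖z‖ ≤ (1 + a) * R) :
    a ^ (∑ ρ ∈ S, m ρ) * ‖g z‖ ≤ M := by
  have hr : (1 + a) * R ≠ 0 := by positivity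
  have key : ‖g z‖ ≤ M / a ^ (∑ ρ ∈ S, m ρ) := by
    refine norm_le_of_forall_mem_frontier_norm_le (U := ball (0 : ℂ) ((1 + a) * R)) isBounded_ball
      hg.diffContOnCl (fun w hw => ?_) ?_
    · rw [frontier_ball _ hr, mem_sphere_zero_iff_norm] at hw
      rw [le_div_iff₀ (by positivity), mul_comm]
      refine le_trans ?_ (hM w hw)
      rw [hfg w, norm_mul, norm_prod]
      refine mul_le_mul_of_nonneg_right ?_ (norm_nonneg _)
      rw [← Finset.prod_pow_eq_pow_sum]
      refine Finset.prod_le_prod (fun _ _ => by positivity) fun ρ hρ => ?_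
      rw [norm_pow]
      refine pow_le_pow_left₀ ha.le ?_ _
      have h1 : 0 < ‖ρ‖ := norm_pos_iff.2 (hS0 ρ hρ)
      have h2 : 1 + a ≤ ‖w / ρ‖ := by
        rw [norm_div, hw, le_div_iff₀ h1]
        exact mul_le_mul_of_nonneg_left (hSR ρ hρ) (by positivity)
      have h3 := norm_sub_norm_le (w / ρ) 1
      rw [norm_one, norm_sub_rev] at h3
      linarith
    · rw [closure_ball _ hr]
      simpa using hz
  rwa [le_div_iff₀ (by positivity), mul_comm] at key

/-- Counting zeros: an entire function with `log |f(s)| ≪ (1 + |s|)^{9/8}` has `≪ X^{9/8}` zeros in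
the disc of radius `X`. -/
lemma exists_count_zeros_le {f : ℂ → ℂ} (hf : Differentiable ℂ f) (h0 : f 0 ≠ 0) {C : ℝ}
    (hC : ∀ s, ‖f s‖ ≤ Real.exp (C * (1 + ‖s‖) ^ (9 / 8 : ℝ))) :
    ∃ B : ℝ, 0 ≤ B ∧ ∀ X : ℝ, 1 ≤ X → ∀ S : Finset ℂ, (∀ ρ ∈ S, ‖ρ‖ ≤ X) →
      (∑ ρ ∈ S, (analyticOrderNatAt f ρ : ℝ)) ≤ B * X ^ (9 / 8 : ℝ) := by
  have hl2 : 0 < Real.log 2 := Real.log_pos (by norm_num)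
  refine ⟨(|C| * 4 ^ (9 / 8 : ℝ) + |Real.log ‖f 0‖|) / Real.log 2, by positivity,
    fun X hX S hS => ?_⟩
  have hX1 : 1 ≤ X ^ (9 / 8 : ℝ) := Real.one_le_rpow hX (by norm_num)
  set S' := S.filter fun ρ => f ρ = 0
  have hsum : ∑ ρ ∈ S, (analyticOrderNatAt f ρ : ℝ) = ((∑ ρ ∈ S', analyticOrderNatAt f ρ : ℕ) : ℝ) := by
    push_cast
    rw [Finset.sum_filter_of_ne]
    intro ρ _ hne
    by_contra h
    exact hne (by simp [analyticOrderNatAt_eq_zero_of_ne_zero h])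
  rw [hsum]
  set n := ∑ ρ ∈ S', analyticOrderNatAt f ρ
  have hS'0 : ∀ ρ ∈ S', ρ ≠ 0 := by
    rintro ρ hρ rfl
    exact h0 (Finset.mem_filter.1 hρ).2
  have hS'X : ∀ ρ ∈ S', ‖ρ‖ ≤ X := fun ρ hρ => hS ρ (Finset.mem_filter.1 hρ).1
  obtain ⟨g, hg, -, hfg⟩ := exists_entire_div_prod hf h0 S' hS'0
  have hfg0 : f 0 = g 0 := by simpa using hfg 0
  have hM : ∀ z : ℂ, ‖z‖ = (1 + 2) * X → ‖f z‖ ≤ Real.exp (|C| * 4 ^ (9 / 8 : ℝ) * X ^ (9 / 8 : ℝ)) := by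
    intro z hz
    refine (hC z).trans (Real.exp_le_exp.2 ?_)
    rw [mul_assoc, ← Real.mul_rpow (by norm_num) (by linarith)]
    refine mul_le_mul (le_abs_self C) ?_ (by positivity) (abs_nonneg C)
    exact Real.rpow_le_rpow (by positivity) (by linarith) (by norm_num)
  have h1 := pow_mul_norm_quotient_le hg hfg (by linarith : (0 : ℝ) < X) (by norm_num : (0 : ℝ) < 2)
    hS'0 hS'X hM (z := 0) (by simp; linarith)
  rw [← hfg0] at h1
  have hpos : 0 < ‖f 0‖ := norm_pos_iff.2 h0
  have h2 := Real.log_le_log (by positivity) h1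
  rw [Real.log_exp, Real.log_mul (by positivity) hpos.ne', Real.log_pow] at h2
  have h3 : -|Real.log ‖f 0‖| ≤ Real.log ‖f 0‖ := neg_abs_le _
  rw [div_mul_eq_mul_div, le_div_iff₀ hl2]
  nlinarith [abs_nonneg (Real.log ‖f 0‖)]

/-- The sum of `(1 + |ρ|)^{-5/4}` over the zeros converges. -/
lemma summable_zeros_rpow {f : ℂ → ℂ} (hf : Differentiable ℂ f) (h0 : f 0 ≠ 0) {C : ℝ}
    (hC : ∀ s, ‖f s‖ ≤ Real.exp (C * (1 + ‖s‖) ^ (9 / 8 : ℝ))) :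
    Summable fun ρ : ℂ => (analyticOrderNatAt f ρ : ℝ) * (1 + ‖ρ‖) ^ (-(5 / 4) : ℝ) := by
  classical
  obtain ⟨B, hB0, hB⟩ := exists_count_zeros_le hf h0 hC
  let b : ℕ → ℝ := fun n => ((2 : ℝ) ^ n) ^ (-(5 / 4) : ℝ)
  let q : ℝ := (2 : ℝ) ^ (-(1 / 8) : ℝ)
  have hq0 : 0 ≤ q := by positivity
  have hq1 : q < 1 := Real.rpow_lt_one_of_one_lt_of_neg (by norm_num) (by norm_num)
  have hbq : ∀ n, b n * (B * ((2 : ℝ) ^ (n + 1)) ^ (9 / 8 : ℝ)) = B * 2 ^ (9 / 8 : ℝ) * q ^ n := by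
    intro n
    simp only [b, q]
    rw [pow_succ, Real.mul_rpow (by positivity) (by norm_num), ← Real.rpow_natCast 2 n,
      ← Real.rpow_mul (by norm_num), ← Real.rpow_mul (by norm_num), ← Real.rpow_natCast (2 ^ _) n,
      ← Real.rpow_mul (by norm_num)]
    have : (2 : ℝ) ^ ((n : ℝ) * -(5 / 4)) * 2 ^ ((n : ℝ) * (9 / 8)) = 2 ^ (-(1 / 8) * (n : ℝ)) := by
      rw [← Real.rpow_add (by norm_num)]
      congr 1
      ring
    rw [← this]
    ring
  have hgeo : Summable fun n => B * 2 ^ (9 / 8 : ℝ) * q ^ n :=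
    (summable_geometric_of_lt_one hq0 hq1).mul_left _
  refine summable_of_sum_le (c := ∑' n, B * 2 ^ (9 / 8 : ℝ) * q ^ n) (fun ρ => by positivity)
    fun S => ?_
  have hn : ∀ ρ : ℂ, ∃ n : ℕ, (2 : ℝ) ^ n ≤ 1 + ‖ρ‖ ∧ 1 + ‖ρ‖ < 2 ^ (n + 1) := fun ρ =>
    exists_nat_pow_near (by linarith [norm_nonneg ρ]) (by norm_num)
  choose k hk1 hk2 using hn
  have h1 : ∀ ρ, (1 + ‖ρ‖) ^ (-(5 / 4) : ℝ) ≤ b (k ρ) := fun ρ =>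
    Real.rpow_le_rpow_of_nonpos (by positivity) (hk1 ρ) (by norm_num)
  calc ∑ ρ ∈ S, (analyticOrderNatAt f ρ : ℝ) * (1 + ‖ρ‖) ^ (-(5 / 4) : ℝ)
      ≤ ∑ ρ ∈ S, (analyticOrderNatAt f ρ : ℝ) * b (k ρ) :=
        Finset.sum_le_sum fun ρ _ => mul_le_mul_of_nonneg_left (h1 ρ) (by positivity)
    _ = ∑ n ∈ S.image k, ∑ ρ ∈ S with k ρ = n, (analyticOrderNatAt f ρ : ℝ) * b (k ρ) :=
        (Finset.sum_fiberwise_of_maps_to (fun ρ hρ => Finset.mem_image_of_mem k hρ) _).symm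
    _ ≤ ∑ n ∈ S.image k, B * 2 ^ (9 / 8 : ℝ) * q ^ n := by
        refine Finset.sum_le_sum fun n _ => ?_
        rw [← hbq]
        calc ∑ ρ ∈ S with k ρ = n, (analyticOrderNatAt f ρ : ℝ) * b (k ρ)
            = b n * ∑ ρ ∈ S with k ρ = n, (analyticOrderNatAt f ρ : ℝ) := by
              rw [Finset.mul_sum]
              refine Finset.sum_congr rfl fun ρ hρ => ?_
              rw [(Finset.mem_filter.1 hρ).2, mul_comm]
          _ ≤ _ := by
              refine mul_le_mul_of_nonneg_left (hB _ (one_le_pow₀ (by norm_num)) _ ?_)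
                (by positivity)
              intro ρ hρ
              have := hk2 ρ
              rw [(Finset.mem_filter.1 hρ).2] at this
              linarith
    _ ≤ _ := hgeo.sum_le_tsum _ fun n _ => by positivity

lemma summable_zeros_mul {f : ℂ → ℂ} (hf : Differentiable ℂ f) (h0 : f 0 ≠ 0) {C : ℝ}
    (hC : ∀ s, ‖f s‖ ≤ Real.exp (C * (1 + ‖s‖) ^ (9 / 8 : ℝ))) {E : Type*} [NormedRing E]
    [CompleteSpace E] {φ : ℂ → E} {X K : ℝ}
    (hφ : ∀ ρ, f ρ = 0 → X ≤ ‖ρ‖ → ‖φ ρ‖ ≤ K * (1 + ‖ρ‖) ^ (-(5 / 4) : ℝ)) :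
    Summable fun ρ : ℂ => (analyticOrderNatAt f ρ : E) * φ ρ := by
  refine Summable.of_norm_bounded_eventually
    (g := fun ρ => (‖(1 : E)‖ * K) * ((analyticOrderNatAt f ρ : ℝ) * (1 + ‖ρ‖) ^ (-(5 / 4) : ℝ)))
    ((summable_zeros_rpow hf h0 hC).mul_left _) ?_
  have hfin := finite_zeros_of_isCompact hf h0 (isCompact_closedBall (0 : ℂ) X)
  filter_upwards [hfin.compl_mem_cofinite] with ρ hρ
  by_cases h : f ρ = 0
  · have hX : X ≤ ‖ρ‖ := by
      by_contra hlt
      exact hρ ⟨h, by simpa using (not_le.1 hlt).le⟩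
    calc ‖(analyticOrderNatAt f ρ : E) * φ ρ‖ ≤ ‖(analyticOrderNatAt f ρ : E)‖ * ‖φ ρ‖ :=
          norm_mul_le _ _
      _ ≤ (analyticOrderNatAt f ρ * ‖(1 : E)‖) * (K * (1 + ‖ρ‖) ^ (-(5 / 4) : ℝ)) :=
          mul_le_mul (Nat.norm_cast_le _) (hφ ρ h hX) (norm_nonneg _) (by positivity)
      _ = _ := by ring
  · simp [analyticOrderNatAt_eq_zero_of_ne_zero h]

/-- The partial fraction expansion of the logarithmic derivative of an entire function of order
less than two. -/
theorem hasSum_logDeriv_sub {f : ℂ → ℂ} (hf : Differentiable ℂ f) (h0 : f 0 ≠ 0) {C : ℝ}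
    (hC : ∀ s, ‖f s‖ ≤ Real.exp (C * (1 + ‖s‖) ^ (9 / 8 : ℝ))) {s : ℂ} (hs : f s ≠ 0) :
    HasSum (fun ρ : ℂ => (analyticOrderNatAt f ρ : ℂ) * (1 / (s - ρ) + 1 / ρ))
      (logDeriv f s - logDeriv f 0) := by
  have hsum : Summable fun ρ : ℂ => (analyticOrderNatAt f ρ : ℂ) * (1 / (s - ρ) + 1 / ρ) := by
    refine summable_zeros_mul hf h0 hC (X := 2 * ‖s‖ + 1) (K := 8 * ‖s‖) fun ρ hρ hX => ?_
    have hρ1 : 1 ≤ ‖ρ‖ := by linarith [norm_nonneg s]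
    have hρ0 : ρ ≠ 0 := norm_pos_iff.1 (by linarith)
    have hsρ : ‖ρ‖ / 2 ≤ ‖s - ρ‖ := by
      have := norm_sub_norm_le ρ s
      rw [norm_sub_rev] at this
      linarith
    have hsρ0 : s - ρ ≠ 0 := norm_pos_iff.1 (by linarith)
    have h1 : 1 / (s - ρ) + 1 / ρ = s / ((s - ρ) * ρ) := by
      field_simp
      ring
    have h2 : (1 + ‖ρ‖) ^ (-2 : ℝ) ≤ (1 + ‖ρ‖) ^ (-(5 / 4) : ℝ) :=
      Real.rpow_le_rpow_of_exponent_le (by linarith) (by norm_num)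
    refine le_trans ?_ (mul_le_mul_of_nonneg_left h2 (by positivity))
    rw [h1, norm_div, norm_mul, Real.rpow_neg (by positivity), Real.rpow_two, ← div_eq_mul_inv]
    rw [div_le_div_iff₀ (by positivity) (by positivity)]
    have h3 : (1 + ‖ρ‖) ^ 2 ≤ 8 * (‖s - ρ‖ * ‖ρ‖) := by nlinarith
    nlinarith [norm_nonneg s]
  have hmono : Monotone fun n : ℕ => zerosInBall f n := by
    intro a b hab z hz
    simp only [mem_zerosInBall hf h0] at hz ⊢
    exact ⟨hz.1, hz.2.trans (by exact_mod_cast hab)⟩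
  -- the partial sums over the zeros in the disc of radius `n`
  have hlim1 : Tendsto (fun n : ℕ => ∑ ρ ∈ zerosInBall f n,
      (analyticOrderNatAt f ρ : ℂ) * (1 / (s - ρ) + 1 / ρ)) atTop
      (𝓝 (∑' ρ, (analyticOrderNatAt f ρ : ℂ) * (1 / (s - ρ) + 1 / ρ))) := by
    have hsub := (hasSum_subtype_iff_of_support_subset (s := {ρ | f ρ = 0})
      (f := fun ρ : ℂ => (analyticOrderNatAt f ρ : ℂ) * (1 / (s - ρ) + 1 / ρ)) (by
        intro ρ hρ
        by_contra h
        exact hρ (by simp [analyticOrderNatAt_eq_zero_of_ne_zero (f := f) h]))).2 hsum.hasSum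
    have ht : Tendsto (fun n : ℕ => (zerosInBall f n).subtype (fun ρ => ρ ∈ {ρ | f ρ = 0}))
        atTop atTop := by
      refine tendsto_atTop_finset_of_monotone ?_ ?_
      · intro a b hab
        exact Finset.subtype_mono (hmono hab)
      · rintro ⟨ρ, hρ⟩
        obtain ⟨n, hn⟩ := exists_nat_ge ‖ρ‖
        exact ⟨n, by simpa [mem_zerosInBall hf h0] using ⟨hρ, hn⟩⟩
    refine (hsub.comp ht).congr fun n => ?_
    simp only [Function.comp]
    rw [Finset.sum_subtype_of_mem (p := fun ρ => ρ ∈ {ρ | f ρ = 0})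
      (fun ρ : ℂ => (analyticOrderNatAt f ρ : ℂ) * (1 / (s - ρ) + 1 / ρ))
      fun ρ hρ => ((mem_zerosInBall hf h0).1 hρ).1]
  have hlim2 : Tendsto (fun n : ℕ => ∑ ρ ∈ zerosInBall f n,
      (analyticOrderNatAt f ρ : ℂ) * (1 / (s - ρ) + 1 / ρ)) atTop
      (𝓝 (logDeriv f s - logDeriv f 0)) := by
    rw [tendsto_iff_norm_sub_tendsto_zero]
    let A : ℕ → ℝ := fun n => |C| * 3 ^ (9 / 8 : ℝ) * (n : ℝ) ^ (9 / 8 : ℝ) + |Real.log ‖f 0‖| + 1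
    have hAlim : Tendsto (fun n : ℕ => 64 * A n / (n : ℝ) ^ 2 * ‖s‖) atTop (𝓝 0) := by
      have e1 : Tendsto (fun n : ℕ => (n : ℝ) ^ (-(7 / 8) : ℝ)) atTop (𝓝 0) :=
        (tendsto_rpow_neg_atTop (by norm_num)).comp tendsto_natCast_atTop_atTop
      have e2 : Tendsto (fun n : ℕ => (n : ℝ) ^ (-2 : ℝ)) atTop (𝓝 0) :=
        (tendsto_rpow_neg_atTop (by norm_num)).comp tendsto_natCast_atTop_atTop
      have e3 := ((e1.const_mul (|C| * 3 ^ (9 / 8 : ℝ))).add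
        (e2.const_mul (|Real.log ‖f 0‖| + 1))).const_mul (64 * ‖s‖)
      simp only [mul_zero, add_zero] at e3
      refine e3.congr' ?_
      filter_upwards [eventually_gt_atTop 0] with n hn
      have hn0 : (0 : ℝ) < n := by exact_mod_cast hn
      have e4 : (n : ℝ) ^ (-(7 / 8) : ℝ) = (n : ℝ) ^ (9 / 8 : ℝ) * (n : ℝ) ^ (-2 : ℝ) := by
        rw [← Real.rpow_add hn0]
        norm_num
      rw [e4]
      have e5 : (n : ℝ) ^ (-2 : ℝ) = ((n : ℝ) ^ 2)⁻¹ := by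
        rw [Real.rpow_neg hn0.le, Real.rpow_two]
      rw [e5]
      simp only [A]
      field_simp
      ring
    refine squeeze_zero' (Eventually.of_forall fun n => norm_nonneg _) ?_ hAlim
    obtain ⟨N, hN⟩ := exists_nat_ge (8 * ‖s‖)
    filter_upwards [eventually_ge_atTop (N + 1)] with n hn
    have hn1 : (1 : ℝ) ≤ n := by exact_mod_cast (show 1 ≤ n by omega)
    have hns : ‖s‖ ≤ (n : ℝ) / 8 := by
      have : (N : ℝ) ≤ n := by exact_mod_cast (show N ≤ n by omega)
      linarith
    set S := zerosInBall f n
    have hS0 : ∀ ρ ∈ S, ρ ≠ 0 := by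
      rintro ρ hρ rfl
      exact h0 ((mem_zerosInBall hf h0).1 hρ).1
    obtain ⟨g, hg, hgS, hfg⟩ := exists_entire_div_prod hf h0 S hS0
    have hg0 : f 0 = g 0 := by simpa using hfg 0
    have hpos : 0 < ‖f 0‖ := norm_pos_iff.2 h0
    have hgne : ∀ z ∈ ball (0 : ℂ) n, g z ≠ 0 := by
      intro z hz hgz
      have hfz : f z = 0 := by rw [hfg z, hgz, mul_zero]
      refine hgS z ((mem_zerosInBall hf h0).2 ⟨hfz, ?_⟩) hgz
      exact (mem_ball_zero_iff.1 hz).le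
    have hgb : ∀ z ∈ ball (0 : ℂ) n, ‖g z‖ ≤ Real.exp (A n) * ‖g 0‖ := by
      intro z hz
      have h1 := pow_mul_norm_quotient_le hg hfg (by linarith : (0 : ℝ) < n) one_pos hS0
        (fun ρ hρ => ((mem_zerosInBall hf h0).1 hρ).2)
        (M := Real.exp (|C| * 3 ^ (9 / 8 : ℝ) * (n : ℝ) ^ (9 / 8 : ℝ))) (by
          intro z hz
          refine (hC z).trans (Real.exp_le_exp.2 ?_)
          rw [mul_assoc, ← Real.mul_rpow (by norm_num) (by linarith)]
          refine mul_le_mul (le_abs_self C) ?_ (by positivity) (abs_nonneg C)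
          exact Real.rpow_le_rpow (by positivity) (by linarith) (by norm_num)) (z := z) (by
          have := mem_ball_zero_iff.1 hz
          linarith)
      rw [one_pow, one_mul] at h1
      refine h1.trans ?_
      rw [← hg0]
      conv_rhs => rw [← Real.exp_log hpos]
      rw [← Real.exp_add, Real.exp_le_exp]
      simp only [A]
      linarith [neg_abs_le (Real.log ‖f 0‖)]
    have hBC := (logDeriv_bounds_of_ball (by linarith : (0 : ℝ) < n)
      (by simp only [A]; positivity : 0 < A n) hg.differentiableOn hgne hgb).2 s hns
    refine le_trans (le_of_eq ?_) hBC
    rw [norm_sub_rev]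
    congr 1
    -- the logarithmic derivative of the product of the linear factors
    have hld : ∀ z, f z ≠ 0 → logDeriv f z =
        (∑ ρ ∈ S, (analyticOrderNatAt f ρ : ℂ) * (1 / (z - ρ))) + logDeriv g z := by
      intro z hz
      have hz' := hz
      rw [hfg z] at hz'
      have hP := left_ne_zero_of_mul hz'
      have hG := right_ne_zero_of_mul hz'
      have hf' : f = fun z => (∏ ρ ∈ S, (1 - z / ρ) ^ analyticOrderNatAt f ρ) * g z := funext hfg
      conv_lhs => rw [hf']
      have hPd : ∀ ρ ∈ S, DifferentiableAt ℂ (fun z : ℂ => (1 - z / ρ) ^ analyticOrderNatAt f ρ) z :=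
        fun ρ _ => by fun_prop
      rw [logDeriv_mul z hP hG (DifferentiableAt.fun_finsetProd hPd) (hg z)]
      congr 1
      have := logDeriv_prod (s := S) (f := fun ρ (z : ℂ) => (1 - z / ρ) ^ analyticOrderNatAt f ρ)
        (x := z) (fun ρ hρ => Finset.prod_ne_zero_iff.1 hP ρ hρ) hPd
      rw [this]
      refine Finset.sum_congr rfl fun ρ hρ => ?_
      have hρ0 := hS0 ρ hρ
      have hzρ : z - ρ ≠ 0 := by
        rw [sub_ne_zero]
        rintro rfl
        exact hz ((mem_zerosInBall hf h0).1 hρ).1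
      rw [logDeriv_fun_pow (f := fun z : ℂ => 1 - z / ρ) (by fun_prop)]
      congr 1
      rw [logDeriv_apply]
      have hd : HasDerivAt (fun z : ℂ => 1 - z / ρ) (-(1 / ρ)) z := by
        simpa using ((hasDerivAt_id z).div_const ρ).const_sub 1
      rw [hd.deriv]
      have h1z : 1 - z / ρ ≠ 0 := by
        rw [show 1 - z / ρ = -(z - ρ) / ρ by field_simp; ring]
        exact div_ne_zero (neg_ne_zero.2 hzρ) hρ0
      rw [div_eq_div_iff h1z hzρ]
      field_simp
      ring
    rw [hld s hs, hld 0 h0]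
    have : ∀ ρ : ℂ, (1 : ℂ) / (0 - ρ) = -(1 / ρ) := fun ρ => by rw [zero_sub, div_neg]
    simp only [this, mul_add, Finset.sum_add_distrib, mul_neg, Finset.sum_neg_distrib]
    ring
  rw [← tendsto_nhds_unique hlim1 hlim2]
  exact hsum.hasSum

/-! ### Growth of the gamma function and of its logarithmic derivative -/

lemma differentiableAt_Gamma_of_re_pos {w : ℂ} (hw : 0 < w.re) :
    DifferentiableAt ℂ Complex.Gamma w := by
  refine Complex.differentiableAt_Gamma w fun m hm => ?_
  rw [hm] at hw
  simp at hw
  have : (0 : ℝ) ≤ m := by positivity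
  linarith

lemma norm_Gamma_le_Gamma_re {z : ℂ} (hz : 0 < z.re) : ‖Complex.Gamma z‖ ≤ Real.Gamma z.re := by
  rw [Complex.Gamma_eq_integral hz, Real.Gamma_eq_integral hz, Complex.GammaIntegral]
  refine (MeasureTheory.norm_integral_le_integral_norm _).trans (le_of_eq ?_)
  refine MeasureTheory.setIntegral_congr_fun measurableSet_Ioi fun x hx => ?_
  have hx : 0 < x := hx
  simp only [norm_mul, norm_real, Real.norm_eq_abs, Real.abs_exp]
  rw [norm_cpow_eq_rpow_re_of_pos hx]
  simp

lemma Gamma_add_two_le {x : ℝ} (hx : 0 < x) :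
    Real.Gamma (x + 2) ≤ Real.exp (8 * (3 * (1 + x)) ^ (9 / 8 : ℝ)) := by
  set N := ⌈x⌉₊ + 1
  have hxN : x ≤ ⌈x⌉₊ := Nat.le_ceil x
  have hNx : (N : ℝ) ≤ 3 * (1 + x) := by
    have := Nat.ceil_lt_add_one hx.le
    simp only [N]
    push_cast
    linarith
  have hN1 : (1 : ℝ) ≤ N := by simp [N]
  have h1 : Real.Gamma (x + 2) ≤ Real.Gamma (N + 1 : ℝ) := by
    refine Real.Gamma_strictMonoOn_Ici.monotoneOn ?_ ?_ ?_
    · simp only [Set.mem_Ici]; linarith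
    · simp only [Set.mem_Ici]; linarith
    · simp only [N]; push_cast; linarith
  rw [Real.Gamma_nat_eq_factorial] at h1
  refine h1.trans ?_
  have h2 : (N.factorial : ℝ) ≤ (N : ℝ) ^ N := by exact_mod_cast Nat.factorial_le_pow N
  refine h2.trans ?_
  rw [← Real.exp_log (show (0 : ℝ) < (N : ℝ) ^ N by positivity), Real.log_pow]
  refine Real.exp_le_exp.2 ?_
  have h3 := Real.log_le_rpow_div (x := N) (by positivity) (ε := 1 / 8) (by norm_num)
  calc (N : ℝ) * Real.log N ≤ N * ((N : ℝ) ^ (1 / 8 : ℝ) / (1 / 8)) := by gcongr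
    _ = 8 * (N : ℝ) ^ (9 / 8 : ℝ) := by
      rw [show (9 / 8 : ℝ) = 1 + 1 / 8 by norm_num, Real.rpow_add (by linarith), Real.rpow_one]
      ring
    _ ≤ _ := by gcongr

/-- A weak form of Stirling's upper bound: the exponent `9 / 8 > 1` absorbs the logarithm. -/
lemma exists_Gamma_le_exp {δ : ℝ} (hδ : 0 < δ) :
    ∃ C : ℝ, 0 ≤ C ∧ ∀ x, δ ≤ x → Real.Gamma x ≤ Real.exp (C * (1 + x) ^ (9 / 8 : ℝ)) := by
  refine ⟨8 * 3 ^ (9 / 8 : ℝ) + 1 / δ ^ 2, by positivity, fun x hx => ?_⟩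
  have hx0 : 0 < x := hδ.trans_le hx
  have h1 : Real.Gamma (x + 2) = (x + 1) * (x * Real.Gamma x) := by
    rw [show x + 2 = (x + 1) + 1 by ring, Real.Gamma_add_one (by positivity),
      Real.Gamma_add_one (by positivity)]
  have h2 : Real.Gamma x ≤ 1 / δ ^ 2 * Real.Gamma (x + 2) := by
    rw [h1, div_mul_eq_mul_div, le_div_iff₀ (by positivity)]
    have : 0 < Real.Gamma x := Real.Gamma_pos_of_pos hx0
    have : δ ^ 2 ≤ (x + 1) * x := by nlinarith
    nlinarith
  have h3 : (1 : ℝ) ≤ (1 + x) ^ (9 / 8 : ℝ) := Real.one_le_rpow (by linarith) (by norm_num)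
  calc Real.Gamma x ≤ 1 / δ ^ 2 * Real.Gamma (x + 2) := h2
    _ ≤ Real.exp (1 / δ ^ 2) * Real.exp (8 * (3 * (1 + x)) ^ (9 / 8 : ℝ)) := by
      refine mul_le_mul ?_ (Gamma_add_two_le hx0) (Real.Gamma_pos_of_pos (by linarith)).le
        (Real.exp_pos _).le
      linarith [Real.add_one_le_exp (1 / δ ^ 2)]
    _ ≤ _ := by
      rw [← Real.exp_add, Real.exp_le_exp, Real.mul_rpow (by norm_num) (by linarith)]
      have : 0 < 1 / δ ^ 2 := by positivity
      nlinarith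

/-- The hypothesis `1 ≤ Re v` makes the second factor of the Beta integrand bounded by `1`. -/
lemma norm_betaIntegral_le {u v : ℂ} (hu : 0 < u.re) (hv : 1 ≤ v.re) :
    ‖betaIntegral u v‖ ≤ 1 / u.re := by
  rw [betaIntegral]
  have hint : IntervalIntegrable (fun x : ℝ => x ^ (u.re - 1)) MeasureTheory.volume 0 1 :=
    intervalIntegral.intervalIntegrable_rpow' (by linarith)
  have h1 : ∀ x ∈ Set.Ioc (0 : ℝ) 1,
      ‖(x : ℂ) ^ (u - 1) * (1 - (x : ℂ)) ^ (v - 1)‖ ≤ x ^ (u.re - 1) := by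
    rintro x ⟨hx0, hx1⟩
    rw [norm_mul, norm_cpow_eq_rpow_re_of_pos hx0, sub_re, one_re]
    refine mul_le_of_le_one_right (by positivity) ?_
    rw [show (1 : ℂ) - x = ((1 - x : ℝ) : ℂ) by push_cast; ring]
    rcases hx1.eq_or_lt with rfl | hx1
    · by_cases hv1 : v - 1 = 0
      · simp [hv1]
      · simp [zero_cpow hv1]
    · rw [norm_cpow_eq_rpow_re_of_pos (by linarith)]
      exact Real.rpow_le_one (by linarith) (by linarith) (by simpa using hv)
  refine (intervalIntegral.norm_integral_le_of_norm_le zero_le_one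
    (Filter.Eventually.of_forall h1) hint).trans ?_
  rw [integral_rpow (Or.inl (by linarith))]
  rw [sub_add_cancel, Real.one_rpow, Real.zero_rpow hu.ne', sub_zero]

lemma norm_Gamma_add_nat_le {z : ℂ} (hz : 0 < z.re) (n : ℕ) :
    ‖Complex.Gamma (z + n)‖ ≤ (‖z‖ + n) ^ n * ‖Complex.Gamma z‖ := by
  induction n with
  | zero => simp
  | succ n ih =>
    have hne : z + n ≠ 0 := by
      intro h
      have := congrArg re h
      simp at this
      have : (0 : ℝ) ≤ n := by positivity
      linarith
    rw [Nat.cast_succ, ← add_assoc, Complex.Gamma_add_one _ hne, norm_mul]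
    have h1 : ‖z + n‖ ≤ ‖z‖ + (n + 1 : ℝ) := by
      refine (norm_add_le _ _).trans ?_
      simp
    calc ‖z + n‖ * ‖Complex.Gamma (z + n)‖
        ≤ (‖z‖ + (n + 1 : ℝ)) * ((‖z‖ + (n + 1 : ℝ)) ^ n * ‖Complex.Gamma z‖) := by
          refine mul_le_mul h1 (ih.trans ?_) (norm_nonneg _) (by positivity)
          gcongr
          linarith
      _ = _ := by push_cast; ring

/-- Neighbouring values of `Γ` on a vertical line differ by a factor of polynomial size. The
quotient of the values is a Beta integral, up to an integer shift of the argument. -/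
lemma exists_norm_Gamma_add_le {x : ℝ} (hx : 0 < x) :
    ∃ (K : ℝ) (N : ℕ), 0 < K ∧ ∀ z h : ℂ, z.re = x → ‖h‖ ≤ x / 2 →
      ‖Complex.Gamma (z + h)‖ ≤ K * (‖z‖ + N) ^ N * ‖Complex.Gamma z‖ := by
  set N := ⌈x / 2⌉₊ + 1
  have hN : x / 2 + 1 ≤ N := by
    have := Nat.le_ceil (x / 2)
    simp only [N]
    push_cast
    linarith
  obtain ⟨K, hK⟩ := (isCompact_closedBall (N : ℂ) (x / 2)).exists_bound_of_continuousOn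
    (f := fun s : ℂ => (Complex.Gamma s)⁻¹) differentiable_one_div_Gamma.continuous.continuousOn
  refine ⟨(|K| + 1) * (2 / x), N, by positivity, fun z h hz hh => ?_⟩
  have hre := abs_re_le_norm h
  have hw : x / 2 ≤ (z + h).re := by
    rw [add_re, hz]
    linarith [neg_abs_le h.re]
  have hδ : 1 ≤ ((N : ℂ) - h).re := by
    simp only [sub_re, natCast_re]
    linarith [le_abs_self h.re]
  have hδ0 : 0 < ((N : ℂ) - h).re := by linarith
  have h1 := Complex.Gamma_mul_Gamma_eq_betaIntegral (s := z + h) (t := N - h) (by linarith) hδ0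
  rw [show z + h + (N - h) = z + N by ring] at h1
  have hG : Complex.Gamma (N - h) ≠ 0 := Complex.Gamma_ne_zero_of_re_pos hδ0
  have h2 : Complex.Gamma (z + h) =
      Complex.Gamma (z + N) * betaIntegral (z + h) (N - h) * (Complex.Gamma (N - h))⁻¹ := by
    rw [← h1]
    field_simp
  rw [h2, norm_mul, norm_mul]
  have h3 : ‖(Complex.Gamma (N - h))⁻¹‖ ≤ |K| + 1 := by
    refine (hK (N - h) ?_).trans (by linarith [le_abs_self K])
    simpa using hh
  have h4 : ‖betaIntegral (z + h) (N - h)‖ ≤ 2 / x := by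
    refine (norm_betaIntegral_le (by linarith) hδ).trans ?_
    rw [div_le_div_iff₀ (by linarith) hx]
    linarith
  have h5 := norm_Gamma_add_nat_le (z := z) (by linarith) N
  calc ‖Complex.Gamma (z + N)‖ * ‖betaIntegral (z + h) (N - h)‖ * ‖(Complex.Gamma (N - h))⁻¹‖
      ≤ ((‖z‖ + N) ^ N * ‖Complex.Gamma z‖) * (2 / x) * (|K| + 1) := by gcongr
    _ = _ := by ring

/-- `Γ'/Γ` grows slowly on vertical lines: by `exists_norm_Gamma_add_le` the logarithm of `|Γ|` varies
by `O(log |y|)` on a disc of fixed radius, and Borel–Carathéodory bounds its derivative. -/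
lemma exists_norm_digamma_le {x : ℝ} (hx : 0 < x) :
    ∃ K : ℝ, 0 ≤ K ∧ ∀ y : ℝ, ‖logDeriv Complex.Gamma (x + y * I)‖ ≤ K * (1 + |y|) ^ (1 / 4 : ℝ) := by
  obtain ⟨K, N, hK, hKN⟩ := exists_norm_Gamma_add_le hx
  refine ⟨16 / x * (|Real.log K| + 1 + N * 4 * (1 + x + N) ^ (1 / 4 : ℝ)), by positivity, fun y => ?_⟩
  set z : ℂ := x + y * I
  have hz : z.re = x := by simp [z]
  have hzn : ‖z‖ ≤ x + |y| := by
    refine (norm_add_le _ _).trans ?_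
    simp [abs_of_pos hx]
  have hzpos : 0 < ‖z‖ := norm_pos_iff.2 fun h => by rw [h] at hz; simp at hz; linarith
  have hGz : Complex.Gamma z ≠ 0 := Complex.Gamma_ne_zero_of_re_pos (by rw [hz]; exact hx)
  set A := |Real.log K| + 1 + N * (4 * (‖z‖ + N) ^ (1 / 4 : ℝ))
  have hA : 0 < A := by positivity
  have hre : ∀ h ∈ ball (0 : ℂ) (x / 2), 0 < (z + h).re := by
    intro h hh
    rw [mem_ball_zero_iff] at hh
    rw [add_re, hz]
    linarith [neg_abs_le h.re, abs_re_le_norm h]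
  have hBC := (logDeriv_bounds_of_ball (g := fun h => Complex.Gamma (z + h)) (R := x / 2) (A := A)
    (by positivity) hA
    (fun h hh => by
      refine DifferentiableAt.differentiableWithinAt ?_
      exact DifferentiableAt.comp h (differentiableAt_Gamma_of_re_pos (hre h hh)) (by fun_prop))
    (fun h hh => Complex.Gamma_ne_zero_of_re_pos (hre h hh))
    (fun h hh => by
      refine (hKN z h hz (mem_ball_zero_iff.1 hh).le).trans ?_
      simp only [add_zero]
      refine mul_le_mul_of_nonneg_right ?_ (norm_nonneg _)
      have hpos : 0 < ‖z‖ + N := by positivity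
      rw [← Real.exp_log (show 0 < K * (‖z‖ + N) ^ N by positivity), Real.exp_le_exp,
        Real.log_mul hK.ne' (by positivity), Real.log_pow]
      have h1 := Real.log_le_rpow_div hpos.le (show (0 : ℝ) < 1 / 4 by norm_num)
      rw [div_div_eq_mul_div, div_one, mul_comm] at h1
      have h2 : (N : ℝ) * Real.log (‖z‖ + N) ≤ N * (4 * (‖z‖ + N) ^ (1 / 4 : ℝ)) := by gcongr
      simp only [A]
      linarith [le_abs_self (Real.log K)])).1
  have hld : logDeriv (fun h => Complex.Gamma (z + h)) 0 = logDeriv Complex.Gamma z := by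
    rw [logDeriv_apply, logDeriv_apply, deriv_comp_const_add, add_zero]
  rw [hld] at hBC
  refine hBC.trans ?_
  have h3 : (1 : ℝ) ≤ (1 + |y|) ^ (1 / 4 : ℝ) := Real.one_le_rpow (by linarith [abs_nonneg y]) (by norm_num)
  have h4 : (‖z‖ + N) ^ (1 / 4 : ℝ) ≤ (1 + x + N) ^ (1 / 4 : ℝ) * (1 + |y|) ^ (1 / 4 : ℝ) := by
    rw [← Real.mul_rpow (by positivity) (by positivity)]
    refine Real.rpow_le_rpow (by positivity) ?_ (by norm_num)
    have : (0 : ℝ) ≤ N := by positivity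
    nlinarith [abs_nonneg y]
  calc 8 * A / (x / 2) = 16 / x * A := by field_simp; ring
    _ ≤ 16 / x * ((|Real.log K| + 1) * (1 + |y|) ^ (1 / 4 : ℝ) +
          N * (4 * ((1 + x + N) ^ (1 / 4 : ℝ) * (1 + |y|) ^ (1 / 4 : ℝ)))) := by
        simp only [A]
        gcongr
        exact le_mul_of_one_le_right (by positivity) h3
    _ = _ := by ring

lemma re_digamma_neg (x y : ℝ) :
    (logDeriv Complex.Gamma (x + (-y : ℝ) * I)).re = (logDeriv Complex.Gamma (x + y * I)).re := by
  have h1 : (starRingEnd ℂ) ∘ Complex.Gamma ∘ (starRingEnd ℂ) = Complex.Gamma := by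
    ext z
    simp [Complex.Gamma_conj]
  have h2 := deriv_conj_conj (f := Complex.Gamma)
  rw [h1] at h2
  have h3 : (x : ℂ) + (-y : ℝ) * I = (starRingEnd ℂ) (x + y * I) := by simp
  rw [h3, logDeriv_apply, logDeriv_apply, Complex.Gamma_conj]
  conv_lhs => rw [h2]
  simp only [Function.comp, conj_conj]
  rw [← map_div₀, conj_re]

lemma continuous_digamma_vertical {x : ℝ} (hx : 0 < x) :
    Continuous fun y : ℝ => logDeriv Complex.Gamma (x + y * I) := by
  have hop : IsOpen {z : ℂ | 0 < z.re} := isOpen_lt continuous_const continuous_re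
  have hd : DifferentiableOn ℂ Complex.Gamma {z : ℂ | 0 < z.re} := fun w hw =>
    (differentiableAt_Gamma_of_re_pos hw).differentiableWithinAt
  have hl : ContinuousOn (logDeriv Complex.Gamma) {z : ℂ | 0 < z.re} :=
    ((hd.deriv hop).div hd fun w hw => Complex.Gamma_ne_zero_of_re_pos hw).continuousOn
  exact hl.comp_continuous (by fun_prop) fun y => by simpa using hx

/-- For an even function `g` the two integrals below differ by boundary terms only. -/
lemma abs_integral_even_shift_le {g : ℝ → ℝ} (hg : Continuous g) (hev : ∀ y, g (-y) = g y) {K : ℝ}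
    (hK0 : 0 ≤ K) (hK : ∀ y, |g y| ≤ K * (1 + |y|) ^ (1 / 4 : ℝ)) {l : ℝ} (hl : 0 < l) (ν : ℝ) :
    ∃ B : ℝ, 0 ≤ B ∧ ∀ T : ℝ, 0 ≤ T →
      |∫ t in (0 : ℝ)..T, (g (l * t + ν) - g (l * (-t) + ν))| ≤ B * (1 + T) ^ (1 / 4 : ℝ) := by
  refine ⟨l⁻¹ * (4 * |ν| * (K * (1 + l + |ν|) ^ (1 / 4 : ℝ))), by positivity, fun T hT => ?_⟩
  have hii : ∀ a b : ℝ, IntervalIntegrable g MeasureTheory.volume a b := fun a b =>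
    hg.intervalIntegrable a b
  have h1 : ∫ t in (0 : ℝ)..T, (g (l * t + ν) - g (l * (-t) + ν)) =
      l⁻¹ * ((∫ y in (l * T - ν)..(l * T + ν), g y) - ∫ y in (-ν)..ν, g y) := by
    have e1 : ∀ t, g (l * (-t) + ν) = g (l * t - ν) := by
      intro t
      rw [← hev]
      congr 1
      ring
    simp only [e1]
    rw [intervalIntegral.integral_sub ((by fun_prop : Continuous _).intervalIntegrable _ _)
      ((by fun_prop : Continuous _).intervalIntegrable _ _),
      intervalIntegral.integral_comp_mul_add g hl.ne', intervalIntegral.integral_comp_mul_sub g hl.ne',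
      mul_zero, zero_add, zero_sub, smul_eq_mul, smul_eq_mul, ← mul_sub]
    congr 1
    have e2 := intervalIntegral.integral_add_adjacent_intervals (hii (-ν) ν) (hii ν (l * T + ν))
    have e3 := intervalIntegral.integral_add_adjacent_intervals (hii (-ν) (l * T - ν))
      (hii (l * T - ν) (l * T + ν))
    linarith
  have hM : ∀ y, |y| ≤ l * T + |ν| →
      |g y| ≤ K * (1 + l + |ν|) ^ (1 / 4 : ℝ) * (1 + T) ^ (1 / 4 : ℝ) := by
    intro y hy
    refine (hK y).trans ?_
    rw [mul_assoc, ← Real.mul_rpow (by positivity) (by positivity)]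
    gcongr
    nlinarith [abs_nonneg ν]
  have h2 : |∫ y in (l * T - ν)..(l * T + ν), g y| ≤
      K * (1 + l + |ν|) ^ (1 / 4 : ℝ) * (1 + T) ^ (1 / 4 : ℝ) * (2 * |ν|) := by
    have := intervalIntegral.norm_integral_le_of_norm_le_const (f := g) (a := l * T - ν)
      (b := l * T + ν) (C := K * (1 + l + |ν|) ^ (1 / 4 : ℝ) * (1 + T) ^ (1 / 4 : ℝ)) (by
        intro y hy
        refine hM y ?_
        have hlT : 0 ≤ l * T := by positivity
        rcases Set.mem_uIoc.1 hy with h | h <;> rw [abs_le] <;>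
          constructor <;> linarith [neg_abs_le ν, le_abs_self ν, h.1, h.2])
    rwa [show l * T + ν - (l * T - ν) = 2 * ν by ring, abs_mul, abs_two] at this
  have h3 : |∫ y in (-ν)..ν, g y| ≤
      K * (1 + l + |ν|) ^ (1 / 4 : ℝ) * (1 + T) ^ (1 / 4 : ℝ) * (2 * |ν|) := by
    have := intervalIntegral.norm_integral_le_of_norm_le_const (f := g) (a := -ν)
      (b := ν) (C := K * (1 + l + |ν|) ^ (1 / 4 : ℝ) * (1 + T) ^ (1 / 4 : ℝ)) (by
        intro y hy
        refine hM y ?_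
        have hlT : 0 ≤ l * T := by positivity
        rcases Set.mem_uIoc.1 hy with h | h <;> rw [abs_le] <;>
          constructor <;> linarith [neg_abs_le ν, le_abs_self ν, h.1, h.2])
    rwa [show ν - -ν = 2 * ν by ring, abs_mul, abs_two] at this
  rw [h1, abs_mul, abs_of_pos (inv_pos.2 hl)]
  calc l⁻¹ * |(∫ y in (l * T - ν)..(l * T + ν), g y) - ∫ y in (-ν)..ν, g y|
      ≤ l⁻¹ * (2 * (K * (1 + l + |ν|) ^ (1 / 4 : ℝ) * (1 + T) ^ (1 / 4 : ℝ) * (2 * |ν|))) := by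
        gcongr
        refine (abs_sub _ _).trans ?_
        linarith
    _ = _ := by ring

/-! ### Analytic continuation and zero-free regions of `ξ_F` -/

lemma abscissa_le_one_of_forall {a : ℕ → ℂ} {F : ℂ → ℂ}
    (h : ∀ s : ℂ, 1 < s.re → LSeriesHasSum a s (F s)) : LSeries.abscissaOfAbsConv a ≤ 1 := by
  refine LSeries.abscissaOfAbsConv_le_of_forall_lt_LSeriesSummable' fun y hy => ?_
  have hy' : (1 : ℝ) < y := by exact_mod_cast hy
  exact (h y (by simpa using hy')).LSeriesSummable

lemma norm_LSeries_le {a : ℕ → ℂ} (ha : LSeries.abscissaOfAbsConv a ≤ 1) {s : ℂ} (hs : 2 ≤ s.re) :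
    ‖LSeries a s‖ ≤ ∑' n, ‖LSeries.term a 2 n‖ := by
  have h2 : LSeriesSummable a 2 := LSeriesSummable_of_abscissaOfAbsConv_lt_re
    (ha.trans_lt (by simp only [re_ofNat]; exact_mod_cast one_lt_two))
  refine tsum_of_norm_bounded h2.norm.hasSum fun n => ?_
  exact LSeries.norm_term_le_of_re_le_re a (by simpa using hs) n

namespace IsSelbergSharpFlat

variable {F : ℂ → ℂ} {D : GammaData}

/-- In the half-plane of absolute convergence `F` is a constant times the exponential of a Dirichlet
series. In particular it has no zeros there, and its logarithm is bounded on `Re s ≥ 2`. -/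
lemma exists_log (hF : IsSelbergSharpFlat F D) :
    ∃ (L : ℂ → ℂ) (M : ℝ), (∀ s : ℂ, 1 < s.re → HasDerivAt L (logDeriv F s) s) ∧
      (∀ s : ℂ, 1 < s.re → F s ≠ 0) ∧
      (∀ s : ℂ, 2 ≤ s.re → ‖F s‖ ≤ M ∧ ‖L s‖ ≤ M ∧ ‖logDeriv F s‖ ≤ M) ∧
      DifferentiableOn ℂ F {s | 1 < s.re} := by
  obtain ⟨a, ha⟩ := hF.dirichlet_series
  obtain ⟨c, hc1, hc⟩ := hF.euler_sum
  obtain ⟨s₁, hs₁, hFs₁⟩ := hF.not_zero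
  have haab := abscissa_le_one_of_forall ha
  have hcab := abscissa_le_one_of_forall (F := fun s => -logDeriv F s) hc
  let b : ℕ → ℂ := fun n => c n / Real.log n
  have hbc : ∀ {n : ℕ}, n ≠ 0 → LSeries.logMul b n = c n := by
    intro n hn
    rcases (show n = 1 ∨ 2 ≤ n by omega) with rfl | h2
    · simp [LSeries.logMul, hc1]
    · simp only [LSeries.logMul, b, natCast_log]
      have : Real.log n ≠ 0 := (Real.log_pos (by exact_mod_cast h2)).ne'
      have : ((Real.log n : ℝ) : ℂ) ≠ 0 := by exact_mod_cast this
      rw [natCast_log] at this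
      field_simp
  have hbab : LSeries.abscissaOfAbsConv b ≤ 1 := by
    rw [← LSeries.abscissaOfAbsConv_logMul, LSeries.abscissaOfAbsConv_congr hbc]
    exact hcab
  have hlt : ∀ {f : ℕ → ℂ} {s : ℂ}, LSeries.abscissaOfAbsConv f ≤ 1 → 1 < s.re →
      LSeries.abscissaOfAbsConv f < s.re := fun hf hs => hf.trans_lt (by exact_mod_cast hs)
  have hFL : ∀ s : ℂ, 1 < s.re → F s = LSeries a s := fun s hs => (ha s hs).LSeries_eq.symm
  have hlogF : ∀ s : ℂ, 1 < s.re → logDeriv F s = -LSeries c s := fun s hs => by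
    rw [(hc s hs).LSeries_eq, neg_neg]
  have hL : ∀ s : ℂ, 1 < s.re → HasDerivAt (LSeries b) (logDeriv F s) s := by
    intro s hs
    have := LSeries_hasDerivAt (hlt hbab hs)
    rwa [LSeries_congr hbc, ← hlogF s hs] at this
  have hop : IsOpen {s : ℂ | 1 < s.re} := isOpen_lt continuous_const continuous_re
  have hconv : Convex ℝ {s : ℂ | 1 < s.re} := convex_halfSpace_re_gt 1
  have hFd : DifferentiableOn ℂ F {s : ℂ | 1 < s.re} := by
    have h1 : DifferentiableOn ℂ (LSeries a) {s : ℂ | 1 < s.re} := fun s hs =>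
      (LSeries_hasDerivAt (hlt haab hs)).differentiableAt.differentiableWithinAt
    exact h1.congr hFL
  have hLd : DifferentiableOn ℂ (LSeries b) {s : ℂ | 1 < s.re} := fun s hs =>
    (hL s hs).differentiableAt.differentiableWithinAt
  -- `F' = F * L'` near a point where `F` does not vanish, hence in the whole half-plane
  have hode : Set.EqOn (deriv F) (fun s => F s * deriv (LSeries b) s) {s : ℂ | 1 < s.re} := by
    refine ((hFd.deriv hop).analyticOnNhd hop).eqOn_of_preconnected_of_eventuallyEq
      ((hFd.mul (hLd.deriv hop)).analyticOnNhd hop) hconv.isPreconnected hs₁ ?_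
    have hcont : ContinuousAt F s₁ := (hFd.differentiableAt (hop.mem_nhds hs₁)).continuousAt
    filter_upwards [hcont.eventually_ne hFs₁, hop.mem_nhds hs₁] with s hs1 hs2
    rw [(hL s hs2).deriv, logDeriv_apply]
    field_simp
  have hq : ∀ w : ℂ, 1 < w.re → HasDerivAt (fun w => F w * exp (-LSeries b w)) 0 w := by
    intro w hw
    have h1 := ((hFd.differentiableAt (hop.mem_nhds hw)).hasDerivAt).mul ((hL w hw).neg.cexp)
    convert! h1 using 1
    rw [hode hw]
    simp only [Pi.neg_apply, (hL w hw).deriv]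
    ring
  have hne : ∀ s : ℂ, 1 < s.re → F s ≠ 0 := by
    intro s hs h0
    have hconst := hconv.is_const_of_fderivWithin_eq_zero (𝕜 := ℂ)
      (f := fun w => F w * exp (-LSeries b w))
      (fun w hw => (hq w hw).differentiableAt.differentiableWithinAt)
      (fun w hw => by
        rw [fderivWithin_of_isOpen hop hw]
        ext
        simpa using (hq w hw).deriv) hs hs₁
    simp only [h0, zero_mul] at hconst
    exact mul_ne_zero hFs₁ (exp_ne_zero _) hconst.symm
  refine ⟨LSeries b, max (∑' n, ‖LSeries.term a 2 n‖)
    (max (∑' n, ‖LSeries.term b 2 n‖) (∑' n, ‖LSeries.term c 2 n‖)), hL, hne, fun s hs => ?_, hFd⟩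
  have hs1 : 1 < s.re := by linarith
  refine ⟨?_, ?_, ?_⟩
  · rw [hFL s hs1]
    exact (norm_LSeries_le haab hs).trans (le_max_left _ _)
  · exact (norm_LSeries_le hbab hs).trans ((le_max_left _ _).trans (le_max_right _ _))
  · rw [hlogF s hs1, norm_neg]
    exact (norm_LSeries_le hcab hs).trans ((le_max_right _ _).trans (le_max_right _ _))

end IsSelbergSharpFlat

/-- The product defining `ξ_F`, with `(s - 1) ^ m * F s` replaced by its entire continuation `G`. -/
noncomputable def completedProduct (D : GammaData) (m : ℕ) (G : ℂ → ℂ) (s : ℂ) : ℂ :=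
  (-1) ^ m * s ^ m * G s * (D.Q : ℂ) ^ s * ∏ j, Complex.Gamma ((D.lam j : ℂ) * s + D.mu j)

lemma GammaData.re_pos (D : GammaData) (j : Fin D.r) {s : ℂ} (hs : 1 / 2 ≤ s.re) :
    D.lam j / 2 + (D.mu j).re ≤ ((D.lam j : ℂ) * s + D.mu j).re ∧
      0 < D.lam j / 2 + (D.mu j).re := by
  have h1 := D.lam_pos j
  have h2 := D.lam_mu j
  constructor
  · rw [add_re, re_ofReal_mul]
    nlinarith
  · linarith

lemma differentiableAt_completedProduct (D : GammaData) (m : ℕ) {G : ℂ → ℂ}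
    (hG : Differentiable ℂ G) {s : ℂ} (hs : ∀ j, 0 < ((D.lam j : ℂ) * s + D.mu j).re) :
    DifferentiableAt ℂ (completedProduct D m G) s := by
  have hQ : (D.Q : ℂ) ≠ 0 := by exact_mod_cast D.Q_pos.ne'
  have hΓ : DifferentiableAt ℂ (fun s : ℂ => ∏ j, Complex.Gamma ((D.lam j : ℂ) * s + D.mu j)) s := by
    refine DifferentiableAt.fun_finsetProd fun j _ => ?_
    exact DifferentiableAt.comp s (differentiableAt_Gamma_of_re_pos (hs j)) (by fun_prop)
  have hQd : DifferentiableAt ℂ (fun s : ℂ => (D.Q : ℂ) ^ s) s :=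
    DifferentiableAt.const_cpow differentiableAt_id (Or.inl hQ)
  unfold completedProduct
  exact (((differentiableAt_const _).mul (differentiableAt_id.pow m)).mul (hG s)).mul hQd |>.mul hΓ

/-- In the half-plane `Re s ≥ 1 / 2` the function `ξ_F` is given by the product: the condition
`λ_j + 2 Re μ_j > 0` keeps the poles of all gamma factors to the left of it. -/
lemma xi_eventuallyEq {F : ℂ → ℂ} {D : GammaData} {G : ℂ → ℂ} (hG : Differentiable ℂ G)
    (hGF : ∀ s : ℂ, s ≠ 1 → G s = (s - 1) ^ polarOrder F * F s) {s : ℂ} (hs : 1 / 2 ≤ s.re) :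
    xi F D =ᶠ[𝓝 s] completedProduct D (polarOrder F) G := by
  set m := polarOrder F
  let P : ℂ → ℂ := fun s => s ^ m * (1 - s) ^ m * F s * (D.Q : ℂ) ^ s *
      ∏ j, Complex.Gamma ((D.lam j : ℂ) * s + D.mu j)
  have hQ : (D.Q : ℂ) ≠ 0 := by exact_mod_cast D.Q_pos.ne'
  have hPH : ∀ z : ℂ, z ≠ 1 → completedProduct D m G z = P z := by
    intro z hz
    simp only [completedProduct, P]
    rw [hGF z hz, show (1 - z) ^ m = (-1) ^ m * (z - 1) ^ m by rw [← mul_pow]; ring]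
    ring
  have hev : ∀ z : ℂ, completedProduct D m G =ᶠ[𝓝[≠] z] P := by
    intro z
    by_cases hz : z = 1
    · subst hz
      filter_upwards [self_mem_nhdsWithin] with w hw using hPH w hw
    · filter_upwards [mem_nhdsWithin_of_mem_nhds (isOpen_ne.mem_nhds hz)] with w hw using hPH w hw
  have hmer : MeromorphicOn P Set.univ := by
    intro z _
    refine MeromorphicAt.congr ?_ (hev z)
    have h1 : AnalyticAt ℂ (fun s : ℂ => (-1) ^ m * s ^ m * G s * (D.Q : ℂ) ^ s) z := by
      have hd : Differentiable ℂ (fun s : ℂ => (-1) ^ m * s ^ m * G s * (D.Q : ℂ) ^ s) := fun s =>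
        (((differentiableAt_const _).mul (differentiableAt_id.pow m)).mul (hG s)).mul
          (DifferentiableAt.const_cpow differentiableAt_id (Or.inl hQ))
      exact hd.analyticAt z
    refine h1.meromorphicAt.mul (MeromorphicAt.fun_prod fun j _ => ?_)
    refine MeromorphicAt.comp_analyticAt (g := fun s : ℂ => (D.lam j : ℂ) * s + D.mu j)
      (MeromorphicOn.Gamma (s := Set.univ) _ trivial) ?_
    exact (by fun_prop : Differentiable ℂ fun s : ℂ => (D.lam j : ℂ) * s + D.mu j).analyticAt z
  have h2 : xi F D =ᶠ[𝓝[≠] s] completedProduct D m G :=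
    (hmer.toMeromorphicNFOn_eq_self_on_nhdsNE (Set.mem_univ s)).trans (hev s).symm
  have hop : IsOpen {z : ℂ | ∀ j, 0 < ((D.lam j : ℂ) * z + D.mu j).re} := by
    rw [Set.ofPred_forall]
    exact isOpen_iInter_of_finite fun j => isOpen_lt continuous_const (by fun_prop)
  have hsop : s ∈ {z : ℂ | ∀ j, 0 < ((D.lam j : ℂ) * z + D.mu j).re} := fun j =>
    (D.re_pos j hs).2.trans_le (D.re_pos j hs).1
  have hA : AnalyticAt ℂ (completedProduct D m G) s := by
    have hd : DifferentiableOn ℂ (completedProduct D m G)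
        {z : ℂ | ∀ j, 0 < ((D.lam j : ℂ) * z + D.mu j).re} := fun z hz =>
      (differentiableAt_completedProduct D m hG hz).differentiableWithinAt
    exact hd.analyticAt (hop.mem_nhds hsop)
  exact ((meromorphicNFOn_toMeromorphicNFOn P Set.univ (Set.mem_univ s)
    ).eventuallyEq_nhdsNE_iff_eventuallyEq_nhds hA.meromorphicNFAt).1 h2

namespace IsSelbergSharpFlat

variable {F : ℂ → ℂ} {D : GammaData}

lemma exists_continuation (hF : IsSelbergSharpFlat F D) : ∃ G : ℂ → ℂ, Differentiable ℂ G ∧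
    HasFiniteOrder G ∧ ∀ s : ℂ, s ≠ 1 → G s = (s - 1) ^ polarOrder F * F s :=
  Nat.sInf_mem (s := {m : ℕ | IsPolarBound F m}) hF.continuation

lemma norm_xi_one_sub_conj (hF : IsSelbergSharpFlat F D) (s : ℂ) :
    ‖xi F D s‖ = ‖xi F D (1 - (starRingEnd ℂ) s)‖ := by
  rw [hF.functional_equation s, norm_mul, D.norm_w, one_mul, RCLike.norm_conj]

/-- `ξ_F` is entire: the functional equation carries holomorphy from `Re s ≥ 1 / 2` to the left. -/
lemma differentiable_xi (hF : IsSelbergSharpFlat F D) : Differentiable ℂ (xi F D) := by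
  obtain ⟨G, hG, -, hGF⟩ := hF.exists_continuation
  have hright : ∀ s : ℂ, 1 / 2 ≤ s.re → DifferentiableAt ℂ (xi F D) s := by
    intro s hs
    refine DifferentiableAt.congr_of_eventuallyEq ?_ (xi_eventuallyEq hG hGF hs)
    exact differentiableAt_completedProduct D _ hG fun j =>
      (D.re_pos j hs).2.trans_le (D.re_pos j hs).1
  intro s
  rcases le_or_gt (1 / 2) s.re with hs | hs
  · exact hright s hs
  · have hk : DifferentiableAt ℂ (fun t : ℂ => xi F D (1 - t)) ((starRingEnd ℂ) s) := by
      refine DifferentiableAt.comp (g := xi F D) (f := fun t : ℂ => 1 - t) _ (hright _ ?_)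
        (by fun_prop)
      simp only [sub_re, one_re, conj_re]
      linarith
    have h2 := (differentiableAt_conj_conj_iff.2 hk).const_mul D.w
    refine h2.congr_of_eventuallyEq (Eventually.of_forall fun z => ?_)
    simpa using hF.functional_equation z

lemma xi_ne_zero (hF : IsSelbergSharpFlat F D) {s : ℂ} (hs : 1 < s.re) : xi F D s ≠ 0 := by
  obtain ⟨G, hG, -, hGF⟩ := hF.exists_continuation
  obtain ⟨-, -, -, hne, -⟩ := hF.exists_log
  have hQ : (D.Q : ℂ) ≠ 0 := by exact_mod_cast D.Q_pos.ne'
  have h12 : 1 / 2 ≤ s.re := by linarith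
  have hs1 : s ≠ 1 := by rintro rfl; simp at hs
  have hs0 : s ≠ 0 := by rintro rfl; simp at hs; linarith
  rw [(xi_eventuallyEq hG hGF h12).self_of_nhds, completedProduct, hGF s hs1]
  refine mul_ne_zero (mul_ne_zero (mul_ne_zero (mul_ne_zero (by simp) (pow_ne_zero _ hs0))
    (mul_ne_zero (pow_ne_zero _ (sub_ne_zero.2 hs1)) (hne s hs))) ?_) ?_
  · rw [cpow_def_of_ne_zero hQ]
    exact exp_ne_zero _
  · exact Finset.prod_ne_zero_iff.2 fun j _ => Complex.Gamma_ne_zero_of_re_pos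
      ((D.re_pos j h12).2.trans_le (D.re_pos j h12).1)

lemma re_mem_of_xi_eq_zero (hF : IsSelbergSharpFlat F D) {ρ : ℂ} (h : xi F D ρ = 0) :
    0 ≤ ρ.re ∧ ρ.re ≤ 1 := by
  constructor
  · by_contra hlt
    have h1 := hF.norm_xi_one_sub_conj ρ
    rw [h, norm_zero, eq_comm, norm_eq_zero] at h1
    refine hF.xi_ne_zero ?_ h1
    simp only [sub_re, one_re, conj_re]
    linarith [not_le.1 hlt]
  · by_contra hlt
    exact hF.xi_ne_zero (not_le.1 hlt) h

end IsSelbergSharpFlat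

/-! ### Growth of `ξ_F` -/

/-- `log |f(s)| ≪ (1 + |s|) ^ p` on the set `S`. -/
def HasGrowthOn (p : ℝ) (S : Set ℂ) (f : ℂ → ℂ) : Prop :=
  ∃ C : ℝ, 0 ≤ C ∧ ∀ s ∈ S, ‖f s‖ ≤ Real.exp (C * (1 + ‖s‖) ^ p)

namespace HasGrowthOn

variable {p q : ℝ} {S : Set ℂ} {f g : ℂ → ℂ}

lemma mul (hf : HasGrowthOn p S f) (hg : HasGrowthOn p S g) :
    HasGrowthOn p S fun s => f s * g s := by
  obtain ⟨C, hC0, hC⟩ := hf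
  obtain ⟨C', hC0', hC'⟩ := hg
  refine ⟨C + C', by positivity, fun s hs => ?_⟩
  rw [norm_mul, add_mul, Real.exp_add]
  exact mul_le_mul (hC s hs) (hC' s hs) (norm_nonneg _) (Real.exp_pos _).le

lemma prod {ι : Type*} (I : Finset ι) {f : ι → ℂ → ℂ} (hf : ∀ i ∈ I, HasGrowthOn p S (f i)) :
    HasGrowthOn p S fun s => ∏ i ∈ I, f i s := by
  classical
  induction I using Finset.induction_on with
  | empty => exact ⟨0, le_rfl, fun s _ => by simp⟩
  | insert i I hi ih =>
    have := (hf i (Finset.mem_insert_self _ _)).mul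
      (ih fun j hj => hf j (Finset.mem_insert_of_mem hj))
    simpa only [Finset.prod_insert hi] using this

lemma mono_exponent (hpq : p ≤ q) (hf : HasGrowthOn p S f) : HasGrowthOn q S f := by
  obtain ⟨C, hC0, hC⟩ := hf
  refine ⟨C, hC0, fun s hs => (hC s hs).trans (Real.exp_le_exp.2 ?_)⟩
  gcongr
  linarith [norm_nonneg s]

lemma mono_set {S' : Set ℂ} (hS : S' ⊆ S) (hf : HasGrowthOn p S f) : HasGrowthOn p S' f := by
  obtain ⟨C, hC0, hC⟩ := hf
  exact ⟨C, hC0, fun s hs => hC s (hS hs)⟩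

lemma union {S' : Set ℂ} (hf : HasGrowthOn p S f) (hf' : HasGrowthOn p S' f) :
    HasGrowthOn p (S ∪ S') f := by
  obtain ⟨C, hC0, hC⟩ := hf
  obtain ⟨C', hC0', hC'⟩ := hf'
  refine ⟨C + C', by positivity, fun s hs => ?_⟩
  have h1 : 0 ≤ (1 + ‖s‖) ^ p := by positivity
  rcases hs with hs | hs
  · exact (hC s hs).trans (Real.exp_le_exp.2 (by nlinarith))
  · exact (hC' s hs).trans (Real.exp_le_exp.2 (by nlinarith))

lemma of_norm_le (hp : 1 ≤ p) {A B : ℝ} (n : ℕ) (hA : 0 ≤ A) (hB : 0 ≤ B)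
    (h : ∀ s ∈ S, ‖f s‖ ≤ A * (B + ‖s‖) ^ n) : HasGrowthOn p S f := by
  refine ⟨A + n * (1 + B), by positivity, fun s hs => (h s hs).trans ?_⟩
  have hs0 := norm_nonneg s
  have h1 : (1 : ℝ) ≤ (1 + ‖s‖) ^ p := Real.one_le_rpow (by linarith) (by linarith)
  have h2 : 1 + ‖s‖ ≤ (1 + ‖s‖) ^ p := by
    conv_lhs => rw [← Real.rpow_one (1 + ‖s‖)]
    exact Real.rpow_le_rpow_of_exponent_le (by linarith) hp
  have h3 : (B + ‖s‖) ^ n ≤ Real.exp (n * (B + ‖s‖)) := by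
    rw [Real.exp_nat_mul]
    exact pow_le_pow_left₀ (by positivity) (by linarith [Real.add_one_le_exp (B + ‖s‖)]) n
  calc A * (B + ‖s‖) ^ n ≤ Real.exp A * Real.exp (n * (B + ‖s‖)) := by
        refine mul_le_mul (by linarith [Real.add_one_le_exp A]) h3 (by positivity)
          (Real.exp_pos _).le
    _ ≤ _ := by
        rw [← Real.exp_add, Real.exp_le_exp, add_mul]
        refine add_le_add (le_mul_of_one_le_right hA h1) ?_
        rw [mul_assoc]
        refine mul_le_mul_of_nonneg_left ?_ (by positivity)
        nlinarith

lemma cpow (hp : 1 ≤ p) {Q : ℝ} (hQ : 0 < Q) : HasGrowthOn p S fun s => (Q : ℂ) ^ s := by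
  refine ⟨|Real.log Q|, abs_nonneg _, fun s _ => ?_⟩
  rw [norm_cpow_eq_rpow_re_of_pos hQ, Real.rpow_def_of_pos hQ, Real.exp_le_exp]
  have h2 : 1 + ‖s‖ ≤ (1 + ‖s‖) ^ p := by
    conv_lhs => rw [← Real.rpow_one (1 + ‖s‖)]
    exact Real.rpow_le_rpow_of_exponent_le (by linarith [norm_nonneg s]) hp
  calc Real.log Q * s.re ≤ |Real.log Q * s.re| := le_abs_self _
    _ = |Real.log Q| * |s.re| := abs_mul _ _
    _ ≤ |Real.log Q| * (1 + ‖s‖) ^ p := by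
      gcongr
      linarith [abs_re_le_norm s]

lemma Gamma_comp {l : ℝ} (hl : 0 < l) {μ : ℂ} {δ : ℝ} (hδ : 0 < δ)
    (hS : ∀ s ∈ S, δ ≤ ((l : ℂ) * s + μ).re) :
    HasGrowthOn (9 / 8) S fun s => Complex.Gamma ((l : ℂ) * s + μ) := by
  obtain ⟨C, hC0, hC⟩ := exists_Gamma_le_exp hδ
  refine ⟨C * (1 + l + ‖μ‖) ^ (9 / 8 : ℝ), by positivity, fun s hs => ?_⟩
  refine (norm_Gamma_le_Gamma_re (hδ.trans_le (hS s hs))).trans ((hC _ (hS s hs)).trans ?_)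
  rw [Real.exp_le_exp, mul_assoc, ← Real.mul_rpow (by positivity) (by positivity)]
  have h0 := hδ.trans_le (hS s hs)
  have h1 : ((l : ℂ) * s + μ).re ≤ l * ‖s‖ + ‖μ‖ := by
    rw [add_re, re_ofReal_mul]
    have h2 := re_le_norm s
    have h3 := re_le_norm μ
    nlinarith
  refine mul_le_mul_of_nonneg_left (Real.rpow_le_rpow (by linarith) ?_ (by norm_num)) hC0
  nlinarith [norm_nonneg s, norm_nonneg μ]

/-- Growth is preserved by the reflection `s ↦ 1 - conj s`. -/
lemma of_reflection (hp : 0 ≤ p) (hf : ∀ s, ‖f s‖ = ‖f (1 - (starRingEnd ℂ) s)‖)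
    (h : HasGrowthOn p S f) {S' : Set ℂ} (hS : ∀ s ∈ S', 1 - (starRingEnd ℂ) s ∈ S) :
    HasGrowthOn p S' f := by
  obtain ⟨C, hC0, hC⟩ := h
  refine ⟨C * 2 ^ p, by positivity, fun s hs => ?_⟩
  rw [hf s]
  refine (hC _ (hS s hs)).trans (Real.exp_le_exp.2 ?_)
  rw [mul_assoc, ← Real.mul_rpow (by norm_num) (by positivity)]
  gcongr
  have : ‖1 - (starRingEnd ℂ) s‖ ≤ 1 + ‖s‖ := by
    refine (norm_sub_le _ _).trans ?_
    simp
  linarith [norm_nonneg s]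

end HasGrowthOn

/-- The exponent may be taken to be an integer that is at least `2`. -/
lemma HasFiniteOrder.hasGrowthOn {G : ℂ → ℂ} (hG : Differentiable ℂ G) (h : HasFiniteOrder G) :
    ∃ n : ℕ, 2 ≤ n ∧ HasGrowthOn n Set.univ G := by
  obtain ⟨A, hA⟩ := h
  obtain ⟨c, hc0, hc⟩ := hA.exists_pos
  obtain ⟨n, hn⟩ := exists_nat_ge A
  have hc := hc.bound
  rw [Filter.Eventually, mem_cocompact] at hc
  obtain ⟨K, hK, hKc⟩ := hc
  obtain ⟨M, hM⟩ := (hK.union (isCompact_closedBall (0 : ℂ) 1)).exists_bound_of_continuousOn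
    hG.continuous.continuousOn
  refine ⟨n + 2, by omega, |M| + c + 1, by positivity, fun s _ => ?_⟩
  have h1 : (1 : ℝ) ≤ (1 + ‖s‖) ^ ((n + 2 : ℕ) : ℝ) :=
    Real.one_le_rpow (by linarith [norm_nonneg s]) (by positivity)
  by_cases hs : s ∈ K ∪ closedBall (0 : ℂ) 1
  · calc ‖G s‖ ≤ |M| := (hM s hs).trans (le_abs_self M)
      _ ≤ Real.exp |M| := by linarith [Real.add_one_le_exp |M|]
      _ ≤ _ := by
        rw [Real.exp_le_exp]
        nlinarith [abs_nonneg M]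
  · have hsK : s ∉ K := fun h => hs (Or.inl h)
    have hs1 : 1 < ‖s‖ := by
      by_contra hlt
      exact hs (Or.inr (by simpa using not_lt.1 hlt))
    have h2 : ‖G s‖ ≤ c * ‖Real.exp (‖s‖ ^ A)‖ := hKc hsK
    rw [Real.norm_eq_abs, Real.abs_exp] at h2
    have h3 : ‖s‖ ^ A ≤ (1 + ‖s‖) ^ ((n + 2 : ℕ) : ℝ) := by
      refine (Real.rpow_le_rpow_of_exponent_le hs1.le (y := A) (z := ((n + 2 : ℕ) : ℝ)) ?_).trans
        (Real.rpow_le_rpow (by positivity) (by linarith) (by positivity))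
      push_cast
      linarith
    calc ‖G s‖ ≤ c * Real.exp (‖s‖ ^ A) := h2
      _ ≤ Real.exp c * Real.exp ((1 + ‖s‖) ^ ((n + 2 : ℕ) : ℝ)) := by
        gcongr
        linarith [Real.add_one_le_exp c]
      _ ≤ _ := by
        rw [← Real.exp_add, Real.exp_le_exp]
        nlinarith [abs_nonneg M]

namespace IsSelbergSharpFlat

variable {F : ℂ → ℂ} {D : GammaData}

lemma hasGrowthOn_xi_of_continuation {G : ℂ → ℂ}
    (hG : Differentiable ℂ G) (hGF : ∀ s : ℂ, s ≠ 1 → G s = (s - 1) ^ polarOrder F * F s) {p : ℝ}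
    (hp : 9 / 8 ≤ p) {S : Set ℂ} (hS : ∀ s ∈ S, 1 / 2 ≤ s.re) (hGp : HasGrowthOn p S G) :
    HasGrowthOn p S (xi F D) := by
  have hp1 : 1 ≤ p := by linarith
  have h1 : HasGrowthOn p S fun s : ℂ => (-1 : ℂ) ^ polarOrder F * s ^ polarOrder F :=
    HasGrowthOn.of_norm_le hp1 (polarOrder F) zero_le_one le_rfl fun s _ => by simp
  have h2 : HasGrowthOn p S
      fun s : ℂ => ∏ j, Complex.Gamma ((D.lam j : ℂ) * s + D.mu j) := by
    refine HasGrowthOn.prod _ fun j _ => HasGrowthOn.mono_exponent hp ?_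
    have h12 : (1 : ℝ) / 2 ≤ (1 / 2 : ℂ).re := by norm_num
    exact HasGrowthOn.Gamma_comp (D.lam_pos j) (D.re_pos j h12).2 fun s hs => (D.re_pos j (hS s hs)).1
  obtain ⟨C, hC0, hC⟩ := ((h1.mul hGp).mul (HasGrowthOn.cpow hp1 D.Q_pos)).mul h2
  refine ⟨C, hC0, fun s hs => ?_⟩
  rw [(xi_eventuallyEq hG hGF (hS s hs)).self_of_nhds]
  exact hC s hs

/-- The finite order of `(s - 1) ^ m * F s` gives a crude growth bound for `ξ_F`, sufficient for the
Phragmén–Lindelöf principle in a vertical strip. -/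
lemma exists_crude_growth (hF : IsSelbergSharpFlat F D) :
    ∃ n : ℕ, HasGrowthOn n Set.univ (xi F D) := by
  obtain ⟨G, hG, hGo, hGF⟩ := hF.exists_continuation
  obtain ⟨n, hn, hGn⟩ := hGo.hasGrowthOn hG
  have hn2 : (2 : ℝ) ≤ n := by exact_mod_cast hn
  have hr : HasGrowthOn n {s : ℂ | 1 / 2 ≤ s.re} (xi F D) :=
    hasGrowthOn_xi_of_continuation hG hGF (by linarith) (fun s hs => hs)
      (hGn.mono_set (Set.subset_univ _))
  have hl : HasGrowthOn n {s : ℂ | s.re < 1 / 2} (xi F D) := by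
    refine hr.of_reflection (by positivity) hF.norm_xi_one_sub_conj fun s hs => ?_
    have hs : s.re < 1 / 2 := hs
    simp only [Set.mem_ofPred_eq, sub_re, one_re, conj_re]
    linarith
  refine ⟨n, (hr.union hl).mono_set fun s _ => ?_⟩
  exact le_or_gt (1 / 2) s.re

/-- On the line `Re s = 2` the gamma factors and `F` are bounded, so only the polynomial factors
matter; they are compared with powers of `s + 3`, which has no zero in `-1 ≤ Re s ≤ 2`. -/
lemma exists_bound_re_eq_two (hF : IsSelbergSharpFlat F D) :
    ∃ B : ℝ, 0 ≤ B ∧ ∀ s : ℂ, s.re = 2 → ‖xi F D s‖ ≤ B * ‖s + 3‖ ^ (2 * polarOrder F) := by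
  obtain ⟨G, hG, -, hGF⟩ := hF.exists_continuation
  obtain ⟨L, M, -, -, hM, -⟩ := hF.exists_log
  refine ⟨|M| * D.Q ^ (2 : ℝ) * ∏ j, Real.Gamma (D.lam j * 2 + (D.mu j).re),
    mul_nonneg (by have := D.Q_pos; positivity) (Finset.prod_nonneg fun j _ => ?_), fun s hs => ?_⟩
  · refine (Real.Gamma_pos_of_pos ?_).le
    have h1 := D.lam_pos j
    have h2 := D.lam_mu j
    linarith
  have hs1 : s ≠ 1 := by rintro rfl; simp at hs
  rw [(xi_eventuallyEq hG hGF (by linarith)).self_of_nhds, completedProduct, hGF s hs1]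
  simp only [norm_mul, norm_pow, norm_neg, norm_one, one_pow, one_mul, norm_prod]
  rw [norm_cpow_eq_rpow_re_of_pos D.Q_pos, hs]
  have e1 : ‖s‖ ≤ ‖s + 3‖ := by
    rw [← sq_le_sq₀ (norm_nonneg _) (norm_nonneg _), ← normSq_eq_norm_sq, ← normSq_eq_norm_sq,
      normSq_apply, normSq_apply]
    simp only [add_re, add_im, hs, re_ofNat, im_ofNat]
    nlinarith
  have e2 : ‖s - 1‖ ≤ ‖s + 3‖ := by
    rw [← sq_le_sq₀ (norm_nonneg _) (norm_nonneg _), ← normSq_eq_norm_sq, ← normSq_eq_norm_sq,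
      normSq_apply, normSq_apply]
    simp only [add_re, add_im, sub_re, sub_im, hs, re_ofNat, im_ofNat, one_re, one_im]
    nlinarith
  have e3 : ‖F s‖ ≤ |M| := ((hM s hs.ge).1).trans (le_abs_self M)
  have e4 : ∏ j, ‖Complex.Gamma ((D.lam j : ℂ) * s + D.mu j)‖ ≤
      ∏ j, Real.Gamma (D.lam j * 2 + (D.mu j).re) := by
    refine Finset.prod_le_prod (fun _ _ => norm_nonneg _) fun j _ => ?_
    have h1 := D.lam_pos j
    have h2 := D.lam_mu j
    have h3 : ((D.lam j : ℂ) * s + D.mu j).re = D.lam j * 2 + (D.mu j).re := by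
      rw [add_re, re_ofReal_mul, hs]
    rw [← h3]
    exact norm_Gamma_le_Gamma_re (by rw [h3]; linarith)
  have hQ := D.Q_pos
  calc ‖s‖ ^ polarOrder F * (‖s - 1‖ ^ polarOrder F * ‖F s‖) * D.Q ^ (2 : ℝ) *
        ∏ j, ‖Complex.Gamma ((D.lam j : ℂ) * s + D.mu j)‖
      ≤ ‖s + 3‖ ^ polarOrder F * (‖s + 3‖ ^ polarOrder F * |M|) * D.Q ^ (2 : ℝ) *
        ∏ j, Real.Gamma (D.lam j * 2 + (D.mu j).re) := by gcongr
    _ = _ := by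
      rw [two_mul (polarOrder F), pow_add]
      ring

/-- In the strip `-1 ≤ Re s ≤ 2` the function `ξ_F` has polynomial growth. -/
lemma exists_strip_bound (hF : IsSelbergSharpFlat F D) :
    ∃ B : ℝ, 0 ≤ B ∧ ∀ s : ℂ, -1 ≤ s.re → s.re ≤ 2 →
      ‖xi F D s‖ ≤ B * ‖s + 3‖ ^ (2 * polarOrder F) := by
  obtain ⟨B, hB0, hB⟩ := hF.exists_bound_re_eq_two
  obtain ⟨n, C, hC0, hC⟩ := hF.exists_crude_growth
  set m := polarOrder F
  have hre3 : ∀ s : ℂ, -1 ≤ s.re → 2 ≤ ‖s + 3‖ := by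
    intro s hs
    have := re_le_norm (s + 3)
    simp at this
    linarith
  have hne : ∀ s : ℂ, -1 ≤ s.re → (s + 3) ^ (2 * m) ≠ 0 := fun s hs =>
    pow_ne_zero _ (norm_pos_iff.1 (by linarith [hre3 s hs]))
  let k : ℂ → ℂ := fun s => xi F D s / (s + 3) ^ (2 * m)
  have hkd : ∀ s : ℂ, -1 ≤ s.re → DifferentiableAt ℂ k s := fun s hs =>
    (hF.differentiable_xi s).div (by fun_prop) (hne s hs)
  have hkb : ∀ s : ℂ, -1 ≤ s.re → ‖k s‖ ≤ ‖xi F D s‖ := by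
    intro s hs
    simp only [k, norm_div, norm_pow]
    exact div_le_self (norm_nonneg _) (one_le_pow₀ (by linarith [hre3 s hs]))
  have hstrip : closure (re ⁻¹' Set.Ioo (-1 : ℝ) 2) ⊆ {s : ℂ | -1 ≤ s.re} :=
    closure_minimal (fun s hs => hs.1.le) (isClosed_le continuous_const continuous_re)
  have hd : DiffContOnCl ℂ k (re ⁻¹' Set.Ioo (-1 : ℝ) 2) :=
    ⟨fun s hs => (hkd s hs.1.le).differentiableWithinAt,
      fun s hs => (hkd s (hstrip hs)).continuousAt.continuousWithinAt⟩
  have hgrowth : ∃ c < Real.pi / (2 - (-1)), ∃ B', k =O[comap (_root_.abs ∘ im) atTop ⊓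
      𝓟 (re ⁻¹' Set.Ioo (-1 : ℝ) 2)] fun z => Real.exp (B' * Real.exp (c * |z.im|)) := by
    refine ⟨1, ?_, C * (n.factorial * Real.exp 3), ?_⟩
    · have := Real.pi_gt_three
      rw [lt_div_iff₀ (by norm_num)]
      linarith
    · refine Asymptotics.IsBigO.of_bound 1 ?_
      refine eventually_inf_principal.2 (Eventually.of_forall fun s hs => ?_)
      rw [one_mul, Real.norm_eq_abs, Real.abs_exp]
      refine ((hkb s hs.1.le).trans (hC s trivial)).trans (Real.exp_le_exp.2 ?_)
      rw [mul_assoc]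
      refine mul_le_mul_of_nonneg_left ?_ hC0
      have h1 : 1 + ‖s‖ ≤ 3 + |s.im| := by
        have := norm_le_abs_re_add_abs_im s
        have h2 : |s.re| ≤ 2 := abs_le.2 ⟨by linarith [hs.1], hs.2.le⟩
        linarith
      rw [Real.rpow_natCast]
      calc (1 + ‖s‖) ^ n ≤ (3 + |s.im|) ^ n := by gcongr
        _ ≤ n.factorial * Real.exp (3 + |s.im|) := by
          have := Real.pow_div_factorial_le_exp (3 + |s.im|) (by positivity) n
          rwa [div_le_iff₀ (by positivity), mul_comm] at this
        _ = _ := by rw [Real.exp_add, one_mul]; ring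
  have hB3 : ∀ s : ℂ, s.re = 2 → ‖k s‖ ≤ B * 3 ^ (2 * m) := by
    intro s hs
    simp only [k, norm_div, norm_pow]
    have h3 := hre3 s (by linarith)
    rw [div_le_iff₀ (by positivity)]
    refine (hB s hs).trans ?_
    have : (1 : ℝ) ≤ 3 ^ (2 * m) := one_le_pow₀ (by norm_num)
    gcongr
    exact le_mul_of_one_le_right hB0 this
  have hB3' : ∀ s : ℂ, s.re = -1 → ‖k s‖ ≤ B * 3 ^ (2 * m) := by
    intro s hs
    simp only [k, norm_div, norm_pow]
    have h3 := hre3 s (by linarith)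
    rw [div_le_iff₀ (by positivity), mul_assoc, ← mul_pow, hF.norm_xi_one_sub_conj s]
    refine (hB _ (by simp [hs]; norm_num)).trans ?_
    gcongr
    have h4 : 1 - (starRingEnd ℂ) s + 3 = (s + 3) + 3 := by
      apply Complex.ext <;> simp [hs]
      norm_num
    rw [h4]
    refine (norm_add_le _ _).trans ?_
    simp
    linarith
  refine ⟨B * 3 ^ (2 * m), by positivity, fun s hs1 hs2 => ?_⟩
  have := PhragmenLindelof.vertical_strip hd hgrowth hB3' hB3 hs1 hs2
  simp only [k, norm_div, norm_pow] at this
  have h3 := hre3 s hs1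
  rwa [div_le_iff₀ (by positivity)] at this

/-- `log |ξ_F(s)| ≪ (1 + |s|) ^ (9 / 8)`. -/
lemma hasGrowthOn_xi (hF : IsSelbergSharpFlat F D) : HasGrowthOn (9 / 8) Set.univ (xi F D) := by
  obtain ⟨G, hG, -, hGF⟩ := hF.exists_continuation
  obtain ⟨L, M, -, -, hM, -⟩ := hF.exists_log
  obtain ⟨B, hB0, hB⟩ := hF.exists_strip_bound
  have hr : HasGrowthOn (9 / 8) {s : ℂ | 2 ≤ s.re} (xi F D) := by
    refine hasGrowthOn_xi_of_continuation hG hGF le_rfl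
      (fun s hs => le_trans (by norm_num) (show (2 : ℝ) ≤ s.re from hs)) ?_
    refine HasGrowthOn.of_norm_le (by norm_num) (polarOrder F) (abs_nonneg M) zero_le_one
      fun s hs => ?_
    have hs1 : s ≠ 1 := by rintro rfl; norm_num at hs
    rw [hGF s hs1, norm_mul, norm_pow, mul_comm]
    refine mul_le_mul (((hM s hs).1).trans (le_abs_self M)) ?_ (by positivity) (abs_nonneg M)
    refine pow_le_pow_left₀ (norm_nonneg _) ((norm_sub_le _ _).trans ?_) _
    rw [norm_one, add_comm]
  have hl : HasGrowthOn (9 / 8) {s : ℂ | s.re ≤ -1} (xi F D) := by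
    refine hr.of_reflection (by norm_num) hF.norm_xi_one_sub_conj fun s hs => ?_
    have hs : s.re ≤ -1 := hs
    simp only [Set.mem_ofPred_eq, sub_re, one_re, conj_re]
    linarith
  have hm : HasGrowthOn (9 / 8) {s : ℂ | -1 ≤ s.re ∧ s.re ≤ 2} (xi F D) := by
    refine HasGrowthOn.of_norm_le (by norm_num) (2 * polarOrder F) hB0 (by norm_num : (0 : ℝ) ≤ 3)
      fun s hs => (hB s hs.1 hs.2).trans ?_
    gcongr
    refine (norm_add_le _ _).trans ?_
    simp [add_comm]
  refine ((hr.union hl).union hm).mono_set fun s _ => ?_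
  rcases le_or_gt 2 s.re with h | h
  · exact Or.inl (Or.inl h)
  · rcases le_or_gt s.re (-1) with h' | h'
    · exact Or.inl (Or.inr h')
    · exact Or.inr ⟨h'.le, h.le⟩

end IsSelbergSharpFlat

/-! ### The logarithmic derivative of `ξ_F` on the line `Re s = 2` -/

namespace IsSelbergSharpFlat

variable {F : ℂ → ℂ} {D : GammaData}

lemma logDeriv_xi (hF : IsSelbergSharpFlat F D) {s : ℂ} (hs : 1 < s.re) :
    logDeriv (xi F D) s = polarOrder F / s + polarOrder F / (s - 1) + logDeriv F s +
      Real.log D.Q + ∑ j, (D.lam j : ℂ) * logDeriv Complex.Gamma ((D.lam j : ℂ) * s + D.mu j) := by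
  obtain ⟨G, hG, -, hGF⟩ := hF.exists_continuation
  obtain ⟨L, M, -, hne, -, hFd⟩ := hF.exists_log
  set m := polarOrder F
  have hs12 : 1 / 2 ≤ s.re := by linarith
  have hQ : (D.Q : ℂ) ≠ 0 := by exact_mod_cast D.Q_pos.ne'
  have hs1 : s ≠ 1 := by rintro rfl; simp at hs
  have hs0 : s ≠ 0 := by rintro rfl; norm_num at hs
  have hs1' : s - 1 ≠ 0 := sub_ne_zero.2 hs1
  have hop : IsOpen {s : ℂ | 1 < s.re} := isOpen_lt continuous_const continuous_re
  have hFs : DifferentiableAt ℂ F s := hFd.differentiableAt (hop.mem_nhds hs)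
  have hGne : G s ≠ 0 := by
    rw [hGF s hs1]
    exact mul_ne_zero (pow_ne_zero _ hs1') (hne s hs)
  have hre : ∀ j, 0 < ((D.lam j : ℂ) * s + D.mu j).re := fun j =>
    (D.re_pos j hs12).2.trans_le (D.re_pos j hs12).1
  have hΓd : ∀ j, DifferentiableAt ℂ (fun s : ℂ => Complex.Gamma ((D.lam j : ℂ) * s + D.mu j)) s :=
    fun j => DifferentiableAt.comp s (differentiableAt_Gamma_of_re_pos (hre j)) (by fun_prop)
  have hΓne : ∀ j, Complex.Gamma ((D.lam j : ℂ) * s + D.mu j) ≠ 0 := fun j =>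
    Complex.Gamma_ne_zero_of_re_pos (hre j)
  have hQd : HasDerivAt (fun s : ℂ => (D.Q : ℂ) ^ s) ((D.Q : ℂ) ^ s * log D.Q * 1) s :=
    (hasDerivAt_id s).const_cpow (Or.inl hQ)
  have hQne : (D.Q : ℂ) ^ s ≠ 0 := by
    rw [cpow_def_of_ne_zero hQ]
    exact exp_ne_zero _
  have hpd : DifferentiableAt ℂ (fun s : ℂ => (-1 : ℂ) ^ m * s ^ m) s := by fun_prop
  have hpne : (-1 : ℂ) ^ m * s ^ m ≠ 0 := mul_ne_zero (by simp) (pow_ne_zero _ hs0)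
  rw [(logDeriv_congr_nhds (xi_eventuallyEq (D := D) hG hGF hs12)).eq_of_nhds]
  have e1 : logDeriv (completedProduct D m G) s =
      logDeriv (fun s : ℂ => (-1 : ℂ) ^ m * s ^ m) s + logDeriv G s +
        logDeriv (fun s : ℂ => (D.Q : ℂ) ^ s) s +
        logDeriv (fun s : ℂ => ∏ j, Complex.Gamma ((D.lam j : ℂ) * s + D.mu j)) s := by
    unfold completedProduct
    rw [logDeriv_mul (f := fun s => (-1 : ℂ) ^ m * s ^ m * G s * (D.Q : ℂ) ^ s) s
      (mul_ne_zero (mul_ne_zero hpne hGne) hQne) (Finset.prod_ne_zero_iff.2 fun j _ => hΓne j)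
      ((hpd.mul (hG s)).mul hQd.differentiableAt) (DifferentiableAt.fun_finsetProd fun j _ => hΓd j),
      logDeriv_mul (f := fun s => (-1 : ℂ) ^ m * s ^ m * G s) s (mul_ne_zero hpne hGne) hQne
        (hpd.mul (hG s)) hQd.differentiableAt,
      logDeriv_mul (f := fun s => (-1 : ℂ) ^ m * s ^ m) s hpne hGne hpd (hG s)]
  have e2 : logDeriv (fun s : ℂ => (-1 : ℂ) ^ m * s ^ m) s = m / s := by
    rw [logDeriv_const_mul (f := fun s : ℂ => s ^ m) s _ (by simp), logDeriv_pow]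
  have e3 : logDeriv G s = m / (s - 1) + logDeriv F s := by
    have : G =ᶠ[𝓝 s] fun s => (s - 1) ^ m * F s := by
      filter_upwards [isOpen_ne.mem_nhds hs1] with z hz using hGF z hz
    rw [(logDeriv_congr_nhds this).eq_of_nhds, logDeriv_mul (f := fun s : ℂ => (s - 1) ^ m) s
      (pow_ne_zero _ hs1') (hne s hs) (by fun_prop) hFs,
      logDeriv_fun_pow (f := fun s : ℂ => s - 1) (by fun_prop)]
    congr 1
    rw [logDeriv_apply]
    simp [div_eq_mul_inv]
  have e4 : logDeriv (fun s : ℂ => (D.Q : ℂ) ^ s) s = Real.log D.Q := by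
    rw [logDeriv_apply, hQd.deriv, mul_one, mul_div_cancel_left₀ _ hQne,
      ofReal_log D.Q_pos.le]
  have e5 : logDeriv (fun s : ℂ => ∏ j, Complex.Gamma ((D.lam j : ℂ) * s + D.mu j)) s =
      ∑ j, (D.lam j : ℂ) * logDeriv Complex.Gamma ((D.lam j : ℂ) * s + D.mu j) := by
    rw [logDeriv_prod (s := Finset.univ)
      (f := fun j (s : ℂ) => Complex.Gamma ((D.lam j : ℂ) * s + D.mu j))
      (fun j _ => hΓne j) fun j _ => hΓd j]
    refine Finset.sum_congr rfl fun j _ => ?_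
    have := logDeriv_comp (f := Complex.Gamma) (g := fun s : ℂ => (D.lam j : ℂ) * s + D.mu j)
      (x := s) (differentiableAt_Gamma_of_re_pos (hre j)) (by fun_prop)
    rw [show (fun s : ℂ => Complex.Gamma ((D.lam j : ℂ) * s + D.mu j)) =
      Complex.Gamma ∘ fun s : ℂ => (D.lam j : ℂ) * s + D.mu j from rfl, this]
    have hd : deriv (fun s : ℂ => (D.lam j : ℂ) * s + D.mu j) s = D.lam j := by
      have : HasDerivAt (fun s : ℂ => (D.lam j : ℂ) * s + D.mu j) (D.lam j * 1) s :=
        ((hasDerivAt_id s).const_mul _).add_const _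
      rw [this.deriv, mul_one]
    rw [hd, mul_comm]
  rw [e1, e2, e3, e4, e5]
  ring

/-- The real part of `Γ'/Γ` on the vertical line through `2 λ_j + Re μ_j`. -/
noncomputable def gammaTerm (D : GammaData) (j : Fin D.r) (y : ℝ) : ℝ :=
  (logDeriv Complex.Gamma ((2 * D.lam j + (D.mu j).re : ℝ) + y * I)).re

lemma gammaTerm_pos (D : GammaData) (j : Fin D.r) : 0 < 2 * D.lam j + (D.mu j).re := by
  have h1 := D.lam_pos j
  have h2 := D.lam_mu j
  linarith

lemma re_logDeriv_xi (hF : IsSelbergSharpFlat F D) (t : ℝ) :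
    (logDeriv (xi F D) (2 + t * I)).re = (polarOrder F * (2 / (4 + t ^ 2) + 1 / (1 + t ^ 2)) +
      Real.log D.Q) + (logDeriv F (2 + t * I)).re +
        ∑ j, D.lam j * gammaTerm D j (D.lam j * t + (D.mu j).im) := by
  rw [hF.logDeriv_xi (by simp)]
  simp only [add_re, ofReal_re, re_sum, re_ofReal_mul, gammaTerm]
  have e1 : ((polarOrder F : ℂ) / (2 + t * I)).re = polarOrder F * (2 / (4 + t ^ 2)) := by
    simp [div_re, normSq_apply]
    ring
  have e2 : ((polarOrder F : ℂ) / (2 + t * I - 1)).re = polarOrder F * (1 / (1 + t ^ 2)) := by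
    simp [div_re, normSq_apply]
    ring_nf
  have e3 : ∀ j, (D.lam j : ℂ) * (2 + t * I) + D.mu j =
      ((2 * D.lam j + (D.mu j).re : ℝ) : ℂ) + ((D.lam j * t + (D.mu j).im : ℝ) : ℂ) * I := by
    intro j
    apply Complex.ext <;> simp
    ring
  rw [e1, e2]
  simp only [e3]
  ring

lemma exists_gammaTerm_bound (D : GammaData) (j : Fin D.r) :
    ∃ K : ℝ, 0 ≤ K ∧ ∀ y, |gammaTerm D j y| ≤ K * (1 + |y|) ^ (1 / 4 : ℝ) := by
  obtain ⟨K, hK0, hK⟩ := exists_norm_digamma_le (gammaTerm_pos D j)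
  exact ⟨K, hK0, fun y => (abs_re_le_norm _).trans (hK y)⟩

/-- A bound for the real part of `ξ_F'/ξ_F` on the line `Re s = 2`. -/
lemma exists_abs_re_logDeriv_xi_le (hF : IsSelbergSharpFlat F D) :
    ∃ K : ℝ, 0 ≤ K ∧ ∀ t : ℝ, |(logDeriv (xi F D) (2 + t * I)).re| ≤ K * (1 + |t|) ^ (1 / 4 : ℝ) := by
  obtain ⟨L, M, -, -, hM, -⟩ := hF.exists_log
  choose K hK0 hK using exists_gammaTerm_bound D
  refine ⟨(polarOrder F : ℝ) * 2 + |Real.log D.Q| + |M| +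
    ∑ j, D.lam j * (K j * (1 + D.lam j + |(D.mu j).im|) ^ (1 / 4 : ℝ)), ?_, fun t => ?_⟩
  · have : 0 ≤ ∑ j, D.lam j * (K j * (1 + D.lam j + |(D.mu j).im|) ^ (1 / 4 : ℝ)) :=
      Finset.sum_nonneg fun j _ => by
        have := D.lam_pos j
        have := hK0 j
        positivity
    positivity
  rw [hF.re_logDeriv_xi]
  have ht : (1 : ℝ) ≤ (1 + |t|) ^ (1 / 4 : ℝ) :=
    Real.one_le_rpow (by linarith [abs_nonneg t]) (by norm_num)
  have e1 : |(polarOrder F : ℝ) * (2 / (4 + t ^ 2) + 1 / (1 + t ^ 2))| ≤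
      (polarOrder F : ℝ) * 2 := by
    rw [abs_of_nonneg (by positivity)]
    refine mul_le_mul_of_nonneg_left ?_ (by positivity)
    have h1 : 2 / (4 + t ^ 2) ≤ 1 := (div_le_one (by positivity)).2 (by nlinarith)
    have h2 : 1 / (1 + t ^ 2) ≤ 1 := (div_le_one (by positivity)).2 (by nlinarith)
    linarith
  have e2 : |(logDeriv F (2 + t * I)).re| ≤ |M| :=
    (abs_re_le_norm _).trans (((hM _ (by simp)).2.2).trans (le_abs_self M))
  have e3 : |∑ j, D.lam j * gammaTerm D j (D.lam j * t + (D.mu j).im)| ≤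
      (∑ j, D.lam j * (K j * (1 + D.lam j + |(D.mu j).im|) ^ (1 / 4 : ℝ))) *
        (1 + |t|) ^ (1 / 4 : ℝ) := by
    rw [Finset.sum_mul]
    refine (Finset.abs_sum_le_sum_abs _ _).trans (Finset.sum_le_sum fun j _ => ?_)
    have hl := D.lam_pos j
    have hk := hK0 j
    rw [abs_mul, abs_of_pos hl, mul_assoc]
    refine mul_le_mul_of_nonneg_left ((hK j _).trans ?_) hl.le
    rw [mul_assoc, ← Real.mul_rpow (by positivity) (by positivity)]
    refine mul_le_mul_of_nonneg_left (Real.rpow_le_rpow (by positivity) ?_ (by norm_num)) hk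
    have h1 : |D.lam j * t + (D.mu j).im| ≤ D.lam j * |t| + |(D.mu j).im| := by
      refine (abs_add_le _ _).trans ?_
      rw [abs_mul, abs_of_pos hl]
    nlinarith [abs_nonneg t, abs_nonneg (D.mu j).im]
  have e4 := abs_add_le (((polarOrder F : ℝ) * (2 / (4 + t ^ 2) + 1 / (1 + t ^ 2)) +
    Real.log D.Q) + (logDeriv F (2 + t * I)).re)
    (∑ j, D.lam j * gammaTerm D j (D.lam j * t + (D.mu j).im))
  have e5 := abs_add_le ((polarOrder F : ℝ) * (2 / (4 + t ^ 2) + 1 / (1 + t ^ 2)) +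
    Real.log D.Q) (logDeriv F (2 + t * I)).re
  have e6 := abs_add_le ((polarOrder F : ℝ) * (2 / (4 + t ^ 2) + 1 / (1 + t ^ 2))) (Real.log D.Q)
  have e7 : ((polarOrder F : ℝ) * 2 + |Real.log D.Q| + |M|) ≤
      (polarOrder F * 2 + |Real.log D.Q| + |M|) * (1 + |t|) ^ (1 / 4 : ℝ) :=
    le_mul_of_one_le_right (by positivity) ht
  rw [add_mul]
  linarith

lemma continuous_vertical : Continuous fun t : ℝ => (2 : ℂ) + t * I := by fun_prop

lemma continuous_logDeriv_F_vertical (hF : IsSelbergSharpFlat F D) :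
    Continuous fun t : ℝ => logDeriv F (2 + t * I) := by
  obtain ⟨L, M, -, hne, -, hFd⟩ := hF.exists_log
  have hop : IsOpen {s : ℂ | 1 < s.re} := isOpen_lt continuous_const continuous_re
  have hl : ContinuousOn (logDeriv F) {z : ℂ | 1 < z.re} :=
    ((hFd.deriv hop).div hFd fun w hw => hne w hw).continuousOn
  exact hl.comp_continuous continuous_vertical fun y => by simp

/-- The integral of `Re F'/F` along the line `Re s = 2` is the variation of a bounded function. -/
lemma exists_integral_logDeriv_F_bound (hF : IsSelbergSharpFlat F D) :
    ∃ K : ℝ, 0 ≤ K ∧ ∀ T : ℝ,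
      |∫ t in (0 : ℝ)..T, ((logDeriv F (2 + t * I)).re - (logDeriv F (2 + (-t : ℝ) * I)).re)| ≤ K := by
  obtain ⟨L, M, hL, -, hM, -⟩ := hF.exists_log
  refine ⟨4 * |M|, by positivity, fun T => ?_⟩
  have hcont := continuous_re.comp hF.continuous_logDeriv_F_vertical
  have hder : ∀ t : ℝ, HasDerivAt (fun t : ℝ => (L (2 + t * I)).im)
      (logDeriv F (2 + t * I)).re t := by
    intro t
    have h1 : HasDerivAt (fun t : ℝ => (2 : ℂ) + t * I) I t := by
      simpa using ((ofRealCLM.hasDerivAt (x := t)).mul_const I).const_add 2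
    have h2 := (hL (2 + t * I) (by simp)).comp t h1
    have h3 : HasDerivAt (fun t : ℝ => (L (2 + t * I)).im)
        (imCLM (logDeriv F (2 + t * I) * I)) t := imCLM.hasFDerivAt.comp_hasDerivAt t h2
    simpa using h3
  have hder' : ∀ t : ℝ, HasDerivAt (fun t : ℝ => (L (2 + t * I)).im + (L (2 + (-t : ℝ) * I)).im)
      ((logDeriv F (2 + t * I)).re - (logDeriv F (2 + (-t : ℝ) * I)).re) t := by
    intro t
    have h1 := (hder (-t)).comp t (hasDerivAt_neg t)
    have h2 := (hder t).add h1
    convert! h2 using 1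
    ring
  rw [intervalIntegral.integral_eq_sub_of_hasDerivAt (fun t _ => hder' t)
    (Continuous.intervalIntegrable (hcont.sub (hcont.comp continuous_neg)) _ _)]
  have hb : ∀ t : ℝ, |(L (2 + t * I)).im| ≤ |M| := fun t =>
    (abs_im_le_norm _).trans (((hM _ (by simp)).2.1).trans (le_abs_self M))
  have h1 := hb T
  have h2 := hb (-T)
  have h3 := hb 0
  have h4 := hb (-0)
  rw [abs_le] at *
  constructor <;> linarith

/-- The real part of `ξ_F'/ξ_F` is nearly even in `Im s` on the line `Re s = 2`. -/
lemma exists_integral_logDeriv_xi_bound (hF : IsSelbergSharpFlat F D) :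
    ∃ K : ℝ, 0 ≤ K ∧ ∀ T : ℝ, 0 ≤ T →
      |∫ t in (0 : ℝ)..T, ((logDeriv (xi F D) (2 + t * I)).re -
        (logDeriv (xi F D) (2 + (-t : ℝ) * I)).re)| ≤ K * (1 + T) ^ (1 / 4 : ℝ) := by
  obtain ⟨K₀, hK₀, hF0⟩ := hF.exists_integral_logDeriv_F_bound
  have hc : ∀ j, Continuous (gammaTerm D j) := fun j =>
    continuous_re.comp (continuous_digamma_vertical (gammaTerm_pos D j))
  have hΓ : ∀ j, ∃ B : ℝ, 0 ≤ B ∧ ∀ T : ℝ, 0 ≤ T → |∫ t in (0 : ℝ)..T,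
      (gammaTerm D j (D.lam j * t + (D.mu j).im) - gammaTerm D j (D.lam j * (-t) + (D.mu j).im))| ≤
        B * (1 + T) ^ (1 / 4 : ℝ) := by
    intro j
    obtain ⟨K, hK0, hK⟩ := exists_gammaTerm_bound D j
    exact abs_integral_even_shift_le (hc j) (fun y => re_digamma_neg _ y) hK0 hK (D.lam_pos j) _
  choose B hB0 hB using hΓ
  refine ⟨K₀ + ∑ j, D.lam j * B j, add_nonneg hK₀ (Finset.sum_nonneg fun j _ =>
    mul_nonneg (D.lam_pos j).le (hB0 j)), fun T hT => ?_⟩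
  have hT1 : (1 : ℝ) ≤ (1 + T) ^ (1 / 4 : ℝ) := Real.one_le_rpow (by linarith) (by norm_num)
  have e1 : ∀ t : ℝ, (logDeriv (xi F D) (2 + t * I)).re - (logDeriv (xi F D) (2 + (-t : ℝ) * I)).re =
      ((logDeriv F (2 + t * I)).re - (logDeriv F (2 + (-t : ℝ) * I)).re) +
      ∑ j, D.lam j * (gammaTerm D j (D.lam j * t + (D.mu j).im) -
        gammaTerm D j (D.lam j * (-t) + (D.mu j).im)) := by
    intro t
    rw [hF.re_logDeriv_xi, hF.re_logDeriv_xi, neg_sq]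
    simp only [mul_sub, Finset.sum_sub_distrib]
    ring
  simp only [e1]
  have hcF : Continuous fun t : ℝ => (logDeriv F (2 + t * I)).re :=
    continuous_re.comp hF.continuous_logDeriv_F_vertical
  have hcF' : Continuous fun t : ℝ =>
      (logDeriv F (2 + t * I)).re - (logDeriv F (2 + (-t : ℝ) * I)).re :=
    hcF.sub (hcF.comp continuous_neg)
  have hcj : ∀ j, Continuous fun t => D.lam j * (gammaTerm D j (D.lam j * t + (D.mu j).im) -
        gammaTerm D j (D.lam j * (-t) + (D.mu j).im)) := fun j => by
    have := hc j
    fun_prop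
  rw [intervalIntegral.integral_add
    (hcF'.intervalIntegrable _ _)
    (Continuous.intervalIntegrable (continuous_finsetSum _ fun j _ => hcj j) _ _),
    intervalIntegral.integral_finsetSum fun j _ => (hcj j).intervalIntegrable _ _]
  refine (abs_add_le _ _).trans ?_
  rw [add_mul]
  refine add_le_add ((hF0 T).trans (le_mul_of_one_le_right hK₀ hT1)) ?_
  refine (Finset.abs_sum_le_sum_abs _ _).trans ?_
  rw [Finset.sum_mul]
  refine Finset.sum_le_sum fun j _ => ?_
  rw [intervalIntegral.integral_const_mul, abs_mul, abs_of_pos (D.lam_pos j), mul_assoc]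
  exact mul_le_mul_of_nonneg_left (hB j T hT) (D.lam_pos j).le

end IsSelbergSharpFlat

/-! ### The contribution of one zero to the integrated logarithmic derivative -/

lemma abs_arctan_div_sub_le {a x : ℝ} (ha1 : 1 ≤ a) (ha2 : a ≤ 2) (hx : 0 ≤ x) :
    |Real.arctan (x / a) - Real.pi / 2| ≤ 4 / (1 + |x|) := by
  have ha0 : 0 < a := by linarith
  rw [abs_of_nonneg hx, abs_of_nonpos (by linarith [Real.arctan_lt_pi_div_two (x / a)])]
  rcases hx.eq_or_lt with rfl | hx0
  · simp
    linarith [Real.pi_le_four]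
  · have h1 := Real.arctan_inv_of_pos (x := a / x) (by positivity)
    rw [inv_div] at h1
    rw [h1, neg_sub, sub_sub_cancel, le_div_iff₀ (by positivity)]
    have h2 : Real.arctan (a / x) ≤ a / x := by
      have := Real.le_tan (Real.arctan_nonneg.2 (by positivity : 0 ≤ a / x))
        (Real.arctan_lt_pi_div_two _)
      rwa [Real.tan_arctan] at this
    have h3 : Real.arctan (a / x) ≤ 2 := by
      linarith [Real.arctan_lt_pi_div_two (a / x), Real.pi_le_four]
    have h4 : Real.arctan (a / x) * x ≤ 2 := by
      calc Real.arctan (a / x) * x ≤ a / x * x := by gcongr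
        _ = a := by field_simp
        _ ≤ 2 := ha2
    nlinarith

lemma abs_arctan_div_add_le {a x : ℝ} (ha1 : 1 ≤ a) (ha2 : a ≤ 2) (hx : x ≤ 0) :
    |Real.arctan (x / a) + Real.pi / 2| ≤ 4 / (1 + |x|) := by
  have h := abs_arctan_div_sub_le ha1 ha2 (neg_nonneg.2 hx)
  rw [neg_div, Real.arctan_neg, abs_neg, ← abs_neg] at h
  convert h using 2
  ring

/-- The kernel `Re 1 / (2 + i t - ρ)` as a function of `t`, where `a = 2 - Re ρ` and
`γ = Im ρ`. -/
noncomputable def zeroKernel (a γ t : ℝ) : ℝ := a / (a ^ 2 + (t - γ) ^ 2)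

/-- The integral of the odd part of the kernel. -/
noncomputable def oddIntegral (a γ T : ℝ) : ℝ :=
  ∫ t in (0 : ℝ)..T, (zeroKernel a γ t - zeroKernel a γ (-t))

lemma re_one_div_sub (ρ : ℂ) (t : ℝ) :
    (1 / (2 + t * I - ρ)).re = zeroKernel (2 - ρ.re) ρ.im t := by
  simp [zeroKernel, normSq_apply]
  ring

section Kernel

variable {a γ : ℝ}

lemma zeroKernel_nonneg (ha1 : 1 ≤ a) (t : ℝ) : 0 ≤ zeroKernel a γ t := by
  unfold zeroKernel
  positivity

lemma zeroKernel_le (ha1 : 1 ≤ a) (ha2 : a ≤ 2) (t : ℝ) :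
    zeroKernel a γ t ≤ 2 / (1 + (t - γ) ^ 2) := by
  unfold zeroKernel
  rw [div_le_div_iff₀ (by positivity) (by positivity)]
  nlinarith [sq_nonneg (t - γ), mul_nonneg (sub_nonneg.2 ha2) (sq_nonneg (t - γ))]

lemma le_zeroKernel (ha1 : 1 ≤ a) (ha2 : a ≤ 2) (t : ℝ) :
    1 / (1 + (t - γ) ^ 2) ≤ 4 * zeroKernel a γ t := by
  unfold zeroKernel
  rw [mul_div_assoc', div_le_div_iff₀ (by positivity) (by positivity)]
  nlinarith [sq_nonneg (t - γ), mul_nonneg (sub_nonneg.2 ha1) (sq_nonneg (t - γ))]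

lemma continuous_zeroKernel (ha1 : 1 ≤ a) : Continuous (zeroKernel a γ) := by
  unfold zeroKernel
  refine Continuous.div (by fun_prop) (by fun_prop) fun t => ?_
  positivity

lemma zeroKernel_le_rpow (ha1 : 1 ≤ a) (ha2 : a ≤ 2) {t T : ℝ} (ht : |t| ≤ T) :
    zeroKernel a γ t ≤ 8 * (1 + T ^ 2) * (1 + |γ|) ^ (-(5 / 4) : ℝ) := by
  have h1 : (1 + |γ|) ^ (-2 : ℝ) ≤ (1 + |γ|) ^ (-(5 / 4) : ℝ) :=
    Real.rpow_le_rpow_of_exponent_le (by linarith [abs_nonneg γ]) (by norm_num)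
  rw [Real.rpow_neg (by positivity), Real.rpow_two] at h1
  have ht2 : t ^ 2 ≤ T ^ 2 := sq_le_sq' (by linarith [neg_abs_le t]) (by linarith [le_abs_self t])
  refine (zeroKernel_le ha1 ha2 t).trans (le_trans ?_
    (mul_le_mul_of_nonneg_left h1 (by positivity)))
  rw [← div_eq_mul_inv, div_le_div_iff₀ (by positivity) (by positivity)]
  have h2 : (1 + |γ|) ^ 2 ≤ 2 * (1 + γ ^ 2) := by
    rw [← sq_abs γ]
    nlinarith [sq_nonneg (1 - |γ|)]
  have h3 : 1 + γ ^ 2 ≤ 2 * ((1 + t ^ 2) * (1 + (t - γ) ^ 2)) := by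
    nlinarith [sq_nonneg (2 * t - γ), sq_nonneg (t * (t - γ)), sq_nonneg (t - γ), sq_nonneg t]
  have h4 : (1 + t ^ 2) * (1 + (t - γ) ^ 2) ≤ (1 + T ^ 2) * (1 + (t - γ) ^ 2) := by gcongr
  nlinarith

lemma oddIntegral_eq (ha1 : 1 ≤ a) (T : ℝ) :
    oddIntegral a γ T = Real.arctan ((T - γ) / a) - Real.arctan ((T + γ) / a) +
      2 * Real.arctan (γ / a) := by
  have ha0 : a ≠ 0 := by positivity
  have hd : ∀ c t : ℝ, HasDerivAt (fun t => Real.arctan ((t - c) / a)) (zeroKernel a c t) t := by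
    intro c t
    have h1 : HasDerivAt (fun t => (t - c) / a) (1 / a) t :=
      ((hasDerivAt_id t).sub_const c).div_const a
    convert! h1.arctan using 1
    unfold zeroKernel
    field_simp
  have he : ∀ t, zeroKernel a γ (-t) = zeroKernel a (-γ) t := by
    intro t
    unfold zeroKernel
    congr 2
    ring
  unfold oddIntegral
  simp only [he]
  rw [intervalIntegral.integral_eq_sub_of_hasDerivAt
    (fun t _ => (hd γ t).sub (hd (-γ) t))
    (((continuous_zeroKernel ha1).sub (continuous_zeroKernel ha1)).intervalIntegrable _ _)]
  simp only [Pi.sub_apply, sub_neg_eq_add, zero_sub, zero_add, neg_div, Real.arctan_neg]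
  ring

/-- The sign of `γ`, cut off at `|γ| ≤ T`. -/
noncomputable def truncSign (γ T : ℝ) : ℝ := open Classical in if |γ| ≤ T then Real.sign γ else 0

lemma abs_oddIntegral_sub_le (ha1 : 1 ≤ a) (ha2 : a ≤ 2) {T : ℝ} (hT : 0 ≤ T) :
    |oddIntegral a γ T - Real.pi * truncSign γ T| ≤
      4 / (1 + |T - γ|) + 4 / (1 + |T + γ|) + 8 / (1 + |γ|) := by
  rw [oddIntegral_eq ha1]
  have e8 : 8 / (1 + |γ|) = 2 * (4 / (1 + |γ|)) := by ring
  rw [e8]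
  rcases lt_trichotomy γ 0 with hγ | rfl | hγ
  · have h2 := abs_arctan_div_add_le ha1 ha2 hγ.le
    have h1 := abs_arctan_div_sub_le ha1 ha2 (show 0 ≤ T - γ by linarith)
    rw [abs_le] at h1 h2
    unfold truncSign
    rw [abs_of_neg hγ, Real.sign_of_neg hγ]
    rw [abs_of_neg hγ] at h2
    rcases le_or_gt (-γ) T with h | h
    · have h3 := abs_arctan_div_sub_le ha1 ha2 (show 0 ≤ T + γ by linarith)
      rw [abs_le] at h3
      rw [if_pos h, abs_le]
      constructor <;> linarith [h1.1, h1.2, h2.1, h2.2, h3.1, h3.2]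
    · have h3 := abs_arctan_div_add_le ha1 ha2 (show T + γ ≤ 0 by linarith)
      rw [abs_le] at h3
      rw [if_neg (not_le.2 h), abs_le]
      constructor <;> linarith [h1.1, h1.2, h2.1, h2.2, h3.1, h3.2]
  · have : truncSign 0 T = 0 := by simp [truncSign]
    rw [this]
    simp
    positivity
  · have h2 := abs_arctan_div_sub_le ha1 ha2 hγ.le
    have h1 := abs_arctan_div_sub_le ha1 ha2 (show 0 ≤ T + γ by linarith)
    rw [abs_le] at h1 h2
    unfold truncSign
    rw [abs_of_pos hγ, Real.sign_of_pos hγ]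
    rw [abs_of_pos hγ] at h2
    rcases le_or_gt γ T with h | h
    · have h3 := abs_arctan_div_sub_le ha1 ha2 (show 0 ≤ T - γ by linarith)
      rw [abs_le] at h3
      rw [if_pos h, abs_le]
      constructor <;> linarith [h1.1, h1.2, h2.1, h2.2, h3.1, h3.2]
    · have h3 := abs_arctan_div_add_le ha1 ha2 (show T - γ ≤ 0 by linarith)
      rw [abs_le] at h3
      rw [if_neg (not_le.2 h), abs_le]
      constructor <;> linarith [h1.1, h1.2, h2.1, h2.2, h3.1, h3.2]

lemma abs_oddIntegral_le (ha1 : 1 ≤ a) (ha2 : a ≤ 2) {T : ℝ} (hT : 0 ≤ T) (hγ : 2 * T < |γ|) :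
    |oddIntegral a γ T| ≤ 8 / γ ^ 2 * T := by
  have hγ0 : 0 < |γ| := by linarith
  have hγ2 : 0 < γ ^ 2 := by
    rw [← sq_abs]
    positivity
  have hk : ∀ t, |t| ≤ T → zeroKernel a γ t ≤ 8 / γ ^ 2 := by
    intro t ht
    refine (zeroKernel_le ha1 ha2 t).trans ?_
    rw [div_le_div_iff₀ (by positivity) hγ2]
    have h1 : |γ| / 2 ≤ |t - γ| := by
      have := abs_sub_abs_le_abs_sub γ t
      rw [abs_sub_comm] at this
      linarith
    have h2 : (|γ| / 2) ^ 2 ≤ |t - γ| ^ 2 := by gcongr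
    rw [div_pow, sq_abs, sq_abs] at h2
    linarith
  have := intervalIntegral.norm_integral_le_of_norm_le_const (a := 0) (b := T) (C := 8 / γ ^ 2)
    (f := fun t => zeroKernel a γ t - zeroKernel a γ (-t)) (by
      intro t ht
      rw [Set.uIoc_of_le hT] at ht
      have ht' : |t| ≤ T := abs_le.2 ⟨by linarith [ht.1], ht.2⟩
      have h1 := hk t ht'
      have h2 := hk (-t) (by rwa [abs_neg])
      have h3 := zeroKernel_nonneg (γ := γ) ha1 t
      have h4 := zeroKernel_nonneg (γ := γ) ha1 (-t)
      rw [Real.norm_eq_abs, abs_le]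
      constructor <;> linarith)
  rwa [sub_zero, abs_of_nonneg hT] at this

/-- Both terms on the right can be summed over the zeros, the kernel because its sum is known from
the partial fraction expansion; the sum of the left side itself over the zeros need not converge. -/
lemma one_div_one_add_abs_le (ha1 : 1 ≤ a) (ha2 : a ≤ 2) {t T : ℝ} (hT : 0 < T) :
    1 / (1 + |t - γ|) ≤ T ^ (-(1 / 2) : ℝ) + 4 * T ^ (1 / 2 : ℝ) * zeroKernel a γ t := by
  set r := T ^ (1 / 2 : ℝ)
  have hr : 0 < r := by positivity
  have hr' : T ^ (-(1 / 2) : ℝ) = r⁻¹ := Real.rpow_neg hT.le _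
  set u := 1 + |t - γ|
  have hu : 1 ≤ u := by simp [u]
  have h1 : 1 / u ≤ r⁻¹ + r * (1 / u ^ 2) := by
    have : 0 ≤ (u - r) ^ 2 + u * r := by positivity
    have h2 : r⁻¹ + r * (1 / u ^ 2) - 1 / u = ((u - r) ^ 2 + u * r) / (r * u ^ 2) := by
      field_simp
      ring
    have h3 : 0 ≤ ((u - r) ^ 2 + u * r) / (r * u ^ 2) := by positivity
    linarith
  have h4 : 1 / u ^ 2 ≤ 1 / (1 + (t - γ) ^ 2) := by
    refine one_div_le_one_div_of_le (by positivity) ?_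
    simp only [u]
    nlinarith [abs_nonneg (t - γ), sq_abs (t - γ)]
  have h5 := le_zeroKernel (γ := γ) ha1 ha2 t
  rw [hr']
  calc 1 / u ≤ r⁻¹ + r * (1 / u ^ 2) := h1
    _ ≤ r⁻¹ + r * (4 * zeroKernel a γ t) := by
      gcongr
      exact h4.trans h5
    _ = _ := by ring

/-- The integrated kernel counts the zeros with `0 < γ ≤ T` with weight `π` and those with
`-T ≤ γ < 0` with weight `-π`. The error is bounded by quantities whose sum over the zeros is
known. -/
lemma abs_oddIntegral_sub_le_rpow (ha1 : 1 ≤ a) (ha2 : a ≤ 2) {T : ℝ} (hT : 1 ≤ T) :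
    |oddIntegral a γ T - Real.pi * truncSign γ T| ≤
      80 * T ^ (3 / 4 : ℝ) * (1 + |γ|) ^ (-(5 / 4) : ℝ) +
        16 * T ^ (1 / 2 : ℝ) * (zeroKernel a γ T + zeroKernel a γ (-T)) := by
  have hT0 : 0 < T := by linarith
  have hγ1 : 1 ≤ 1 + |γ| := by linarith [abs_nonneg γ]
  have hw : 0 < (1 + |γ|) ^ (-(5 / 4) : ℝ) := by positivity
  rcases le_or_gt |γ| (2 * T) with hγ | hγ
  · refine (abs_oddIntegral_sub_le ha1 ha2 hT0.le).trans ?_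
    have h1 := one_div_one_add_abs_le (γ := γ) ha1 ha2 (t := T) hT0
    have h2 := one_div_one_add_abs_le (γ := γ) ha1 ha2 (t := -T) hT0
    rw [show |-T - γ| = |T + γ| by rw [← abs_neg]; congr 1; ring] at h2
    have hγT : 1 + |γ| ≤ 3 * T := by linarith
    have e1 : (3 * T) ^ (5 / 4 : ℝ) ≤ 4 * T ^ (5 / 4 : ℝ) := by
      rw [Real.mul_rpow (by norm_num) hT0.le]
      refine mul_le_mul_of_nonneg_right ?_ (by positivity)
      rw [show (5 / 4 : ℝ) = (5 : ℕ) * (1 / 4 : ℝ) by norm_num, Real.rpow_mul (by norm_num),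
        Real.rpow_natCast]
      calc ((3 : ℝ) ^ 5) ^ (1 / 4 : ℝ) ≤ ((4 : ℝ) ^ 4) ^ (1 / 4 : ℝ) := by
            refine Real.rpow_le_rpow (by norm_num) (by norm_num) (by norm_num)
        _ = 4 := by
            rw [← Real.rpow_natCast 4 4, ← Real.rpow_mul (by norm_num)]
            norm_num
    have e2 : T ^ (-(1 / 2) : ℝ) ≤ 4 * T ^ (3 / 4 : ℝ) * (1 + |γ|) ^ (-(5 / 4) : ℝ) := by
      have h3 : (1 + |γ|) ^ (5 / 4 : ℝ) ≤ 4 * T ^ (5 / 4 : ℝ) :=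
        (Real.rpow_le_rpow (by positivity) hγT (by norm_num)).trans e1
      have h4 : T ^ (3 / 4 : ℝ) = T ^ (-(1 / 2) : ℝ) * T ^ (5 / 4 : ℝ) := by
        rw [← Real.rpow_add hT0]
        norm_num
      rw [Real.rpow_neg (by positivity : 0 ≤ 1 + |γ|), ← div_eq_mul_inv, le_div_iff₀ (by positivity),
        h4]
      have : 0 < T ^ (-(1 / 2) : ℝ) := by positivity
      nlinarith
    have e3 : 1 / (1 + |γ|) ≤ 4 * T ^ (3 / 4 : ℝ) * (1 + |γ|) ^ (-(5 / 4) : ℝ) := by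
      have h3 : (1 + |γ|) ^ (1 / 4 : ℝ) ≤ 4 * T ^ (3 / 4 : ℝ) := by
        calc (1 + |γ|) ^ (1 / 4 : ℝ) ≤ (3 * T) ^ (1 / 4 : ℝ) :=
              Real.rpow_le_rpow (by positivity) hγT (by norm_num)
          _ = 3 ^ (1 / 4 : ℝ) * T ^ (1 / 4 : ℝ) := Real.mul_rpow (by norm_num) hT0.le
          _ ≤ 3 ^ (1 : ℝ) * T ^ (3 / 4 : ℝ) := by
              gcongr <;> norm_num
          _ ≤ _ := by
              rw [Real.rpow_one]
              gcongr
              norm_num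
      have h4 : 1 / (1 + |γ|) = (1 + |γ|) ^ (1 / 4 : ℝ) * (1 + |γ|) ^ (-(5 / 4) : ℝ) := by
        rw [← Real.rpow_add (by positivity), one_div, ← Real.rpow_neg_one]
        norm_num
      rw [h4]
      gcongr
    have e4 : ∀ x : ℝ, 4 / x = 4 * (1 / x) := fun x => by ring
    have e5 : ∀ x : ℝ, 8 / x = 8 * (1 / x) := fun x => by ring
    rw [e4, e4, e5]
    have e6 : 0 < T ^ (3 / 4 : ℝ) * (1 + |γ|) ^ (-(5 / 4) : ℝ) := by positivity
    linarith
  · have h0 : truncSign γ T = 0 := by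
      unfold truncSign
      rw [if_neg]
      linarith
    rw [h0, mul_zero, sub_zero]
    refine (abs_oddIntegral_le ha1 ha2 hT0.le hγ).trans ?_
    have hk : 0 ≤ 16 * T ^ (1 / 2 : ℝ) * (zeroKernel a γ T + zeroKernel a γ (-T)) := by
      have h1 := zeroKernel_nonneg (γ := γ) ha1 T
      have h2 := zeroKernel_nonneg (γ := γ) ha1 (-T)
      positivity
    refine le_trans ?_ (le_add_of_nonneg_right hk)
    have hγ2 : 0 < γ ^ 2 := by
      rw [← sq_abs]
      have : 0 < |γ| := by linarith
      positivity
    have h1 : 8 / γ ^ 2 ≤ 80 * (1 + |γ|) ^ (-2 : ℝ) := by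
      rw [Real.rpow_neg (by positivity), Real.rpow_two, ← div_eq_mul_inv,
        div_le_div_iff₀ hγ2 (by positivity), ← sq_abs γ]
      nlinarith
    have h2 : (1 + |γ|) ^ (-2 : ℝ) ≤ (1 + |γ|) ^ (-(5 / 4) : ℝ) * T ^ (-(3 / 4) : ℝ) := by
      have : (1 + |γ|) ^ (-2 : ℝ) = (1 + |γ|) ^ (-(5 / 4) : ℝ) * (1 + |γ|) ^ (-(3 / 4) : ℝ) := by
        rw [← Real.rpow_add (by positivity)]
        norm_num
      rw [this]
      refine mul_le_mul_of_nonneg_left ?_ hw.le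
      exact Real.rpow_le_rpow_of_nonpos hT0 (by linarith) (by norm_num)
    have h3 : T ^ (-(3 / 4) : ℝ) * T ≤ T ^ (3 / 4 : ℝ) := by
      conv_lhs => rw [← Real.rpow_one T]
      rw [← Real.rpow_mul hT0.le, ← Real.rpow_add hT0]
      exact Real.rpow_le_rpow_of_exponent_le hT (by norm_num)
    calc 8 / γ ^ 2 * T ≤ 80 * ((1 + |γ|) ^ (-(5 / 4) : ℝ) * T ^ (-(3 / 4) : ℝ)) * T := by
          refine mul_le_mul_of_nonneg_right (h1.trans ?_) hT0.le
          linarith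
      _ = 80 * (1 + |γ|) ^ (-(5 / 4) : ℝ) * (T ^ (-(3 / 4) : ℝ) * T) := by ring
      _ ≤ 80 * (1 + |γ|) ^ (-(5 / 4) : ℝ) * T ^ (3 / 4 : ℝ) := by gcongr
      _ = _ := by ring

end Kernel

/-! ### Balance of the zeros above and below the real axis -/

namespace IsSelbergSharpFlat

variable {F : ℂ → ℂ} {D : GammaData}

lemma zeroMult_eq_zero {ρ : ℂ} (h : xi F D ρ ≠ 0) : zeroMult F D ρ = 0 :=
  analyticOrderNatAt_eq_zero_of_ne_zero h

lemma norm_le_one_add_abs_im (hF : IsSelbergSharpFlat F D) {ρ : ℂ} (h : xi F D ρ = 0) :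
    ‖ρ‖ ≤ 1 + |ρ.im| := by
  obtain ⟨h1, h2⟩ := hF.re_mem_of_xi_eq_zero h
  refine (norm_le_abs_re_add_abs_im ρ).trans ?_
  rw [abs_of_nonneg h1]
  linarith

lemma rpow_one_add_abs_im_le (hF : IsSelbergSharpFlat F D) {ρ : ℂ} (h : xi F D ρ = 0) :
    (1 + |ρ.im|) ^ (-(5 / 4) : ℝ) ≤ 2 ^ (5 / 4 : ℝ) * (1 + ‖ρ‖) ^ (-(5 / 4) : ℝ) := by
  have h1 := hF.norm_le_one_add_abs_im h
  have h2 : (1 + ‖ρ‖) / 2 ≤ 1 + |ρ.im| := by linarith [abs_nonneg ρ.im]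
  refine (Real.rpow_le_rpow_of_nonpos (by positivity) h2 (by norm_num)).trans (le_of_eq ?_)
  rw [Real.div_rpow (by positivity) (by norm_num), Real.rpow_neg (by norm_num : (0 : ℝ) ≤ 2),
    div_inv_eq_mul, mul_comm]

/-- The zeros lie in the strip `0 ≤ Re ρ ≤ 1`, so their size can be measured by `|Im ρ|`. -/
lemma summable_zeroMult_mul (hF : IsSelbergSharpFlat F D) (h0 : xi F D 0 ≠ 0) {E : Type*}
    [NormedRing E] [CompleteSpace E] {φ : ℂ → E} {X K : ℝ}
    (hφ : ∀ ρ, xi F D ρ = 0 → X ≤ ‖ρ‖ → ‖φ ρ‖ ≤ K * (1 + |ρ.im|) ^ (-(5 / 4) : ℝ)) :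
    Summable fun ρ : ℂ => (zeroMult F D ρ : E) * φ ρ := by
  obtain ⟨C, -, hC⟩ := hF.hasGrowthOn_xi
  refine summable_zeros_mul hF.differentiable_xi h0 (fun s => hC s trivial) (X := X)
    (K := |K| * 2 ^ (5 / 4 : ℝ)) fun ρ hρ hX => (hφ ρ hρ hX).trans ?_
  calc K * (1 + |ρ.im|) ^ (-(5 / 4) : ℝ) ≤ |K| * (1 + |ρ.im|) ^ (-(5 / 4) : ℝ) := by
        gcongr
        exact le_abs_self K
    _ ≤ |K| * (2 ^ (5 / 4 : ℝ) * (1 + ‖ρ‖) ^ (-(5 / 4) : ℝ)) := by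
        gcongr
        exact hF.rpow_one_add_abs_im_le hρ
    _ = _ := by ring

lemma two_sub_re_mem (hF : IsSelbergSharpFlat F D) {ρ : ℂ} (h : xi F D ρ = 0) :
    1 ≤ 2 - ρ.re ∧ 2 - ρ.re ≤ 2 := by
  obtain ⟨h1, h2⟩ := hF.re_mem_of_xi_eq_zero h
  constructor <;> linarith

/-- If `φ` is of size `|ρ| ^ (-2)`, its sum over the zeros converges absolutely. -/
lemma summable_zeroMult_mul_of_sq (hF : IsSelbergSharpFlat F D) (h0 : xi F D 0 ≠ 0) {E : Type*}
    [NormedRing E] [CompleteSpace E] {φ : ℂ → E} {X K : ℝ}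
    (hφ : ∀ ρ, xi F D ρ = 0 → X ≤ ‖ρ‖ → ‖φ ρ‖ ≤ K / ‖ρ‖ ^ 2) :
    Summable fun ρ : ℂ => (zeroMult F D ρ : E) * φ ρ := by
  refine hF.summable_zeroMult_mul h0 (X := max X 2) (K := 16 * |K|) fun ρ hρ hX => ?_
  have h1 := hF.norm_le_one_add_abs_im hρ
  have h2 : 2 ≤ ‖ρ‖ := (le_max_right _ _).trans hX
  have h3 : (1 + |ρ.im|) ^ (-2 : ℝ) ≤ (1 + |ρ.im|) ^ (-(5 / 4) : ℝ) :=
    Real.rpow_le_rpow_of_exponent_le (by linarith [abs_nonneg ρ.im]) (by norm_num)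
  rw [Real.rpow_neg (by positivity), Real.rpow_two] at h3
  refine (hφ ρ hρ ((le_max_left _ _).trans hX)).trans
    (le_trans ?_ (mul_le_mul_of_nonneg_left h3 (by positivity)))
  have h4 : |ρ.im| ≤ ‖ρ‖ := abs_im_le_norm ρ
  rw [← div_eq_mul_inv, div_le_div_iff₀ (by positivity) (by positivity)]
  have h5 : (1 + |ρ.im|) ^ 2 ≤ 16 * ‖ρ‖ ^ 2 := by nlinarith [abs_nonneg ρ.im]
  calc K * (1 + |ρ.im|) ^ 2 ≤ |K| * (16 * ‖ρ‖ ^ 2) := by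
        refine mul_le_mul (le_abs_self K) h5 (by positivity) (abs_nonneg K)
    _ = _ := by ring

lemma summable_weight (hF : IsSelbergSharpFlat F D) (h0 : xi F D 0 ≠ 0) :
    Summable fun ρ : ℂ => (zeroMult F D ρ : ℝ) * (1 + |ρ.im|) ^ (-(5 / 4) : ℝ) :=
  hF.summable_zeroMult_mul h0 (X := 0) (K := 1) fun ρ _ _ => by
    rw [one_mul, Real.norm_of_nonneg (by positivity)]

lemma norm_re_one_div_le {ρ : ℂ} (h1 : 0 ≤ ρ.re) (h2 : ρ.re ≤ 1) :
    ‖(1 / ρ).re‖ ≤ 1 / ‖ρ‖ ^ 2 := by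
  rw [one_div, inv_re, normSq_eq_norm_sq, Real.norm_eq_abs, abs_of_nonneg (by positivity)]
  gcongr

/-- The real part of the partial fraction expansion of `ξ_F'/ξ_F` on the line `Re s = 2`. -/
lemma exists_hasSum_zeroKernel (hF : IsSelbergSharpFlat F D) (h0 : xi F D 0 ≠ 0) :
    ∃ c : ℝ, ∀ t : ℝ, HasSum (fun ρ : ℂ => (zeroMult F D ρ : ℝ) * zeroKernel (2 - ρ.re) ρ.im t)
      ((logDeriv (xi F D) (2 + t * I)).re + c) := by
  obtain ⟨C, -, hC⟩ := hF.hasGrowthOn_xi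
  have hs : Summable fun ρ : ℂ => (zeroMult F D ρ : ℝ) * (1 / ρ).re :=
    hF.summable_zeroMult_mul_of_sq h0 (X := 0) (K := 1) fun ρ hρ _ => by
      obtain ⟨h1, h2⟩ := hF.re_mem_of_xi_eq_zero hρ
      exact norm_re_one_div_le h1 h2
  refine ⟨-(logDeriv (xi F D) 0).re - ∑' ρ : ℂ, (zeroMult F D ρ : ℝ) * (1 / ρ).re, fun t => ?_⟩
  have h1 := hasSum_logDeriv_sub hF.differentiable_xi h0 (fun s => hC s trivial)
    (s := 2 + t * I) (hF.xi_ne_zero (by simp))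
  have h2 := (hasSum_re h1).sub hs.hasSum
  convert! h2 using 1
  · funext ρ
    rw [← re_one_div_sub, ← zeroMult, show ((zeroMult F D ρ : ℂ)) = ((zeroMult F D ρ : ℝ) : ℂ) by
      push_cast; rfl, re_ofReal_mul, add_re]
    ring
  · rw [sub_re]
    ring

lemma countable_zeros (hF : IsSelbergSharpFlat F D) (h0 : xi F D 0 ≠ 0) :
    (nontrivialZeros F D).Countable := by
  have : nontrivialZeros F D ⊆ ⋃ n : ℕ, (zerosInBall (xi F D) n : Set ℂ) := by
    intro ρ hρ
    obtain ⟨n, hn⟩ := exists_nat_ge ‖ρ‖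
    exact Set.mem_iUnion.2 ⟨n, (mem_zerosInBall hF.differentiable_xi h0).2 ⟨hρ, hn⟩⟩
  exact (Set.countable_iUnion fun n : ℕ => (zerosInBall (xi F D) n).countable_toSet).mono this

lemma support_subset_nontrivialZeros {E : Type*} [NormedRing E] (φ : ℂ → E) :
    Function.support (fun ρ : ℂ => (zeroMult F D ρ : E) * φ ρ) ⊆ nontrivialZeros F D := by
  intro ρ hρ
  by_contra h
  exact hρ (by simp [zeroMult_eq_zero (F := F) (D := D) h])

/-- Termwise integration of the odd part of the partial fraction expansion. -/
lemma hasSum_oddIntegral (hF : IsSelbergSharpFlat F D) (h0 : xi F D 0 ≠ 0) {T : ℝ} (hT : 0 ≤ T) :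
    HasSum (fun ρ : ℂ => (zeroMult F D ρ : ℝ) * oddIntegral (2 - ρ.re) ρ.im T)
      (∫ t in (0 : ℝ)..T, ((logDeriv (xi F D) (2 + t * I)).re -
        (logDeriv (xi F D) (2 + (-t : ℝ) * I)).re)) := by
  obtain ⟨c, hc⟩ := hF.exists_hasSum_zeroKernel h0
  have hcount : Countable (nontrivialZeros F D) := (hF.countable_zeros h0).to_subtype
  rw [← hasSum_subtype_iff_of_support_subset (support_subset_nontrivialZeros _)]
  let B : nontrivialZeros F D → ℝ := fun ρ => (zeroMult F D ρ : ℝ) *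
    (8 * (1 + T ^ 2) * (1 + |(ρ : ℂ).im|) ^ (-(5 / 4) : ℝ))
  have hB : Summable B := by
    have := ((hF.summable_weight h0).mul_left (8 * (1 + T ^ 2))).subtype (nontrivialZeros F D)
    refine this.congr fun ρ => ?_
    simp only [Function.comp, B]
    ring
  let G : nontrivialZeros F D → ℝ → ℝ := fun ρ t => (zeroMult F D ρ : ℝ) *
    (zeroKernel (2 - (ρ : ℂ).re) (ρ : ℂ).im t - zeroKernel (2 - (ρ : ℂ).re) (ρ : ℂ).im (-t))
  let f : ℝ → ℝ := fun t => (logDeriv (xi F D) (2 + t * I)).re -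
    (logDeriv (xi F D) (2 + (-t : ℝ) * I)).re
  have hmeas : ∀ ρ, MeasureTheory.AEStronglyMeasurable (G ρ)
      (MeasureTheory.volume.restrict (Set.uIoc 0 T)) := fun ρ => by
    have hk := continuous_zeroKernel (γ := (ρ : ℂ).im) (hF.two_sub_re_mem ρ.2).1
    exact (continuous_const.mul (hk.sub (hk.comp continuous_neg))).aestronglyMeasurable
  have hbound : ∀ ρ, ∀ t ∈ Set.uIoc 0 T, ‖G ρ t‖ ≤ B ρ := fun ρ t ht => by
    rw [Set.uIoc_of_le hT] at ht
    obtain ⟨ha1, ha2⟩ := hF.two_sub_re_mem ρ.2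
    have ht' : |t| ≤ T := abs_le.2 ⟨by linarith [ht.1], ht.2⟩
    have e1 := zeroKernel_le_rpow (γ := (ρ : ℂ).im) ha1 ha2 ht'
    have e2 := zeroKernel_le_rpow (γ := (ρ : ℂ).im) ha1 ha2 (t := -t) (T := T) (by rwa [abs_neg])
    have e3 := zeroKernel_nonneg (γ := (ρ : ℂ).im) ha1 t
    have e4 := zeroKernel_nonneg (γ := (ρ : ℂ).im) ha1 (-t)
    simp only [G, B]
    rw [norm_mul, Real.norm_of_nonneg (by positivity : (0 : ℝ) ≤ (zeroMult F D ρ : ℝ))]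
    refine mul_le_mul_of_nonneg_left ?_ (by positivity)
    rw [Real.norm_eq_abs, abs_le]
    constructor <;> linarith
  have hlim : ∀ t : ℝ, HasSum (fun ρ => G ρ t) (f t) := fun t => by
    have h3 : HasSum (fun ρ : ℂ => (zeroMult F D ρ : ℝ) *
        (zeroKernel (2 - ρ.re) ρ.im t - zeroKernel (2 - ρ.re) ρ.im (-t))) (f t) := by
      have h4 := (hc t).sub (hc (-t))
      rw [add_sub_add_right_eq_sub] at h4
      have h5 : (fun ρ : ℂ => (zeroMult F D ρ : ℝ) *
          (zeroKernel (2 - ρ.re) ρ.im t - zeroKernel (2 - ρ.re) ρ.im (-t))) =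
          fun ρ => (zeroMult F D ρ : ℝ) * zeroKernel (2 - ρ.re) ρ.im t -
            (zeroMult F D ρ : ℝ) * zeroKernel (2 - ρ.re) ρ.im (-t) := funext fun ρ => mul_sub _ _ _
      rw [h5]
      exact h4
    exact (hasSum_subtype_iff_of_support_subset
      (support_subset_nontrivialZeros (F := F) (D := D)
        fun ρ : ℂ => zeroKernel (2 - ρ.re) ρ.im t - zeroKernel (2 - ρ.re) ρ.im (-t))).2 h3
  have h2 : HasSum (fun ρ => ∫ t in (0 : ℝ)..T, G ρ t) (∫ t in (0 : ℝ)..T, f t) :=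
    intervalIntegral.hasSum_integral_of_dominated_convergence (μ := MeasureTheory.volume)
      (fun ρ _ => B ρ) hmeas (fun ρ => Eventually.of_forall (hbound ρ))
      (Eventually.of_forall fun t _ => hB) intervalIntegrable_const
      (Eventually.of_forall fun t _ => hlim t)
  have h6 : (fun ρ : ℂ => (zeroMult F D ρ : ℝ) * oddIntegral (2 - ρ.re) ρ.im T) ∘
      ((↑) : nontrivialZeros F D → ℂ) = fun ρ => ∫ t in (0 : ℝ)..T, G ρ t := funext fun ρ => by
    simp only [G, Function.comp, intervalIntegral.integral_const_mul, oddIntegral]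
  rw [h6]
  exact h2

lemma finite_zerosUpTo (hF : IsSelbergSharpFlat F D) (h0 : xi F D 0 ≠ 0) (x : ℝ) :
    (zerosUpTo F D x).Finite := by
  refine (finite_zeros_of_isCompact hF.differentiable_xi h0
    (isCompact_closedBall (0 : ℂ) (1 + x))).subset ?_
  rintro ρ ⟨hρ, hx⟩
  refine ⟨hρ, ?_⟩
  have := hF.norm_le_one_add_abs_im hρ
  simp
  linarith

/-- The zeros `ρ` with `|Im ρ| ≤ x`, as a finite set. -/
noncomputable def zeroFinset (hF : IsSelbergSharpFlat F D) (h0 : xi F D 0 ≠ 0) (x : ℝ) : Finset ℂ :=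
  (hF.finite_zerosUpTo h0 x).toFinset

lemma mem_zeroFinset (hF : IsSelbergSharpFlat F D) (h0 : xi F D 0 ≠ 0) {x : ℝ} {ρ : ℂ} :
    ρ ∈ hF.zeroFinset h0 x ↔ xi F D ρ = 0 ∧ |ρ.im| ≤ x := by
  simp [zeroFinset, zerosUpTo, nontrivialZeros]

/-- The number of zeros with `0 < Im ρ ≤ x` minus the number of those with `-x ≤ Im ρ < 0`. -/
noncomputable def signedCount (hF : IsSelbergSharpFlat F D) (h0 : xi F D 0 ≠ 0) (x : ℝ) : ℝ :=
  ∑ ρ ∈ hF.zeroFinset h0 x, (zeroMult F D ρ : ℝ) * Real.sign ρ.im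

lemma hasSum_signedCount (hF : IsSelbergSharpFlat F D) (h0 : xi F D 0 ≠ 0) (x : ℝ) :
    HasSum (fun ρ : ℂ => (zeroMult F D ρ : ℝ) * truncSign ρ.im x) (hF.signedCount h0 x) := by
  have h1 : hF.signedCount h0 x =
      ∑ ρ ∈ hF.zeroFinset h0 x, (zeroMult F D ρ : ℝ) * truncSign ρ.im x := by
    refine Finset.sum_congr rfl fun ρ hρ => ?_
    rw [truncSign, if_pos ((hF.mem_zeroFinset h0).1 hρ).2]
  rw [h1]
  refine hasSum_sum_of_ne_finset_zero fun ρ hρ => ?_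
  by_cases h : xi F D ρ = 0
  · rw [truncSign, if_neg, mul_zero]
    exact fun hx => hρ ((hF.mem_zeroFinset h0).2 ⟨h, hx⟩)
  · rw [zeroMult_eq_zero h]
    simp

/-- The zeros above and below the real axis are equally numerous up to `O(T ^ (3 / 4))`. The odd part
of `Re ξ_F'/ξ_F` on `Re s = 2` has a small integral over `[0, T]`, and each zero contributes to it
`± π` or `0` up to an error; the errors are summed by means of the convergence of
`∑ (1 + |γ|) ^ (-5/4)` and of the partial fraction expansion at the end points `2 ± i T`. -/
lemma exists_abs_signedCount_le (hF : IsSelbergSharpFlat F D) (h0 : xi F D 0 ≠ 0) :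
    ∃ K : ℝ, 0 ≤ K ∧ ∀ T : ℝ, 0 ≤ T → |hF.signedCount h0 T| ≤ K * (1 + T) ^ (3 / 4 : ℝ) := by
  obtain ⟨c, hc⟩ := hF.exists_hasSum_zeroKernel h0
  obtain ⟨K₁, hK₁, hA⟩ := hF.exists_abs_re_logDeriv_xi_le
  obtain ⟨K₂, hK₂, hB⟩ := hF.exists_integral_logDeriv_xi_bound
  have hW := (hF.summable_weight h0).hasSum
  set W := ∑' ρ : ℂ, (zeroMult F D ρ : ℝ) * (1 + |ρ.im|) ^ (-(5 / 4) : ℝ)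
  have hW0 : 0 ≤ W := tsum_nonneg fun ρ => by positivity
  have hmain : ∀ T : ℝ, 1 ≤ T → |hF.signedCount h0 T| ≤
      (K₂ + 80 * W + 32 * (K₁ + |c|)) * (1 + T) ^ (3 / 4 : ℝ) := by
    intro T hT
    have hT0 : 0 ≤ T := by linarith
    have h1 := hF.hasSum_oddIntegral h0 hT0
    have h2 := (hF.hasSum_signedCount h0 T).mul_left Real.pi
    have h3 := h1.sub h2
    have h4 := (hW.mul_left (80 * T ^ (3 / 4 : ℝ))).add
      (((hc T).add (hc (-T))).mul_left (16 * T ^ (1 / 2 : ℝ)))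
    have h5 : |(∫ t in (0 : ℝ)..T, ((logDeriv (xi F D) (2 + t * I)).re -
        (logDeriv (xi F D) (2 + (-t : ℝ) * I)).re)) - Real.pi * hF.signedCount h0 T| ≤
        80 * T ^ (3 / 4 : ℝ) * W + 16 * T ^ (1 / 2 : ℝ) * (((logDeriv (xi F D) (2 + T * I)).re + c) +
          ((logDeriv (xi F D) (2 + (-T : ℝ) * I)).re + c)) := by
      rw [← h3.tsum_eq, ← Real.norm_eq_abs]
      refine tsum_of_norm_bounded h4 fun ρ => ?_
      by_cases hρ : xi F D ρ = 0
      · obtain ⟨ha1, ha2⟩ := hF.two_sub_re_mem hρ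
        have h6 := abs_oddIntegral_sub_le_rpow (γ := ρ.im) ha1 ha2 hT
        have h7 : (zeroMult F D ρ : ℝ) * oddIntegral (2 - ρ.re) ρ.im T -
            Real.pi * ((zeroMult F D ρ : ℝ) * truncSign ρ.im T) = (zeroMult F D ρ : ℝ) *
              (oddIntegral (2 - ρ.re) ρ.im T - Real.pi * truncSign ρ.im T) := by ring
        rw [h7, norm_mul, Real.norm_of_nonneg (by positivity : (0 : ℝ) ≤ (zeroMult F D ρ : ℝ)),
          Real.norm_eq_abs]
        refine (mul_le_mul_of_nonneg_left h6 (by positivity)).trans (le_of_eq ?_)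
        ring
      · rw [zeroMult_eq_zero hρ]
        simp
    have hq : 1 ≤ 1 + T := by linarith
    have e1 : T ^ (3 / 4 : ℝ) ≤ (1 + T) ^ (3 / 4 : ℝ) := by
      gcongr
      linarith
    have e2 : T ^ (1 / 2 : ℝ) * (1 + T) ^ (1 / 4 : ℝ) ≤ (1 + T) ^ (3 / 4 : ℝ) := by
      calc T ^ (1 / 2 : ℝ) * (1 + T) ^ (1 / 4 : ℝ) ≤ (1 + T) ^ (1 / 2 : ℝ) * (1 + T) ^ (1 / 4 : ℝ) := by
            gcongr
            linarith
        _ = _ := by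
            rw [← Real.rpow_add (by linarith)]
            norm_num
    have e3 : (1 + T) ^ (1 / 4 : ℝ) ≤ (1 + T) ^ (3 / 4 : ℝ) :=
      Real.rpow_le_rpow_of_exponent_le hq (by norm_num)
    have e4 : ∀ t : ℝ, |t| = T → (logDeriv (xi F D) (2 + t * I)).re + c ≤
        (K₁ + |c|) * (1 + T) ^ (1 / 4 : ℝ) := by
      intro t ht
      have := (le_abs_self _).trans (hA t)
      rw [ht] at this
      have h9 : (1 : ℝ) ≤ (1 + T) ^ (1 / 4 : ℝ) := Real.one_le_rpow hq (by norm_num)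
      nlinarith [le_abs_self c, abs_nonneg c]
    have e5 := e4 T (abs_of_nonneg hT0)
    have e6 := e4 (-T) (by rw [abs_neg, abs_of_nonneg hT0])
    have e7 := hB T hT0
    have e8 : Real.pi * |hF.signedCount h0 T| ≤
        (K₂ + 80 * W + 32 * (K₁ + |c|)) * (1 + T) ^ (3 / 4 : ℝ) := by
      have e9 : Real.pi * |hF.signedCount h0 T| = |Real.pi * hF.signedCount h0 T| := by
        rw [abs_mul, abs_of_pos Real.pi_pos]
      rw [e9]
      have e10 := abs_sub_abs_le_abs_sub (Real.pi * hF.signedCount h0 T)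
        (∫ t in (0 : ℝ)..T, ((logDeriv (xi F D) (2 + t * I)).re -
          (logDeriv (xi F D) (2 + (-t : ℝ) * I)).re))
      rw [abs_sub_comm] at e10
      have e11 : 16 * T ^ (1 / 2 : ℝ) * (((logDeriv (xi F D) (2 + T * I)).re + c) +
          ((logDeriv (xi F D) (2 + (-T : ℝ) * I)).re + c)) ≤
          32 * (K₁ + |c|) * (1 + T) ^ (3 / 4 : ℝ) := by
        calc _ ≤ 16 * T ^ (1 / 2 : ℝ) * ((K₁ + |c|) * (1 + T) ^ (1 / 4 : ℝ) +
              (K₁ + |c|) * (1 + T) ^ (1 / 4 : ℝ)) := by gcongr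
          _ = 32 * (K₁ + |c|) * (T ^ (1 / 2 : ℝ) * (1 + T) ^ (1 / 4 : ℝ)) := by ring
          _ ≤ _ := by gcongr
      have e12 : 80 * T ^ (3 / 4 : ℝ) * W ≤ 80 * W * (1 + T) ^ (3 / 4 : ℝ) := by nlinarith
      have e13 : K₂ * (1 + T) ^ (1 / 4 : ℝ) ≤ K₂ * (1 + T) ^ (3 / 4 : ℝ) := by gcongr
      linarith
    refine le_trans ?_ e8
    exact le_mul_of_one_le_left (abs_nonneg _) (by linarith [Real.pi_gt_three])
  -- for `T ≤ 1` the count is bounded by the total number of zeros up to height `1`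
  refine ⟨(K₂ + 80 * W + 32 * (K₁ + |c|)) + ∑ ρ ∈ hF.zeroFinset h0 1, (zeroMult F D ρ : ℝ),
    by positivity, fun T hT => ?_⟩
  have hT1 : (1 : ℝ) ≤ (1 + T) ^ (3 / 4 : ℝ) := Real.one_le_rpow (by linarith) (by norm_num)
  rcases le_or_gt 1 T with h | h
  · refine (hmain T h).trans ?_
    exact mul_le_mul_of_nonneg_right (le_add_of_nonneg_right (by positivity)) (by positivity)
  · have h1 : |hF.signedCount h0 T| ≤ ∑ ρ ∈ hF.zeroFinset h0 1, (zeroMult F D ρ : ℝ) := by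
      refine (Finset.abs_sum_le_sum_abs _ _).trans ?_
      refine (Finset.sum_le_sum_of_subset_of_nonneg (t := hF.zeroFinset h0 1) ?_
        fun _ _ _ => abs_nonneg _).trans (Finset.sum_le_sum fun ρ _ => ?_)
      · intro ρ hρ
        rw [mem_zeroFinset] at hρ ⊢
        exact ⟨hρ.1, hρ.2.trans h.le⟩
      · rw [abs_mul, abs_of_nonneg (by positivity : (0 : ℝ) ≤ (zeroMult F D ρ : ℝ))]
        refine mul_le_of_le_one_right (by positivity) ?_
        rcases Real.sign_apply_eq ρ.im with h | h | h <;> rw [h] <;> norm_num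
    refine h1.trans ?_
    have h2 : 0 ≤ K₂ + 80 * W + 32 * (K₁ + |c|) := by positivity
    have h3 : 0 ≤ ∑ ρ ∈ hF.zeroFinset h0 1, (zeroMult F D ρ : ℝ) := by positivity
    nlinarith

end IsSelbergSharpFlat

/-! ### Convergence of the Li coefficients -/

/-- Second order Taylor bound for `z ^ n` at `1`. -/
lemma norm_one_sub_pow_sub_le {z : ℂ} {r : ℝ} (hr : 1 ≤ r) (hz : ‖z‖ ≤ r) (n : ℕ) :
    ‖1 - z ^ n - n * (1 - z)‖ ≤ n ^ 2 * r ^ n * ‖1 - z‖ ^ 2 := by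
  have h1 : ∀ k : ℕ, ‖1 - z ^ k‖ ≤ k * r ^ k * ‖1 - z‖ := by
    intro k
    induction k with
    | zero => simp
    | succ k ih =>
      have e : 1 - z ^ (k + 1) = (1 - z ^ k) + z ^ k * (1 - z) := by ring
      have e1 : ‖z ^ k * (1 - z)‖ ≤ r ^ k * ‖1 - z‖ := by
        rw [norm_mul, norm_pow]
        gcongr
      have e2 : r ^ k ≤ r ^ (k + 1) := pow_le_pow_right₀ hr (by omega)
      rw [e]
      calc _ ≤ k * r ^ k * ‖1 - z‖ + r ^ k * ‖1 - z‖ := (norm_add_le _ _).trans (add_le_add ih e1)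
        _ = (k + 1) * r ^ k * ‖1 - z‖ := by ring
        _ ≤ (k + 1) * r ^ (k + 1) * ‖1 - z‖ := by gcongr
        _ = _ := by push_cast; ring
  induction n with
  | zero => simp
  | succ n ih =>
    have e : 1 - z ^ (n + 1) - ((n + 1 : ℕ) : ℂ) * (1 - z) =
        (1 - z ^ n - n * (1 - z)) - (1 - z) * (1 - z ^ n) := by
      push_cast
      ring
    have e1 : ‖(1 - z) * (1 - z ^ n)‖ ≤ n * r ^ n * ‖1 - z‖ ^ 2 := by
      rw [norm_mul]
      calc _ ≤ ‖1 - z‖ * (n * r ^ n * ‖1 - z‖) := by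
            gcongr
            exact h1 n
        _ = _ := by ring
    have e2 : r ^ n ≤ r ^ (n + 1) := pow_le_pow_right₀ hr (by omega)
    have e3 : (n : ℝ) ^ 2 + n ≤ ((n + 1 : ℕ) : ℝ) ^ 2 := by
      push_cast
      nlinarith [(Nat.cast_nonneg n : (0 : ℝ) ≤ n)]
    rw [e]
    calc _ ≤ n ^ 2 * r ^ n * ‖1 - z‖ ^ 2 + n * r ^ n * ‖1 - z‖ ^ 2 :=
          (norm_sub_le _ _).trans (add_le_add ih e1)
      _ = ((n : ℝ) ^ 2 + n) * r ^ n * ‖1 - z‖ ^ 2 := by ring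
      _ ≤ _ := by gcongr

namespace IsSelbergSharpFlat

variable {F : ℂ → ℂ} {D : GammaData}

/-- An absolutely convergent sum over the zeros is the limit of its symmetric partial sums. -/
lemma tendsto_sum_zeroFinset (hF : IsSelbergSharpFlat F D) (h0 : xi F D 0 ≠ 0) {φ : ℂ → ℂ} {l : ℂ}
    (h : HasSum (fun ρ : ℂ => (zeroMult F D ρ : ℂ) * φ ρ) l) :
    Tendsto (fun T => ∑ ρ ∈ hF.zeroFinset h0 T, (zeroMult F D ρ : ℂ) * φ ρ) atTop (𝓝 l) := by
  classical
  intro U hU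
  obtain ⟨s₀, hs₀⟩ := mem_atTop_sets.1 (h hU)
  rw [mem_map]
  filter_upwards [eventually_ge_atTop (∑ ρ ∈ s₀, |ρ.im|)] with T hT
  have h1 := hs₀ (hF.zeroFinset h0 T ∪ s₀) Finset.subset_union_right
  have h2 : ∑ ρ ∈ hF.zeroFinset h0 T, (zeroMult F D ρ : ℂ) * φ ρ =
      ∑ ρ ∈ hF.zeroFinset h0 T ∪ s₀, (zeroMult F D ρ : ℂ) * φ ρ := by
    refine Finset.sum_subset Finset.subset_union_left fun ρ hρ hρ' => ?_
    have hρs : ρ ∈ s₀ := (Finset.mem_union.1 hρ).resolve_left hρ'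
    have hz : xi F D ρ ≠ 0 := fun hz => hρ' ((hF.mem_zeroFinset h0).2 ⟨hz,
      (Finset.single_le_sum (f := fun ρ : ℂ => |ρ.im|) (fun _ _ => abs_nonneg _) hρs).trans hT⟩)
    simp [zeroMult_eq_zero hz]
  simp only [Set.mem_preimage] at h1 ⊢
  rwa [h2]

lemma signedCount_eq_sum_truncSign (hF : IsSelbergSharpFlat F D) (h0 : xi F D 0 ≠ 0) {x T : ℝ}
    (hx : x ≤ T) : hF.signedCount h0 x =
      ∑ ρ ∈ hF.zeroFinset h0 T, (zeroMult F D ρ : ℝ) * truncSign ρ.im x := by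
  refine (hF.hasSum_signedCount h0 x).unique (hasSum_sum_of_ne_finset_zero fun ρ hρ => ?_)
  by_cases h : xi F D ρ = 0
  · rw [truncSign, if_neg, mul_zero]
    exact fun hx' => hρ ((hF.mem_zeroFinset h0).2 ⟨h, hx'.trans hx⟩)
  · rw [zeroMult_eq_zero h]
    simp

end IsSelbergSharpFlat

section PartialSummation

open MeasureTheory

lemma integrableOn_inv_sq (T : ℝ) : IntegrableOn (fun x : ℝ => 1 / (1 + x) ^ 2) (Set.Ioc 0 T) := by
  refine (ContinuousOn.integrableOn_Icc (a := 0) (b := T) ?_).mono_set Set.Ioc_subset_Icc_self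
  intro x hx
  have : (1 + x) ^ 2 ≠ 0 := by
    have := hx.1
    positivity
  exact ContinuousAt.continuousWithinAt (by fun_prop (disch := assumption))

lemma truncSign_mul_eq_indicator (γ : ℝ) (g : ℝ → ℝ) : (fun x => truncSign γ x * g x) =
    (Set.Ici |γ|).indicator fun x => Real.sign γ * g x := by
  funext x
  by_cases h : |γ| ≤ x
  · rw [Set.indicator_of_mem (Set.mem_Ici.2 h), truncSign, if_pos h]
  · rw [Set.indicator_of_notMem (by simpa using h), truncSign, if_neg h, zero_mul]

lemma integrableOn_truncSign (γ T : ℝ) :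
    IntegrableOn (fun x => truncSign γ x * (1 / (1 + x) ^ 2)) (Set.Ioc 0 T) := by
  rw [truncSign_mul_eq_indicator]
  exact ((integrableOn_inv_sq T).const_mul _).indicator measurableSet_Ici

lemma integral_truncSign {γ T : ℝ} (h : |γ| ≤ T) :
    ∫ x in Set.Ioc 0 T, truncSign γ x * (1 / (1 + x) ^ 2) =
      Real.sign γ * (1 / (1 + |γ|) - 1 / (1 + T)) := by
  rw [truncSign_mul_eq_indicator, setIntegral_indicator measurableSet_Ici, integral_const_mul]
  rcases eq_or_ne γ 0 with rfl | hγ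
  · simp
  have hγ' : 0 < |γ| := abs_pos.2 hγ
  have h1 : Set.Ioc 0 T ∩ Set.Ici |γ| = Set.Icc |γ| T := by
    ext x
    simp only [Set.mem_inter_iff, Set.mem_Ioc, Set.mem_Ici, Set.mem_Icc]
    exact ⟨fun hx => ⟨hx.2, hx.1.2⟩, fun hx => ⟨⟨hγ'.trans_le hx.1, hx.2⟩, hx.1⟩⟩
  rw [h1, integral_Icc_eq_integral_Ioc, ← intervalIntegral.integral_of_le h]
  rw [intervalIntegral.integral_eq_sub_of_hasDerivAt (f := fun x => -(1 / (1 + x)))]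
  · ring
  · intro x hx
    rw [Set.uIcc_of_le h] at hx
    have hx0 : 1 + x ≠ 0 := by linarith [hx.1]
    have := (((hasDerivAt_id x).const_add 1).inv hx0).neg
    simp only [neg_neg, neg_div, one_div, id] at this ⊢
    exact this
  · rw [intervalIntegrable_iff_integrableOn_Ioc_of_le h]
    exact (integrableOn_inv_sq T).mono_set (Set.Ioc_subset_Ioc_left hγ'.le)

end PartialSummation

namespace IsSelbergSharpFlat

open MeasureTheory

variable {F : ℂ → ℂ} {D : GammaData}

lemma integrableOn_signedCount_Ioc (hF : IsSelbergSharpFlat F D) (h0 : xi F D 0 ≠ 0) (T : ℝ) :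
    IntegrableOn (fun x => hF.signedCount h0 x * (1 / (1 + x) ^ 2)) (Set.Ioc 0 T) := by
  have h1 : IntegrableOn (fun x => ∑ ρ ∈ hF.zeroFinset h0 T,
      (zeroMult F D ρ : ℝ) * (truncSign ρ.im x * (1 / (1 + x) ^ 2))) (Set.Ioc 0 T) :=
    integrable_finsetSum _ fun ρ _ => (integrableOn_truncSign ρ.im T).const_mul _
  refine h1.congr_fun (fun x hx => ?_) measurableSet_Ioc
  simp only
  rw [hF.signedCount_eq_sum_truncSign h0 hx.2, Finset.sum_mul]
  exact Finset.sum_congr rfl fun ρ _ => by ring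

/-- Partial summation of `sign γ / (1 + |γ|)` against the signed count of the zeros. -/
lemma sum_sign_div (hF : IsSelbergSharpFlat F D) (h0 : xi F D 0 ≠ 0) (T : ℝ) :
    ∑ ρ ∈ hF.zeroFinset h0 T, (zeroMult F D ρ : ℝ) * (Real.sign ρ.im / (1 + |ρ.im|)) =
      hF.signedCount h0 T * (1 / (1 + T)) +
        ∫ x in Set.Ioc 0 T, hF.signedCount h0 x * (1 / (1 + x) ^ 2) := by
  have h1 : ∫ x in Set.Ioc 0 T, hF.signedCount h0 x * (1 / (1 + x) ^ 2) =
      ∑ ρ ∈ hF.zeroFinset h0 T,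
        (zeroMult F D ρ : ℝ) * (Real.sign ρ.im * (1 / (1 + |ρ.im|) - 1 / (1 + T))) := by
    have h2 : ∫ x in Set.Ioc 0 T, hF.signedCount h0 x * (1 / (1 + x) ^ 2) =
        ∫ x in Set.Ioc 0 T, ∑ ρ ∈ hF.zeroFinset h0 T,
          (zeroMult F D ρ : ℝ) * (truncSign ρ.im x * (1 / (1 + x) ^ 2)) := by
      refine setIntegral_congr_fun measurableSet_Ioc fun x hx => ?_
      rw [hF.signedCount_eq_sum_truncSign h0 hx.2, Finset.sum_mul]
      exact Finset.sum_congr rfl fun ρ _ => by ring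
    rw [h2, integral_finsetSum _ fun ρ _ => (integrableOn_truncSign ρ.im T).const_mul _]
    refine Finset.sum_congr rfl fun ρ hρ => ?_
    rw [integral_const_mul, integral_truncSign ((hF.mem_zeroFinset h0).1 hρ).2]
  rw [h1, signedCount, Finset.sum_mul, ← Finset.sum_add_distrib]
  exact Finset.sum_congr rfl fun ρ _ => by ring

lemma integrableOn_signedCount (hF : IsSelbergSharpFlat F D) (h0 : xi F D 0 ≠ 0) :
    IntegrableOn (fun x => hF.signedCount h0 x * (1 / (1 + x) ^ 2)) (Set.Ioi 0) := by
  obtain ⟨K, hK, hD⟩ := hF.exists_abs_signedCount_le h0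
  have h1 : IntegrableOn (fun x : ℝ => K * (x + 1) ^ (-(5 / 4) : ℝ)) (Set.Ioi 0) :=
    (integrableOn_add_rpow_Ioi_of_lt (by norm_num) (by norm_num)).const_mul K
  have hU : Set.Ioi (0 : ℝ) = ⋃ n : ℕ, Set.Ioc 0 (n : ℝ) := by
    ext x
    simp only [Set.mem_Ioi, Set.mem_iUnion, Set.mem_Ioc]
    exact ⟨fun hx => (exists_nat_ge x).imp fun n hn => ⟨hx, hn⟩, fun ⟨n, hn⟩ => hn.1⟩
  have hm : AEStronglyMeasurable (fun x => hF.signedCount h0 x * (1 / (1 + x) ^ 2))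
      (volume.restrict (Set.Ioi 0)) := by
    rw [hU, aestronglyMeasurable_iUnion_iff]
    exact fun n => (hF.integrableOn_signedCount_Ioc h0 n).aestronglyMeasurable
  refine Integrable.mono' h1 hm ((ae_restrict_mem measurableSet_Ioi).mono fun x hx => ?_)
  have hx0 : (0 : ℝ) ≤ x := le_of_lt hx
  rw [norm_mul, Real.norm_eq_abs, Real.norm_of_nonneg (by positivity)]
  calc _ ≤ K * (1 + x) ^ (3 / 4 : ℝ) * (1 / (1 + x) ^ 2) := by
        gcongr
        exact hD x hx0
    _ = K * ((1 + x) ^ (3 / 4 : ℝ) * (1 + x) ^ (-2 : ℝ)) := by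
        rw [Real.rpow_neg (by positivity), Real.rpow_two]
        ring
    _ = _ := by
        rw [← Real.rpow_add (by positivity), add_comm x]
        norm_num

/-- The series `∑ sign γ / (1 + |γ|)` converges when the zeros are ordered by height: this is where
the near equality of the numbers of zeros above and below the real axis is needed. -/
lemma exists_tendsto_sum_sign_div (hF : IsSelbergSharpFlat F D) (h0 : xi F D 0 ≠ 0) :
    ∃ l : ℝ, Tendsto (fun T => ∑ ρ ∈ hF.zeroFinset h0 T,
      (zeroMult F D ρ : ℝ) * (Real.sign ρ.im / (1 + |ρ.im|))) atTop (𝓝 l) := by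
  obtain ⟨K, hK, hD⟩ := hF.exists_abs_signedCount_le h0
  simp only [hF.sum_sign_div h0]
  refine ⟨0 + ∫ x in Set.Ioi 0, hF.signedCount h0 x * (1 / (1 + x) ^ 2), Tendsto.add ?_ ?_⟩
  · have h1 : Tendsto (fun T : ℝ => K * (1 + T) ^ (-(1 / 4) : ℝ)) atTop (𝓝 0) := by
      have h2 := (tendsto_rpow_neg_atTop (by norm_num : (0 : ℝ) < 1 / 4)).comp
        (tendsto_atTop_add_const_left atTop (1 : ℝ) tendsto_id)
      simpa using h2.const_mul K
    refine squeeze_zero_norm' ?_ h1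
    filter_upwards [eventually_ge_atTop 0] with T hT
    rw [norm_mul, Real.norm_eq_abs, Real.norm_of_nonneg (by positivity)]
    calc _ ≤ K * (1 + T) ^ (3 / 4 : ℝ) * (1 / (1 + T)) := by
          gcongr
          exact hD T hT
      _ = K * ((1 + T) ^ (3 / 4 : ℝ) * (1 + T) ^ (-1 : ℝ)) := by
          rw [Real.rpow_neg_one]
          ring
      _ = _ := by
          rw [← Real.rpow_add (by positivity)]
          norm_num
  · have h2 := intervalIntegral_tendsto_integral_Ioi 0 (hF.integrableOn_signedCount h0) tendsto_id
    refine h2.congr' ?_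
    filter_upwards [eventually_ge_atTop 0] with T hT
    exact intervalIntegral.integral_of_le hT

/-- Off a compact set, `1 / ρ` differs from `-i sign γ / (1 + |γ|)` by `O(|ρ| ^ (-2))`. -/
lemma norm_one_div_add_le (hF : IsSelbergSharpFlat F D) {ρ : ℂ} (h : xi F D ρ = 0)
    (hρ : 2 ≤ ‖ρ‖) :
    ‖1 / ρ + I * ((Real.sign ρ.im / (1 + |ρ.im|) : ℝ) : ℂ)‖ ≤ 4 / ‖ρ‖ ^ 2 := by
  obtain ⟨h1, h2⟩ := hF.re_mem_of_xi_eq_zero h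
  have h3 := hF.norm_le_one_add_abs_im h
  have h4 : 1 ≤ |ρ.im| := by linarith
  have hγ : ρ.im ≠ 0 := by
    intro h
    rw [h] at h4
    norm_num at h4
  have hγ' : (ρ.im : ℂ) ≠ 0 := by exact_mod_cast hγ
  have hρ0 : ρ ≠ 0 := by
    rintro rfl
    norm_num at hρ
  have e1 : 1 / ρ - 1 / (I * ρ.im) = -(ρ.re : ℂ) / (ρ * (I * ρ.im)) := by
    have : I * (ρ.im : ℂ) - ρ = -(ρ.re : ℂ) := by
      apply Complex.ext <;> simp
    rw [← this, div_sub_div _ _ hρ0 (mul_ne_zero I_ne_zero hγ')]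
    ring
  have e2 : 1 / (I * (ρ.im : ℂ)) + I * ((Real.sign ρ.im / (1 + |ρ.im|) : ℝ) : ℂ) =
      -I * ((1 / ρ.im - Real.sign ρ.im / (1 + |ρ.im|) : ℝ) : ℂ) := by
    push_cast
    rw [one_div, mul_inv, inv_I]
    ring
  have e3 : |1 / ρ.im - Real.sign ρ.im / (1 + |ρ.im|)| = 1 / (|ρ.im| * (1 + |ρ.im|)) := by
    rcases hγ.lt_or_gt with h | h
    · rw [Real.sign_of_neg h, abs_of_neg h]
      rw [abs_of_nonpos]
      · have : 1 + -ρ.im ≠ 0 := by linarith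
        field_simp
        ring
      · have h5 : 1 / (1 + -ρ.im) ≤ 1 / (-ρ.im) :=
          one_div_le_one_div_of_le (by linarith) (by linarith)
        rw [div_neg] at h5
        rw [neg_div]
        linarith
    · rw [Real.sign_of_pos h, abs_of_pos h, abs_of_nonneg]
      · have : 1 + ρ.im ≠ 0 := by linarith
        field_simp
        ring
      · have : 1 / (1 + ρ.im) ≤ 1 / ρ.im := one_div_le_one_div_of_le h (by linarith)
        linarith
  have e4 : 1 / ρ + I * ((Real.sign ρ.im / (1 + |ρ.im|) : ℝ) : ℂ) =
      -(ρ.re : ℂ) / (ρ * (I * ρ.im)) +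
        -I * ((1 / ρ.im - Real.sign ρ.im / (1 + |ρ.im|) : ℝ) : ℂ) := by
    rw [← e1, ← e2]
    ring
  have e5 : ‖-(ρ.re : ℂ) / (ρ * (I * ρ.im))‖ ≤ 2 / ‖ρ‖ ^ 2 := by
    rw [norm_div, norm_neg, norm_mul, norm_mul, norm_I, one_mul, norm_real, norm_real,
      Real.norm_eq_abs, Real.norm_eq_abs, abs_of_nonneg h1,
      div_le_div_iff₀ (by positivity) (by positivity)]
    nlinarith [norm_nonneg ρ, mul_nonneg (norm_nonneg ρ) (norm_nonneg ρ)]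
  have e6 : ‖-I * ((1 / ρ.im - Real.sign ρ.im / (1 + |ρ.im|) : ℝ) : ℂ)‖ ≤ 2 / ‖ρ‖ ^ 2 := by
    rw [norm_mul, norm_neg, norm_I, one_mul, norm_real, Real.norm_eq_abs, e3,
      div_le_div_iff₀ (by positivity) (by positivity)]
    nlinarith [norm_nonneg ρ]
  rw [e4]
  refine (norm_add_le _ _).trans ((add_le_add e5 e6).trans (le_of_eq ?_))
  ring

/-- The limit defining `λ_F(n)` exists, and its real part is an absolutely convergent series. -/
lemma exists_tendsto_liPartialSum (hF : IsSelbergSharpFlat F D) (h0 : xi F D 0 ≠ 0) (n : ℕ) :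
    ∃ l : ℂ, Tendsto (liPartialSum F D n) atTop (𝓝 l) ∧
      HasSum (fun ρ : ℂ => (zeroMult F D ρ : ℝ) * (1 - (1 - 1 / ρ) ^ n).re) l.re := by
  obtain ⟨S, hS⟩ := hF.exists_tendsto_sum_sign_div h0
  let q : ℂ → ℝ := fun ρ => Real.sign ρ.im / (1 + |ρ.im|)
  let φ : ℂ → ℂ := fun ρ => (1 - (1 - 1 / ρ) ^ n) + n * (I * (q ρ : ℂ))
  have hφ : Summable fun ρ : ℂ => (zeroMult F D ρ : ℂ) * φ ρ := by
    refine hF.summable_zeroMult_mul_of_sq h0 (X := 2) (K := n ^ 2 * 2 ^ n + n * 4)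
      fun ρ hρ h2 => ?_
    have e1 : ‖1 - 1 / ρ‖ ≤ 2 := by
      refine (norm_sub_le _ _).trans ?_
      have : ‖1 / ρ‖ ≤ 1 := by
        rw [norm_div, norm_one, div_le_one (by linarith)]
        linarith
      rw [norm_one]
      linarith
    have e2 := norm_one_sub_pow_sub_le (by norm_num) e1 n
    rw [sub_sub_cancel, norm_div, norm_one, div_pow, one_pow] at e2
    have e3 := hF.norm_one_div_add_le hρ h2
    have e4 : φ ρ = (1 - (1 - 1 / ρ) ^ n - n * (1 / ρ)) + n * (1 / ρ + I * (q ρ : ℂ)) := by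
      simp only [φ]
      ring
    rw [e4]
    refine (norm_add_le _ _).trans ?_
    rw [norm_mul, norm_natCast]
    calc _ ≤ n ^ 2 * 2 ^ n * (1 / ‖ρ‖ ^ 2) + n * (4 / ‖ρ‖ ^ 2) := by gcongr
      _ = _ := by ring
  have h1 := hF.tendsto_sum_zeroFinset h0 hφ.hasSum
  have h2 : Tendsto (fun T => ((∑ ρ ∈ hF.zeroFinset h0 T, (zeroMult F D ρ : ℝ) * q ρ : ℝ) : ℂ))
      atTop (𝓝 (S : ℂ)) := (continuous_ofReal.tendsto S).comp hS
  refine ⟨∑' ρ : ℂ, (zeroMult F D ρ : ℂ) * φ ρ - n * I * S, ?_, ?_⟩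
  · refine (h1.sub (h2.const_mul (n * I))).congr fun T => ?_
    rw [liPartialSum, finsum_mem_eq_finite_toFinset_sum _ (hF.finite_zerosUpTo h0 T)]
    change _ = ∑ ρ ∈ hF.zeroFinset h0 T, _
    push_cast
    rw [Finset.mul_sum, ← Finset.sum_sub_distrib]
    refine Finset.sum_congr rfl fun ρ _ => ?_
    simp only [φ]
    ring
  · have h3 := hasSum_re hφ.hasSum
    have h4 : (∑' ρ : ℂ, (zeroMult F D ρ : ℂ) * φ ρ - n * I * S).re =
        (∑' ρ : ℂ, (zeroMult F D ρ : ℂ) * φ ρ).re := by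
      simp
    rw [h4]
    have h5 : (fun ρ : ℂ => (zeroMult F D ρ : ℝ) * (1 - (1 - 1 / ρ) ^ n).re) =
        fun ρ => ((zeroMult F D ρ : ℂ) * φ ρ).re := funext fun ρ => by
      have h6 : (zeroMult F D ρ : ℂ) = ((zeroMult F D ρ : ℝ) : ℂ) := by push_cast; rfl
      have h7 : ((n : ℂ) * (I * (q ρ : ℂ))).re = 0 := by simp
      rw [h6, re_ofReal_mul, add_re, h7, add_zero]
    rw [h5]
    exact h3

lemma hasSum_re_liCoeff (hF : IsSelbergSharpFlat F D) (h0 : xi F D 0 ≠ 0) (n : ℕ) :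
    HasSum (fun ρ : ℂ => (zeroMult F D ρ : ℝ) * (1 - (1 - 1 / ρ) ^ n).re)
      (liCoeff F D n).re := by
  obtain ⟨l, hl, hs⟩ := hF.exists_tendsto_liPartialSum h0 n
  rwa [liCoeff, hl.limUnder_eq]

end IsSelbergSharpFlat

/-! ### Unboundedness of the Li coefficients when GRH fails -/

/-- Simultaneous approximation: finitely many unimodular numbers have a common
arbitrarily large exponent at which all their powers are close to `1`. -/
lemma exists_pow_near_one {ι : Type*} [Fintype ι] (u : ι → ℂ) (hu : ∀ i, ‖u i‖ = 1) (N : ℕ) :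
    ∃ n : ℕ, N ≤ n ∧ ∀ i, ‖u i ^ n - 1‖ ≤ 1 / 2 := by
  obtain ⟨a, -, φ, hφ, ha⟩ := (isCompact_closedBall (0 : ι → ℂ) 1).tendsto_subseq
    (x := fun n i => u i ^ n) fun n => by
      rw [mem_closedBall_zero_iff, pi_norm_le_iff_of_nonneg zero_le_one]
      intro i
      rw [norm_pow, hu, one_pow]
  obtain ⟨M, hM⟩ := Metric.cauchySeq_iff.1 ha.cauchySeq (1 / 2) (by norm_num)
  have h1 : N + φ M ≤ φ (M + N) := add_comm N M ▸ hφ.add_le_nat N M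
  refine ⟨φ (M + N) - φ M, by omega, fun i => ?_⟩
  have h2 := hM (M + N) (by omega) M le_rfl
  rw [dist_eq_norm] at h2
  have h3 := (norm_le_pi_norm _ i).trans h2.le
  simp only [Function.comp, Pi.sub_apply] at h3
  have h4 : u i ^ φ (M + N) - u i ^ φ M = u i ^ φ M * (u i ^ (φ (M + N) - φ M) - 1) := by
    rw [mul_sub, ← pow_add, Nat.add_sub_cancel' (by omega), mul_one]
  rwa [h4, norm_mul, norm_pow, hu, one_pow, one_mul] at h3

/-- The mechanism of the Bombieri–Lagarias criterion: if some `z` of positive multiplicity lies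
outside the closed unit disc, the power sums `∑ m Re (1 - z ^ n)` are unbounded below. The finitely
many largest `z` are rotated near the positive real axis by a common large exponent, and the others
contribute only `O(n ^ 2 r ^ n)` with a smaller radius `r`. -/
lemma exists_hasSum_lt {ι : Type*} {m : ι → ℕ} {z : ι → ℂ} {L : ℕ → ℝ}
    (h1 : Summable fun i => (m i : ℝ) * |(1 - z i).re|)
    (h2 : Summable fun i => (m i : ℝ) * ‖1 - z i‖ ^ 2)
    (hL : ∀ n, HasSum (fun i => (m i : ℝ) * (1 - z i ^ n).re) (L n))
    {i₀ : ι} (hm : m i₀ ≠ 0) (hz : 1 < ‖z i₀‖) (B : ℝ) :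
    ∃ n : ℕ, 1 ≤ n ∧ L n < B := by
  classical
  set R := ‖z i₀‖
  set r := (1 + R) / 2 with hr
  have hr1 : 1 < r := by linarith
  have hrR : r < R := by linarith
  -- only finitely many terms have `r ≤ |z|`, as `|1 - z|` is bounded below there
  have hfin : {i | m i ≠ 0 ∧ r ≤ ‖z i‖}.Finite := by
    have h3 := h2.tendsto_cofinite_zero.eventually (gt_mem_nhds (by nlinarith : 0 < (r - 1) ^ 2))
    rw [eventually_cofinite] at h3
    refine h3.subset fun i hi => ?_
    obtain ⟨hi1, hi2⟩ := hi
    have h4 : r - 1 ≤ ‖1 - z i‖ := by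
      have := norm_sub_norm_le (z i) 1
      rw [norm_one, norm_sub_rev] at this
      linarith
    have h5 : (1 : ℝ) ≤ m i := by exact_mod_cast Nat.one_le_iff_ne_zero.2 hi1
    simp only [Set.mem_ofPred_eq, not_lt]
    have h6 : (r - 1) ^ 2 ≤ ‖1 - z i‖ ^ 2 := pow_le_pow_left₀ (by linarith) h4 2
    nlinarith [sq_nonneg ‖1 - z i‖]
  set S := hfin.toFinset with hS
  have hmem : ∀ i, i ∈ S ↔ m i ≠ 0 ∧ r ≤ ‖z i‖ := fun i => by simp [hS]
  set A₁ := ∑' i, (m i : ℝ) * |(1 - z i).re|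
  set A₂ := ∑' i, (m i : ℝ) * ‖1 - z i‖ ^ 2
  have hA₁ : 0 ≤ A₁ := tsum_nonneg fun i => by positivity
  have hA₂ : 0 ≤ A₂ := tsum_nonneg fun i => by positivity
  set M : ℝ := ∑ i ∈ S, (m i : ℝ)
  -- the growing term dominates for large exponents
  have hbig : ∀ᶠ n : ℕ in atTop, (n : ℝ) ^ 2 * r ^ n * (A₁ + A₂) ≤ 1 / 4 * R ^ n ∧
      4 * (M - B) < R ^ n := by
    have e1 := (isLittleO_pow_const_mul_const_pow_const_pow_of_norm_lt (R := ℝ) 2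
      (r₁ := r) (r₂ := R) (by rwa [Real.norm_of_nonneg (by linarith)])).bound
      (show (0 : ℝ) < 1 / (4 * (A₁ + A₂ + 1)) by positivity)
    have e2 := (tendsto_pow_atTop_atTop_of_one_lt (hr1.trans hrR)).eventually_gt_atTop (4 * (M - B))
    filter_upwards [e1, e2] with n e1 e2
    refine ⟨?_, e2⟩
    rw [Real.norm_of_nonneg (by positivity), Real.norm_of_nonneg (by positivity)] at e1
    calc (n : ℝ) ^ 2 * r ^ n * (A₁ + A₂) ≤ (1 / (4 * (A₁ + A₂ + 1)) * R ^ n) * (A₁ + A₂ + 1) := by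
          refine mul_le_mul e1 (by linarith) (by positivity) (by positivity)
      _ = _ := by
          field_simp
  obtain ⟨N, hN⟩ := eventually_atTop.1 hbig
  obtain ⟨n, hn, hu⟩ := exists_pow_near_one (fun i : S => z i / (‖z i‖ : ℂ)) (fun i => by
    have : 0 < ‖z i‖ := by linarith [((hmem i).1 i.2).2]
    rw [norm_div, norm_real, norm_norm, div_self this.ne']) (N + 1)
  obtain ⟨hn1, hn2⟩ := hN n (by omega)
  refine ⟨n, by omega, ?_⟩
  have hnr : (1 : ℝ) ≤ n := by exact_mod_cast (by omega : 1 ≤ n)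
  have hrn : 1 ≤ r ^ n := one_le_pow₀ hr1.le
  -- on `S` the chosen exponent makes `z ^ n` nearly a positive real number
  have hSterm : ∀ i ∈ S, (1 - z i ^ n).re ≤ 1 - ‖z i‖ ^ n / 2 := fun i hi => by
    have h3 := hu ⟨i, hi⟩
    have h4 : 0 < ‖z i‖ := by linarith [((hmem i).1 hi).2]
    have h5 := (abs_re_le_norm _).trans h3
    simp only [sub_re, one_re, abs_le] at h5
    have h6 : z i ^ n = ((‖z i‖ ^ n : ℝ) : ℂ) * (z i / (‖z i‖ : ℂ)) ^ n := by
      have : (‖z i‖ : ℂ) ≠ 0 := by exact_mod_cast h4.ne'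
      rw [div_pow]
      push_cast
      field_simp
    rw [sub_re, one_re, h6, re_ofReal_mul]
    nlinarith [h5.1, pow_pos h4 n]
  have hg1 : HasSum (fun i => if i ∈ S then (m i : ℝ) * (1 - ‖z i‖ ^ n / 2) else 0)
      (∑ i ∈ S, (m i : ℝ) * (1 - ‖z i‖ ^ n / 2)) := by
    have h3 : ∑ i ∈ S, (m i : ℝ) * (1 - ‖z i‖ ^ n / 2) =
        ∑ i ∈ S, if i ∈ S then (m i : ℝ) * (1 - ‖z i‖ ^ n / 2) else 0 :=
      Finset.sum_congr rfl fun i hi => by rw [if_pos hi]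
    rw [h3]
    exact hasSum_sum_of_ne_finset_zero fun i hi => if_neg hi
  have hg2 := (h1.hasSum.add h2.hasSum).mul_left ((n : ℝ) ^ 2 * r ^ n)
  have hle := hasSum_le (fun i => ?_) (hL n) (hg1.add hg2)
  · have h3 : ∑ i ∈ S, (m i : ℝ) * (1 - ‖z i‖ ^ n / 2) ≤ M - R ^ n / 2 := by
      have h4 : R ^ n / 2 ≤ ∑ i ∈ S, (m i : ℝ) * (‖z i‖ ^ n / 2) := by
        have h5 : i₀ ∈ S := (hmem i₀).2 ⟨hm, hrR.le⟩
        refine le_trans ?_ (Finset.single_le_sum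
          (f := fun i => (m i : ℝ) * (‖z i‖ ^ n / 2)) (fun i _ => by positivity) h5)
        have h6 : (1 : ℝ) ≤ m i₀ := by exact_mod_cast Nat.one_le_iff_ne_zero.2 hm
        exact le_mul_of_one_le_left (by positivity) h6
      have h7 : ∑ i ∈ S, (m i : ℝ) * (1 - ‖z i‖ ^ n / 2) =
          M - ∑ i ∈ S, (m i : ℝ) * (‖z i‖ ^ n / 2) := by
        rw [← Finset.sum_sub_distrib]
        exact Finset.sum_congr rfl fun i _ => by ring
      linarith
    linarith
  · have hpos : 0 ≤ (n : ℝ) ^ 2 * r ^ n *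
        ((m i : ℝ) * |(1 - z i).re| + (m i : ℝ) * ‖1 - z i‖ ^ 2) := by positivity
    by_cases hi : i ∈ S
    · rw [if_pos hi]
      have := mul_le_mul_of_nonneg_left (hSterm i hi) (Nat.cast_nonneg (α := ℝ) (m i))
      linarith
    · rw [if_neg hi, zero_add, ← mul_add]
      rcases eq_or_ne (m i) 0 with h0 | h0
      · simp [h0]
      have h3 : ‖z i‖ ≤ r := by
        by_contra hlt
        exact hi ((hmem i).2 ⟨h0, (not_le.1 hlt).le⟩)
      have h4 := (re_le_norm _).trans (norm_one_sub_pow_sub_le hr1.le h3 n)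
      have h5 : (1 - z i ^ n - n * (1 - z i)).re = (1 - z i ^ n).re - n * (1 - z i).re := by
        rw [sub_re, ← ofReal_natCast, re_ofReal_mul]
      have h6 : (n : ℝ) * (1 - z i).re ≤ n ^ 2 * r ^ n * |(1 - z i).re| := by
        calc (n : ℝ) * (1 - z i).re ≤ n * |(1 - z i).re| := by
              gcongr
              exact le_abs_self _
          _ ≤ n ^ 2 * r ^ n * |(1 - z i).re| := by
              gcongr
              nlinarith
      calc (m i : ℝ) * (1 - z i ^ n).re ≤
            m i * (n ^ 2 * r ^ n * (|(1 - z i).re| + ‖1 - z i‖ ^ 2)) := by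
            gcongr
            linarith
        _ = _ := by ring

namespace IsSelbergSharpFlat

variable {F : ℂ → ℂ} {D : GammaData}

lemma zeroMult_ne_zero (hF : IsSelbergSharpFlat F D) (h0 : xi F D 0 ≠ 0) {ρ : ℂ}
    (h : xi F D ρ = 0) : zeroMult F D ρ ≠ 0 :=
  (analyticOrderNatAt_pos_of_zero hF.differentiable_xi h0 h).ne'

lemma exists_re_lt_half (hF : IsSelbergSharpFlat F D) (h : ¬ GRH F D) :
    ∃ ρ, xi F D ρ = 0 ∧ ρ.re < 1 / 2 := by
  unfold GRH at h
  push Not at h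
  obtain ⟨ρ, hρ, hne⟩ := h
  rcases hne.lt_or_gt with h | h
  · exact ⟨ρ, hρ, h⟩
  · refine ⟨1 - (starRingEnd ℂ) ρ, ?_, ?_⟩
    · rw [← norm_eq_zero, ← hF.norm_xi_one_sub_conj, norm_eq_zero]
      exact hρ
    · rw [sub_re, one_re, conj_re]
      linarith

/-- If GRH fails, the real parts of the Li coefficients are unbounded below. -/
lemma exists_re_liCoeff_lt (hF : IsSelbergSharpFlat F D) (h0 : xi F D 0 ≠ 0) (h : ¬ GRH F D)
    (B : ℝ) : ∃ n : ℕ, 1 ≤ n ∧ (liCoeff F D n).re < B := by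
  obtain ⟨ρ₀, hρ₀, hre⟩ := hF.exists_re_lt_half h
  have hρ0 : ρ₀ ≠ 0 := by
    rintro rfl
    exact h0 hρ₀
  refine exists_hasSum_lt (m := zeroMult F D) (z := fun ρ => 1 - 1 / ρ) ?_ ?_
    (fun n => hF.hasSum_re_liCoeff h0 n) (i₀ := ρ₀) (hF.zeroMult_ne_zero h0 hρ₀) ?_ B
  · refine hF.summable_zeroMult_mul_of_sq h0 (X := 0) (K := 1) fun ρ hρ _ => ?_
    obtain ⟨h1, h2⟩ := hF.re_mem_of_xi_eq_zero hρ
    rw [sub_sub_cancel, Real.norm_eq_abs, abs_abs]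
    exact norm_re_one_div_le h1 h2
  · refine hF.summable_zeroMult_mul_of_sq h0 (X := 0) (K := 1) fun ρ hρ _ => ?_
    simp
  · have h1 : 1 - 1 / ρ₀ = (ρ₀ - 1) / ρ₀ := by
      field_simp
    rw [h1, norm_div, one_lt_div (norm_pos_iff.2 hρ0)]
    refine lt_of_pow_lt_pow_left₀ 2 (norm_nonneg _) ?_
    rw [← normSq_eq_norm_sq, ← normSq_eq_norm_sq, normSq_apply, normSq_apply]
    simp
    nlinarith

end IsSelbergSharpFlat

/-! ### Chebyshev polynomials and the zero counting function -/

section ChebyshevSubstitution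

open MeasureTheory Polynomial.Chebyshev

/-- A countable sum of integrable functions with summable `L¹` norms is integrable. -/
lemma integrable_of_summable_integral_norm {α ι : Type*} [MeasurableSpace α] {μ : Measure α}
    [Countable ι] {f : ι → α → ℝ} {g : α → ℝ} (hf : ∀ i, Integrable (f i) μ)
    (hs : Summable fun i => ∫ a, ‖f i a‖ ∂μ) (hg : ∀ᵐ a ∂μ, HasSum (fun i => f i a) (g a)) :
    Integrable g μ := by
  have hm : AEStronglyMeasurable g μ :=
    aestronglyMeasurable_of_tendsto_ae atTop
      (f := fun (s : Finset ι) a => ∑ i ∈ s, f i a)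
      (fun s => (integrable_finsetSum s fun i _ => hf i).aestronglyMeasurable) hg
  refine ⟨hm, ?_⟩
  have h1 : ∫⁻ a, ‖g a‖ₑ ∂μ ≤ ∑' i, ∫⁻ a, ‖f i a‖ₑ ∂μ := by
    rw [← lintegral_tsum fun i => (hf i).aestronglyMeasurable.enorm]
    refine lintegral_mono_ae (hg.mono fun a ha => ?_)
    rw [← ha.tsum_eq]
    exact enorm_tsum_le_tsum_enorm
  refine h1.trans_lt (lt_top_iff_ne_top.2 ?_)
  have h2 : ∀ i, ∫⁻ a, ‖f i a‖ₑ ∂μ = ENNReal.ofReal (∫ a, ‖f i a‖ ∂μ) := fun i =>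
    (ofReal_integral_norm_eq_lintegral_enorm (hf i)).symm
  simp only [h2]
  exact hs.tsum_ofReal_ne_top

lemma chebyshev_arg_eq (x : ℝ) : (4 * x ^ 2 - 1) / (4 * x ^ 2 + 1) = 1 - 2 / (4 * x ^ 2 + 1) := by
  field_simp
  ring

lemma chebyshev_arg_mem (x : ℝ) : (4 * x ^ 2 - 1) / (4 * x ^ 2 + 1) ∈ Set.Icc (-1 : ℝ) 1 := by
  rw [chebyshev_arg_eq]
  have h1 : 0 < 4 * x ^ 2 + 1 := by positivity
  have h2 : 0 ≤ 2 / (4 * x ^ 2 + 1) := by positivity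
  have h3 : 2 / (4 * x ^ 2 + 1) ≤ 2 := by
    rw [div_le_iff₀ h1]
    nlinarith [sq_nonneg x]
  constructor <;> linarith

lemma exists_abs_eval_le (p : Polynomial ℝ) :
    ∃ M : ℝ, 0 ≤ M ∧ ∀ u ∈ Set.Icc (-1 : ℝ) 1, |p.eval u| ≤ M := by
  obtain ⟨M, hM⟩ := isCompact_Icc.exists_bound_of_continuousOn (s := Set.Icc (-1 : ℝ) 1)
    p.continuous.continuousOn
  exact ⟨M, (norm_nonneg _).trans (hM 0 (by norm_num)), hM⟩

/-- `1 - T_n(u)` vanishes at `u = 1`, hence is `O(1 / (4 x ^ 2 + 1))` at the Chebyshev argument. -/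
lemma exists_abs_one_sub_T_le (n : ℤ) : ∃ M : ℝ, 0 ≤ M ∧ ∀ x : ℝ,
    |1 - (T ℝ n).eval ((4 * x ^ 2 - 1) / (4 * x ^ 2 + 1))| ≤ M / (4 * x ^ 2 + 1) := by
  obtain ⟨q, hq⟩ : Polynomial.X - Polynomial.C 1 ∣ 1 - T ℝ n :=
    Polynomial.dvd_iff_isRoot.2 (by simp [T_eval_one])
  obtain ⟨M, hM0, hM⟩ := exists_abs_eval_le q
  refine ⟨2 * M, by positivity, fun x => ?_⟩
  have h1 : 0 < 4 * x ^ 2 + 1 := by positivity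
  have h2 := congrArg (Polynomial.eval ((4 * x ^ 2 - 1) / (4 * x ^ 2 + 1))) hq
  simp only [Polynomial.eval_sub, Polynomial.eval_one, Polynomial.eval_mul, Polynomial.eval_X,
    Polynomial.eval_C] at h2
  rw [h2, abs_mul]
  have h3 : (4 * x ^ 2 - 1) / (4 * x ^ 2 + 1) - 1 = -(2 / (4 * x ^ 2 + 1)) := by
    rw [chebyshev_arg_eq]
    ring
  rw [h3, abs_neg, abs_of_pos (by positivity)]
  calc _ ≤ 2 / (4 * x ^ 2 + 1) * M := by
        gcongr
        exact hM _ (chebyshev_arg_mem x)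
    _ = _ := by ring

lemma one_sub_T_nonneg (n : ℤ) (x : ℝ) :
    0 ≤ 1 - (T ℝ n).eval ((4 * x ^ 2 - 1) / (4 * x ^ 2 + 1)) := by
  have := abs_eval_T_real_le_one n (abs_le.2 (chebyshev_arg_mem x))
  linarith [le_abs_self ((T ℝ n).eval ((4 * x ^ 2 - 1) / (4 * x ^ 2 + 1)))]

lemma re_pow_eq_eval_T {z : ℂ} (hz : ‖z‖ = 1) (n : ℕ) : (z ^ n).re = (T ℝ (n : ℤ)).eval z.re := by
  have h1 : z = exp ((arg z : ℝ) * I) := by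
    have := norm_mul_exp_arg_mul_I z
    rw [hz, ofReal_one, one_mul] at this
    exact this.symm
  have h2 : z ^ n = exp (((n : ℝ) * arg z : ℝ) * I) := by
    conv_lhs => rw [h1]
    rw [← exp_nat_mul]
    congr 1
    push_cast
    ring
  have h3 : z.re = Real.cos (arg z) := by
    conv_lhs => rw [h1]
    exact exp_ofReal_mul_I_re _
  rw [h2, exp_ofReal_mul_I_re, h3, T_real_cos]
  push_cast
  rfl

lemma hasDerivAt_chebyshev_arg (x : ℝ) :
    HasDerivAt (fun x : ℝ => (4 * x ^ 2 - 1) / (4 * x ^ 2 + 1)) (16 * x / (4 * x ^ 2 + 1) ^ 2) x := by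
  have h1 : (4 * x ^ 2 + 1 : ℝ) ≠ 0 := by positivity
  have h2 : HasDerivAt (fun x : ℝ => 4 * x ^ 2) (4 * (2 * x)) x := by
    simpa using (hasDerivAt_pow 2 x).const_mul 4
  convert! (h2.sub_const 1).div (h2.add_const 1) h1 using 1
  field_simp
  ring

lemma tendsto_chebyshev_arg :
    Tendsto (fun x : ℝ => (4 * x ^ 2 - 1) / (4 * x ^ 2 + 1)) atTop (𝓝 1) := by
  have h1 : Tendsto (fun x : ℝ => 4 * x ^ 2 + 1) atTop atTop :=
    tendsto_atTop_add_const_right _ _ ((tendsto_pow_atTop two_ne_zero).const_mul_atTop (by norm_num))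
  have h2 := (h1.const_div_atTop 2).const_sub 1
  rw [sub_zero] at h2
  exact h2.congr fun x => (chebyshev_arg_eq x).symm

lemma integrableOn_chebyshev_weight {a : ℝ} (ha : 0 ≤ a) :
    IntegrableOn (fun x : ℝ => 16 * x / (4 * x ^ 2 + 1) ^ 2) (Set.Ioi a) :=
  integrableOn_Ioi_deriv_of_nonneg' (fun x _ => hasDerivAt_chebyshev_arg x)
    (fun x hx => by
      have : 0 < x := ha.trans_lt hx
      positivity) tendsto_chebyshev_arg

lemma integral_chebyshev_weight {a : ℝ} (ha : 0 ≤ a) :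
    ∫ x in Set.Ioi a, 16 * x / (4 * x ^ 2 + 1) ^ 2 = 2 / (4 * a ^ 2 + 1) := by
  rw [integral_Ioi_of_hasDerivAt_of_tendsto' (fun x _ => hasDerivAt_chebyshev_arg x)
    (integrableOn_chebyshev_weight ha) tendsto_chebyshev_arg, chebyshev_arg_eq]
  ring

/-- The weight against which the zero counting function is integrated. -/
noncomputable def chebyshevKernel (n : ℕ) (x : ℝ) : ℝ :=
  x / (4 * x ^ 2 + 1) ^ 2 * (U ℝ ((n : ℤ) - 1)).eval ((4 * x ^ 2 - 1) / (4 * x ^ 2 + 1))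

lemma continuous_chebyshevKernel (n : ℕ) : Continuous (chebyshevKernel n) := by
  have h1 : ∀ x : ℝ, (4 * x ^ 2 + 1) ≠ 0 := fun x => by positivity
  have h2 : ∀ x : ℝ, (4 * x ^ 2 + 1) ^ 2 ≠ 0 := fun x => by positivity
  have h3 : Continuous fun x : ℝ => (4 * x ^ 2 - 1) / (4 * x ^ 2 + 1) :=
    Continuous.div (by fun_prop) (by fun_prop) h1
  exact (Continuous.div continuous_id (by fun_prop) h2).mul ((Polynomial.continuous _).comp h3)

lemma exists_abs_chebyshevKernel_le (n : ℕ) : ∃ M : ℝ, 0 ≤ M ∧ ∀ x : ℝ, 0 ≤ x →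
    |chebyshevKernel n x| ≤ M * (16 * x / (4 * x ^ 2 + 1) ^ 2) := by
  obtain ⟨M, hM0, hM⟩ := exists_abs_eval_le (U ℝ ((n : ℤ) - 1))
  refine ⟨M, hM0, fun x hx => ?_⟩
  rw [chebyshevKernel, abs_mul, abs_of_nonneg (by positivity), mul_comm]
  refine mul_le_mul (hM _ (chebyshev_arg_mem x)) ?_ (by positivity) hM0
  gcongr
  linarith

lemma integrableOn_chebyshevKernel (n : ℕ) {a : ℝ} (ha : 0 ≤ a) :
    IntegrableOn (chebyshevKernel n) (Set.Ioi a) := by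
  obtain ⟨M, -, hM⟩ := exists_abs_chebyshevKernel_le n
  refine Integrable.mono' ((integrableOn_chebyshev_weight ha).const_mul M)
    (continuous_chebyshevKernel n).aestronglyMeasurable
    ((ae_restrict_mem measurableSet_Ioi).mono fun x hx => ?_)
  exact hM x (ha.trans (le_of_lt hx))

/-- `T_n` composed with the Chebyshev argument is, up to the factor `16 n`, a primitive of the
kernel, because `T_n' = n U_{n-1}`. -/
lemma integral_chebyshevKernel (n : ℕ) {a : ℝ} (ha : 0 ≤ a) :
    16 * n * ∫ x in Set.Ioi a, chebyshevKernel n x =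
      1 - (T ℝ (n : ℤ)).eval ((4 * a ^ 2 - 1) / (4 * a ^ 2 + 1)) := by
  rw [← integral_const_mul]
  have h1 : Tendsto (fun x : ℝ => (T ℝ (n : ℤ)).eval ((4 * x ^ 2 - 1) / (4 * x ^ 2 + 1)))
      atTop (𝓝 1) := by
    have := ((T ℝ (n : ℤ)).continuous.tendsto 1).comp tendsto_chebyshev_arg
    rwa [T_eval_one] at this
  refine integral_Ioi_of_hasDerivAt_of_tendsto'
    (f := fun x : ℝ => (T ℝ (n : ℤ)).eval ((4 * x ^ 2 - 1) / (4 * x ^ 2 + 1))) (fun x _ => ?_)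
    ((integrableOn_chebyshevKernel n ha).const_mul _) h1
  have h2 := ((T ℝ (n : ℤ)).hasDerivAt ((4 * x ^ 2 - 1) / (4 * x ^ 2 + 1))).comp x
    (hasDerivAt_chebyshev_arg x)
  refine h2.congr_deriv ?_
  rw [T_derivative_eq_U, chebyshevKernel, Polynomial.eval_mul]
  simp only [Int.cast_natCast, Polynomial.eval_natCast]
  ring

end ChebyshevSubstitution

namespace IsSelbergSharpFlat

open MeasureTheory Polynomial.Chebyshev

variable {F : ℂ → ℂ} {D : GammaData}

lemma summable_zeroMult_div (hF : IsSelbergSharpFlat F D) (h0 : xi F D 0 ≠ 0) (M : ℝ) :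
    Summable fun ρ : nontrivialZeros F D =>
      (zeroMult F D ρ : ℝ) * (M / (4 * (ρ : ℂ).im ^ 2 + 1)) := by
  refine Summable.subtype (f := fun ρ : ℂ => (zeroMult F D ρ : ℝ) * (M / (4 * ρ.im ^ 2 + 1))) ?_ _
  refine hF.summable_zeroMult_mul_of_sq h0 (X := 1) (K := |M|) fun ρ hρ h1 => ?_
  obtain ⟨h2, h3⟩ := hF.re_mem_of_xi_eq_zero hρ
  rw [norm_div, Real.norm_eq_abs, Real.norm_of_nonneg (by positivity : 0 ≤ 4 * ρ.im ^ 2 + 1)]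
  refine div_le_div_of_nonneg_left (abs_nonneg M) (by positivity) ?_
  rw [← normSq_eq_norm_sq, normSq_apply]
  nlinarith [sq_nonneg ρ.im]

lemma summable_chebyshevTerm (hF : IsSelbergSharpFlat F D) (h0 : xi F D 0 ≠ 0) (n : ℕ) :
    Summable fun ρ : nontrivialZeros F D => chebyshevTerm F D n ρ := by
  obtain ⟨M, -, hM⟩ := exists_abs_one_sub_T_le n
  refine (hF.summable_zeroMult_div h0 M).of_norm_bounded fun ρ => ?_
  rw [chebyshevTerm, norm_mul, Real.norm_of_nonneg (by positivity : (0 : ℝ) ≤ zeroMult F D ρ)]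
  exact mul_le_mul_of_nonneg_left (hM _) (by positivity)

lemma tsum_chebyshevTerm_nonneg (F : ℂ → ℂ) (D : GammaData) (n : ℕ) :
    0 ≤ ∑' ρ : nontrivialZeros F D, chebyshevTerm F D n ρ :=
  tsum_nonneg fun ρ => mul_nonneg (by positivity) (one_sub_T_nonneg _ _)

/-- On the critical line `1 - 1 / ρ` is unimodular, so its powers are governed by `T_n`. -/
lemma re_liCoeff_eq_tsum (hF : IsSelbergSharpFlat F D) (h0 : xi F D 0 ≠ 0) (h : GRH F D) (n : ℕ) :
    (liCoeff F D n).re = ∑' ρ : nontrivialZeros F D, chebyshevTerm F D n ρ := by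
  have h1 := (hasSum_subtype_iff_of_support_subset
    (support_subset_nontrivialZeros (F := F) (D := D)
      fun ρ : ℂ => (1 - (1 - 1 / ρ) ^ n).re)).2 (hF.hasSum_re_liCoeff h0 n)
  rw [← h1.tsum_eq]
  refine tsum_congr fun ρ => ?_
  have hre := h ρ ρ.2
  have hρ0 : (ρ : ℂ) ≠ 0 := by
    intro h2
    rw [h2] at hre
    norm_num at hre
  have h2 : ‖1 - 1 / (ρ : ℂ)‖ = 1 := by
    have h3 : 1 - 1 / (ρ : ℂ) = (ρ - 1) / ρ := by
      field_simp
    rw [h3, norm_div, div_eq_one_iff_eq (norm_ne_zero_iff.2 hρ0)]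
    rw [← sq_eq_sq₀ (norm_nonneg _) (norm_nonneg _), ← normSq_eq_norm_sq, ← normSq_eq_norm_sq,
      normSq_apply, normSq_apply, sub_re, sub_im, one_re, one_im, hre]
    ring
  have h4 : (1 - 1 / (ρ : ℂ)).re = (4 * (ρ : ℂ).im ^ 2 - 1) / (4 * (ρ : ℂ).im ^ 2 + 1) := by
    rw [chebyshev_arg_eq, sub_re, one_re, one_div, inv_re, normSq_apply, hre]
    congr 1
    rw [div_eq_div_iff (by linarith [mul_self_nonneg (ρ : ℂ).im]) (by positivity)]
    ring
  simp only [Function.comp, chebyshevTerm]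
  rw [sub_re, one_re, re_pow_eq_eval_T h2, h4]

lemma zeroCount_eq_sum (hF : IsSelbergSharpFlat F D) (h0 : xi F D 0 ≠ 0) (x : ℝ) :
    zeroCount F D x = ∑ ρ ∈ hF.zeroFinset h0 x, zeroMult F D ρ :=
  finsum_mem_eq_finite_toFinset_sum _ (hF.finite_zerosUpTo h0 x)

lemma hasSum_chebyshevIntegrand (hF : IsSelbergSharpFlat F D) (h0 : xi F D 0 ≠ 0) (n : ℕ) (x : ℝ) :
    HasSum (fun ρ : nontrivialZeros F D => (zeroMult F D ρ : ℝ) *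
      (Set.Ici |(ρ : ℂ).im|).indicator (chebyshevKernel n) x) (chebyshevIntegrand F D n x) := by
  have h1 : chebyshevIntegrand F D n x = ∑ ρ ∈ hF.zeroFinset h0 x, (zeroMult F D ρ : ℝ) *
      (Set.Ici |ρ.im|).indicator (chebyshevKernel n) x := by
    rw [chebyshevIntegrand, hF.zeroCount_eq_sum h0, mul_assoc]
    push_cast
    rw [Finset.sum_mul]
    refine Finset.sum_congr rfl fun ρ hρ => ?_
    rw [Set.indicator_of_mem (Set.mem_Ici.2 ((hF.mem_zeroFinset h0).1 hρ).2), chebyshevKernel]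
  rw [h1]
  refine (hasSum_subtype_iff_of_support_subset (f := fun ρ : ℂ => (zeroMult F D ρ : ℝ) *
    (Set.Ici |ρ.im|).indicator (chebyshevKernel n) x)
    (support_subset_nontrivialZeros (F := F) (D := D) _)).2
    (hasSum_sum_of_ne_finset_zero fun ρ hρ => ?_)
  by_cases h : xi F D ρ = 0
  · rw [Set.indicator_of_notMem, mul_zero]
    exact fun hx => hρ ((hF.mem_zeroFinset h0).2 ⟨h, hx⟩)
  · rw [zeroMult_eq_zero h]
    simp

lemma setIntegral_indicator_Ici {a : ℝ} (ha : 0 ≤ a) (g : ℝ → ℝ) :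
    ∫ x in Set.Ioi 0, (Set.Ici a).indicator g x = ∫ x in Set.Ioi a, g x := by
  rw [setIntegral_indicator measurableSet_Ici]
  refine setIntegral_congr_set ?_
  have h1 : (Set.Ioi a : Set ℝ) =ᵐ[volume] Set.Ici a := Ioi_ae_eq_Ici
  rcases ha.eq_or_lt with rfl | ha
  · rw [Set.inter_eq_left.2 Set.Ioi_subset_Ici_self]
    exact Filter.EventuallyEq.rfl
  · have h2 : Set.Ioi 0 ∩ Set.Ici a = Set.Ici a :=
      Set.inter_eq_right.2 fun x hx => ha.trans_le hx
    rw [h2]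
    exact h1.symm

lemma integrableOn_and_integral_chebyshevIntegrand (hF : IsSelbergSharpFlat F D) (h0 : xi F D 0 ≠ 0) (n : ℕ) :
    IntegrableOn (chebyshevIntegrand F D n) (Set.Ioi 0) ∧
      16 * (n : ℝ) * ∫ x in Set.Ioi (0 : ℝ), chebyshevIntegrand F D n x =
        ∑' ρ : nontrivialZeros F D, chebyshevTerm F D n ρ := by
  have hcount : Countable (nontrivialZeros F D) := (hF.countable_zeros h0).to_subtype
  obtain ⟨M, hM0, hM⟩ := exists_abs_chebyshevKernel_le n
  let f : nontrivialZeros F D → ℝ → ℝ := fun ρ x => (zeroMult F D ρ : ℝ) *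
    (Set.Ici |(ρ : ℂ).im|).indicator (chebyshevKernel n) x
  have hf : ∀ ρ, IntegrableOn (f ρ) (Set.Ioi 0) := fun ρ =>
    ((integrableOn_chebyshevKernel n le_rfl).indicator measurableSet_Ici).const_mul _
  have hs : Summable fun ρ => ∫ x in Set.Ioi 0, ‖f ρ x‖ := by
    refine Summable.of_nonneg_of_le (fun ρ => integral_nonneg fun x => norm_nonneg _) (fun ρ => ?_)
      (hF.summable_zeroMult_div h0 (M * 2))
    have h1 : ∀ x, ‖f ρ x‖ = (zeroMult F D ρ : ℝ) *
        (Set.Ici |(ρ : ℂ).im|).indicator (fun x => |chebyshevKernel n x|) x := fun x => by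
      simp only [f]
      rw [norm_mul, Real.norm_of_nonneg (by positivity : (0 : ℝ) ≤ zeroMult F D ρ),
        norm_indicator_eq_indicator_norm]
      rfl
    simp only [h1]
    rw [integral_const_mul, setIntegral_indicator_Ici (abs_nonneg _)]
    refine mul_le_mul_of_nonneg_left ?_ (by positivity)
    rw [← sq_abs (ρ : ℂ).im, mul_div_assoc, ← integral_chebyshev_weight (abs_nonneg _),
      ← integral_const_mul]
    exact setIntegral_mono_on (integrableOn_chebyshevKernel n (abs_nonneg _)).abs
      ((integrableOn_chebyshev_weight (abs_nonneg _)).const_mul M) measurableSet_Ioi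
      fun x hx => hM x ((abs_nonneg _).trans (le_of_lt hx))
  refine ⟨integrable_of_summable_integral_norm hf hs
    (Eventually.of_forall fun x => hF.hasSum_chebyshevIntegrand h0 n x), ?_⟩
  have h2 := hasSum_integral_of_summable_integral_norm hf hs
  have h3 : ∀ x, ∑' ρ, f ρ x = chebyshevIntegrand F D n x := fun x =>
    (hF.hasSum_chebyshevIntegrand h0 n x).tsum_eq
  simp only [h3] at h2
  rw [← (h2.mul_left (16 * (n : ℝ))).tsum_eq]
  refine tsum_congr fun ρ => ?_
  simp only [f]
  rw [integral_const_mul, setIntegral_indicator_Ici (abs_nonneg _), mul_left_comm,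
    integral_chebyshevKernel n (abs_nonneg _), sq_abs, chebyshevTerm]

/-- A representation of `Re λ_F(n)` by a function of `n` that is bounded below forces GRH. -/
lemma GRH_of_re_liCoeff_bounded_below (hF : IsSelbergSharpFlat F D) (h0 : xi F D 0 ≠ 0) {B : ℝ}
    (h : ∀ n : ℕ, 1 ≤ n → B ≤ (liCoeff F D n).re) : GRH F D := by
  by_contra hG
  obtain ⟨n, hn, hlt⟩ := hF.exists_re_liCoeff_lt h0 hG B
  exact absurd (h n hn) (not_le.2 hlt)

/-- Under GRH the only possible real zero is `1 / 2`. -/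
lemma zeroCount_zero_of_GRH (hF : IsSelbergSharpFlat F D) (h0 : xi F D 0 ≠ 0) (h : GRH F D)
    (hhalf : (1 / 2 : ℂ) ∉ nontrivialZeros F D) : zeroCount F D 0 = 0 := by
  rw [hF.zeroCount_eq_sum h0]
  refine Finset.sum_eq_zero fun ρ hρ => ?_
  obtain ⟨hz, him⟩ := (hF.mem_zeroFinset h0).1 hρ
  have h1 : ρ.im = 0 := abs_eq_zero.1 (le_antisymm him (abs_nonneg _))
  have h2 : ρ = 1 / 2 := by
    apply Complex.ext
    · rw [h ρ hz]
      norm_num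
    · rw [h1]
      norm_num
  exact absurd (h2 ▸ hz) hhalf

end IsSelbergSharpFlat

end

theorem theorem2 (F : ℂ → ℂ) (D : GammaData) (hF : IsSelbergSharpFlat F D)
    (h0 : (0 : ℂ) ∉ nontrivialZeros F D) :
    -- all the quantities below are well defined
    ((∀ x : ℝ, (zerosUpTo F D x).Finite) ∧
      ∀ n : ℕ, 1 ≤ n →
        (∃ l : ℂ, Filter.Tendsto (liPartialSum F D n) Filter.atTop (nhds l)) ∧
        Summable (fun ρ : nontrivialZeros F D => chebyshevTerm F D n ρ) ∧
        MeasureTheory.IntegrableOn (chebyshevIntegrand F D n) (Set.Ioi 0)) ∧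
    -- the representation as a sum over the zeros
    (GRH F D ↔ ∀ n : ℕ, 1 ≤ n →
      (liCoeff F D n).re = ∑' ρ : nontrivialZeros F D, chebyshevTerm F D n ρ) ∧
    -- the integral representation, if the central point is not a zero
    ((1 / 2 : ℂ) ∉ nontrivialZeros F D →
      (GRH F D ↔ ∀ n : ℕ, 1 ≤ n →
        (liCoeff F D n).re = 16 * (n : ℝ) * (∫ x in Set.Ioi (0 : ℝ), chebyshevIntegrand F D n x)
          - (1 - (-1 : ℝ) ^ n) * (zeroCount F D 0 : ℝ))) ∧
    -- the integral representation, without restriction on the central point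
    (GRH F D ↔ ∀ n : ℕ, 1 ≤ n →
      (liCoeff F D n).re =
        16 * (n : ℝ) * (∫ x in Set.Ioi (0 : ℝ), chebyshevIntegrand F D n x)) := by
  have h0' : xi F D 0 ≠ 0 := h0
  have hI : ∀ n : ℕ, 16 * (n : ℝ) * (∫ x in Set.Ioi (0 : ℝ), chebyshevIntegrand F D n x) =
      ∑' ρ : nontrivialZeros F D, chebyshevTerm F D n ρ := fun n => (hF.integrableOn_and_integral_chebyshevIntegrand h0' n).2
  have ha : GRH F D ↔ ∀ n : ℕ, 1 ≤ n →
      (liCoeff F D n).re = ∑' ρ : nontrivialZeros F D, chebyshevTerm F D n ρ :=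
    ⟨fun h n _ => hF.re_liCoeff_eq_tsum h0' h n, fun h =>
      hF.GRH_of_re_liCoeff_bounded_below h0' (B := 0) fun n hn => by
        rw [h n hn]
        exact IsSelbergSharpFlat.tsum_chebyshevTerm_nonneg F D n⟩
  refine ⟨⟨hF.finite_zerosUpTo h0', fun n _ => ⟨?_, hF.summable_chebyshevTerm h0' n,
    (hF.integrableOn_and_integral_chebyshevIntegrand h0' n).1⟩⟩, ha, fun hhalf => ⟨fun h n _ => ?_, fun h => ?_⟩, ?_⟩
  · obtain ⟨l, hl, -⟩ := hF.exists_tendsto_liPartialSum h0' n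
    exact ⟨l, hl⟩
  · rw [hI, hF.zeroCount_zero_of_GRH h0' h hhalf, hF.re_liCoeff_eq_tsum h0' h]
    simp
  · -- the correction term is bounded, so the right side is still bounded below
    refine hF.GRH_of_re_liCoeff_bounded_below h0' (B := -(2 * (zeroCount F D 0 : ℝ))) fun n hn => ?_
    rw [h n hn, hI]
    have h1 := IsSelbergSharpFlat.tsum_chebyshevTerm_nonneg F D n
    have h2 : 1 - (-1 : ℝ) ^ n ≤ 2 := by
      rcases neg_one_pow_eq_or ℝ n with h | h <;> rw [h] <;> norm_num
    nlinarith [(Nat.cast_nonneg (zeroCount F D 0) : (0 : ℝ) ≤ _)]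
  · simp only [hI]
    exact ha
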